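/- Let $Y$ be a closed, oriented 3-manifold, let $L=K_1\cup\dots\cup K_l\subset Y$ be an $l$-component framed link, and let $W$ be the cobordism from $Y$ to the surgered manifold $Y'$ obtained by attaching to a thickening of $Y$ one 2-handle $h_i$ along each $K_i$ (with corners smoothed). Identify a vertex $I\in\{0,1\}^l$ with the set $\{i: I_i=1\}$; $I$ is internal if $I\neq\emptyset,\{1,\dots,l\}$. A chain is a (possibly empty) totally ordered set of internal vertices, and chains are ordered by inclusion. For $I$ internal let $Y_I\subset W$ be the standard hypersurface passing above the handles $h_i$ with $i\in I$ and below the handles $h_i$ with $i\notin I$: list the vertices by increasing weight and then numerically, starting in position $0$; if $I$ is in position $q$, then $Y_I$ is the graph, over $Y$ surgered along the $K_i$ with $i\in I$, of the height $-1+q/2^l+\sum_{i\in I}\chi_i$, where the height on $W$ runs from $-1$ on $Y$ to $1$ on $Y'$ with the handles at height $0$, and $\chi_i$ is a radial cut-off function equal to $1$ near $K_i$ and supported in a tubular neighbourhood of $K_i$. Let $P_l\subset\mathbb R^l$ be the convex hull of the points whose coordinates are a permutation of $(1,\dots,l)$. (a) Each internal $Y_I$ is compact and separates $W$ into a lower part,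 open, containing $Y$ and the cores of the $h_i$, $i\in I$, and an upper part, open, containing $Y'$ and the cocores of the $h_i$, $i\notin I$. For $I\ne J$, $Y_I\cap Y_J=\emptyset$ if and only if $I\subset J$ or $J\subset I$; if $I\subsetneq J$, then $Y_I$ lies below $Y_J$. (b) The poset of nonempty faces of $P_l$ (including $P_l$ itself) is anti-isomorphic to the poset of chains. The chain $c(F)$ of a face $F$ consists of the internal $I$ with $\sum_{i\in I}x_i=\tfrac{|I|(|I|+1)}2$ for all $x\in F$, and $\dim F+|c(F)|=\dim P_l$ (where $\dim P_l=l-1$ for $l\ge1$, and $\dim P_0=0$). In particular the facets of $P_l$ correspond to the single internal hypersurfaces $Y_I$. (c) There are Riemannian metrics $g_0$ on $W$ that are cylindrical near every internal $Y_I$ and near $\partial W$, i.e. equal to $dt^2+h$ on a collar. For each such $g_0$, with chosen collars, there are $\delta>0$, functions $T_I:P_l\to[0,\infty]$ ($I$ internal) and a family of metrics $(g_p)_{p\in P_l}$ as follows. 1. The $\delta$-collars of $Y_I$ and $Y_J$ are disjoint for $I\subsetneq J$. The map $p\mapsto (T_I(p))_I$ is a homeomorphism from $P_l$ onto the complex of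 all $(T_I)_I$ in $[0,\infty]$ such that $\{I:T_I\ne0\}$ is a chain (the union of the cubes $[0,\infty]^{\gamma}$ over the maximal chains $\gamma$, glued along their common faces), and $T_I(p)>0$ if and only if $p_i<p_j$ for all $i\in I$, $j\notin I$. 2. The metric $g_p$ is obtained from $g_0$ by inserting, for every $I$, a neck $[-T_I(p),T_I(p)]\times Y_I$ along $Y_I$: on the $\delta$-collar of $Y_I$ with $T_I(p)\neq 0$ it is $\lambda_{p,I}(t)^2dt^2+h$ with $\lambda_{p,I}\ge1$, $\lambda_{p,I}(t)=1$ for $|t|\ge\delta$ and $\int_{-\delta}^0\lambda_{p,I}=\int_0^\delta\lambda_{p,I}=\delta+T_I(p)$, and outside these collars it is $g_0$. If $T_I(p)=\infty$, then $\lambda_{p,I}$ is considered for $t\ne0$ only, and the metric is degenerate on $Y_I$: the neck is broken into two half-infinite cylindrical ends. So $g_p$ is a smooth Riemannian metric on $W\setminus\bigcup_{T_I(p)=\infty}Y_I$. Some neighbourhood of $\partial W$, independent of $p$, satisfies $g_p=g_0$ on it for all $p$. 3. A point $p\in P_l$ lies in the relative interior of a face $F$ if and only if $\{I: T_I(p)=\infty\}=c(F)$;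 thus the open faces parametrize the metrics degenerate on precisely the corresponding chain. 4. For $p$ in the relative interior of $P_l$, $g_p$ is a smooth non-degenerate Riemannian metric on $W$. It depends smoothly on $(p,w)\in \operatorname{relint}P_l\times W$, and each $T_I$ is smooth on $\operatorname{relint}P_l$. 5. Up to the boundary, $g_p(w)$ is continuous on $\{(p,w): w\notin Y_I\text{ whenever }T_I(p)=\infty\}$, and so is every $t$-derivative of $\lambda_{p,I}(t)$ on $\{(p,t): t\neq0 \text{ if } T_I(p)=\infty\}$. -/

import Mathlib

open Set Manifold Bundle Topology MeasureTheory
open scoped ContDiff ENNReal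

noncomputable section

/-! ### The permutohedron and its faces -/

/-- The permutohedron of order `l`: the convex hull in `ℝ^l` of all points whose coordinates are a
permutation of `1, …, l`. -/
def permutohedron (l : ℕ) : Set (Fin l → ℝ) :=
  convexHull ℝ (range fun σ : Equiv.Perm (Fin l) => fun i : Fin l => ((σ i : ℕ) : ℝ) + 1)

/-- The (nonempty) faces of the permutohedron, the polytope itself included, ordered by
inclusion. For a convex polytope the faces are the sets on which a linear functional attains
its maximum. -/
abbrev PermFace (l : ℕ) : Type :=
  {F : Set (Fin l → ℝ) // IsExposed ℝ (permutohedron l) F ∧ F.Nonempty}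

/-! ### Internal vertices of the hypercube and chains -/

/-- The internal vertices of the hypercube `{0,1}^l`: all vertices but `0…0` and `1…1`. A vertex is
encoded by the set of coordinates that are equal to `1`; the order is inclusion. -/
abbrev InternalVertex (l : ℕ) : Type :=
  {I : Finset (Fin l) // I ≠ ∅ ∧ I ≠ Finset.univ}

/-- The poset of chains (totally ordered sets, the empty one included) of internal vertices,
ordered by inclusion. -/
abbrev VertexChain (l : ℕ) : Type :=
  {c : Finset (InternalVertex l) // IsChain (· ≤ ·) (c : Set (InternalVertex l))}

/-- The cube complex of neck lengths: one length in `[0,∞]` for every internal vertex, the vertices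
with non-zero length forming a chain. It is the union of the cubes `[0,∞]^γ`, one for each maximal
chain `γ`, glued along their common faces `{T_I = 0}`. -/
abbrev NeckComplex (l : ℕ) : Type :=
  {T : InternalVertex l → ℝ≥0∞ // IsChain (· ≤ ·) {I | T I ≠ 0}}

/-- Position of a vertex in the list of all vertices of `{0,1}^l`, first in order of increasing
weight and then numerically within each weight class (starting with position `0` for `0…0`). -/
def vertexRank {l : ℕ} (I : Finset (Fin l)) : ℕ :=
  (Finset.univ.filter fun J : Finset (Fin l) =>
    J.card * 2 ^ l + ∑ i ∈ J, 2 ^ (i : ℕ) < I.card * 2 ^ l + ∑ i ∈ I, 2 ^ (i : ℕ)).card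

/-- The background level `-1 + q / 2^l ∈ [-1, 0)` of the vertex in position `q`. -/
def vertexLevel {l : ℕ} (I : Finset (Fin l)) : ℝ := -1 + (vertexRank I : ℝ) / 2 ^ l

/-- A smooth cut-off function of the radius: `1` for `r ≤ 1/3`, `0` for `r ≥ 2/3`, strictly
decreasing in between. -/
def radialCutoff (r : ℝ) : ℝ := Real.smoothTransition (2 - 3 * r)

/-! ### Framed links and the surgery cobordism -/

/-- An `l`-component framed link in a 3-manifold `Y`. A framing of a knot is recorded by a
parametrization of a tubular neighbourhood by `S¹ × D²` (`D²` the open unit disc in `ℂ`), the knot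
being the image of `S¹ × 0`. -/
structure FramedLink (l : ℕ) (Y : Type*) [TopologicalSpace Y]
    [ChartedSpace (EuclideanSpace ℝ (Fin 3)) Y] where
  /-- the parametrized tubular neighbourhood of the `i`-th component -/
  tube : Fin l → OpenPartialHomeomorph (Circle × ℂ) Y
  tube_source : ∀ i, (tube i).source = univ ×ˢ Metric.ball (0 : ℂ) 1
  smooth_tube : ∀ i, ContMDiffOn ((𝓡 1).prod 𝓘(ℝ, ℂ)) (𝓡 3) ∞ (tube i) (tube i).source
  smooth_tube_symm : ∀ i,
    ContMDiffOn (𝓡 3) ((𝓡 1).prod 𝓘(ℝ, ℂ)) ∞ (tube i).symm (tube i).target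
  disjoint_tube : ∀ i j, i ≠ j → Disjoint (tube i).target (tube j).target

namespace FramedLink

variable {l : ℕ} {Y : Type*} [TopologicalSpace Y] [ChartedSpace (EuclideanSpace ℝ (Fin 3)) Y]

/-- The union of the components of the link. -/
def carrier (L : FramedLink l Y) : Set Y := {z | ∃ i, ∃ u : Circle, z = L.tube i (u, 0)}

/-- The function on `Y` that is `1` near the `i`-th component and `0` outside its tubular
neighbourhood, a function of the distance to the core in the given parametrization. -/
def bump (L : FramedLink l Y) (i : Fin l) (z : Y) : ℝ :=
  open Classical in
  if z ∈ (L.tube i).target then radialCutoff ‖((L.tube i).symm z).2‖ else 0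

/-- The part of the surgery cobordism not touched by the cocores of the handles:
`Y × [-1,1]` with `K_i × [0,1]` removed for every component `K_i`. -/
def baseRegion (L : FramedLink l Y) : Set (Y × ℝ) :=
  {p | |p.2| ≤ 1 ∧ (p.1 ∈ L.carrier → p.2 < 0)}

end FramedLink

/-- The 2-handle `D² × D²` without corners: the points `(x, y) ∈ ℂ × ℂ` with `‖x‖ ‖y‖ < 1` and
`-1 ≤ ‖y‖² - ‖x‖² ≤ 1`. The core is `{y = 0}`, the cocore is `{x = 0}`. -/
def handleRegion : Set (ℂ × ℂ) := {p | ‖p.1‖ * ‖p.2‖ < 1 ∧ |‖p.2‖ ^ 2 - ‖p.1‖ ^ 2| ≤ 1}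

/-- The structure, on a smooth 4-manifold with boundary `W`, of the cobordism obtained from the
thickening of `Y` by attaching a 2-handle along each component of the framed link `L`. This is
the usual corner-free description of handle attachment (the trace of the surgery on
`L`): `W` is the union of the open pieces `base` and `handle i`, where the handle is glued to the
base along `{x ≠ 0}` by `(r u, y) ∼ (φ_i (u, r y), ‖y‖² - r²)`, for `u ∈ S¹`, `r > 0` and `φ_i` the
framed tubular neighbourhood. These data determine `W` up to diffeomorphism. -/
structure SurgeryCobordism {l : ℕ} {Y : Type*} [TopologicalSpace Y]
    [ChartedSpace (EuclideanSpace ℝ (Fin 3)) Y] (L : FramedLink l Y)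
    (W : Type*) [TopologicalSpace W] [ChartedSpace (EuclideanHalfSpace 4) W] where
  /-- the diffeomorphism from `baseRegion` onto an open part of `W` -/
  base : PartialEquiv (Y × ℝ) W
  base_source : base.source = L.baseRegion
  isOpen_base : IsOpen base.target
  smooth_base : ContMDiffOn ((𝓡 3).prod 𝓘(ℝ, ℝ)) (𝓡∂ 4) ∞ base base.source
  smooth_base_symm : ContMDiffOn (𝓡∂ 4) ((𝓡 3).prod 𝓘(ℝ, ℝ)) ∞ base.symm base.target
  /-- the diffeomorphism from the `i`-th 2-handle onto an open part of `W` -/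
  handle : Fin l → PartialEquiv (ℂ × ℂ) W
  handle_source : ∀ i, (handle i).source = handleRegion
  isOpen_handle : ∀ i, IsOpen (handle i).target
  smooth_handle : ∀ i, ContMDiffOn 𝓘(ℝ, ℂ × ℂ) (𝓡∂ 4) ∞ (handle i) (handle i).source
  smooth_handle_symm : ∀ i,
    ContMDiffOn (𝓡∂ 4) 𝓘(ℝ, ℂ × ℂ) ∞ (handle i).symm (handle i).target
  glue : ∀ (i : Fin l) (u : Circle) (r : ℝ) (y : ℂ), 0 < r →
    ((r : ℂ) * (u : ℂ), y) ∈ handleRegion →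
      handle i ((r : ℂ) * (u : ℂ), y) = base (L.tube i (u, (r : ℂ) * y), ‖y‖ ^ 2 - r ^ 2)
  cocore_notMem_base : ∀ (i : Fin l) (y : ℂ), ((0 : ℂ), y) ∈ handleRegion →
    handle i (0, y) ∉ base.target
  disjoint_cocore : ∀ (i j : Fin l) (y y' : ℂ), i ≠ j → ((0 : ℂ), y) ∈ handleRegion →
    ((0 : ℂ), y') ∈ handleRegion → handle i (0, y) ≠ handle j (0, y')
  cover : base.target ∪ ⋃ i, (handle i).target = univ

namespace SurgeryCobordism

variable {l : ℕ} {Y : Type*} [TopologicalSpace Y] [ChartedSpace (EuclideanSpace ℝ (Fin 3)) Y]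
  {L : FramedLink l Y} {W : Type*} [TopologicalSpace W] [ChartedSpace (EuclideanHalfSpace 4) W]

/-- The height function `W → [-1,1]`: the coordinate of `[-1,1]` on the base and `‖y‖² - ‖x‖²` on
the handles. -/
def height (C : SurgeryCobordism L W) (w : W) : ℝ :=
  open Classical in
  if w ∈ C.base.target then (C.base.symm w).2
  else ∑ i, if w ∈ (C.handle i).target then
    ‖((C.handle i).symm w).2‖ ^ 2 - ‖((C.handle i).symm w).1‖ ^ 2 else 0

/-- The height at which the hypersurface `Y_I` passes over or under a point of `Y`. Away from the
components `K_i` with `i ∈ I` it is the background level of `I`, which is negative (so `Y_I` passes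
below the handles `h_i`, `i ∉ I`); near `K_i`, `i ∈ I`, it is larger by `1`, hence positive (so
`Y_I` passes above the handle `h_i`). The second case concerns the cocores. -/
def cutHeight (C : SurgeryCobordism L W) (I : Finset (Fin l)) (w : W) : ℝ :=
  open Classical in
  if w ∈ C.base.target then vertexLevel I + ∑ i ∈ I, L.bump i (C.base.symm w).1
  else vertexLevel I + ∑ i ∈ I, if w ∈ (C.handle i).target then 1 else 0

/-- The hypersurface `Y_I` in `W`, for an internal vertex `I`: the upper boundary of the
thickening of `Y` with the handles `h_i`, `i ∈ I`, attached. -/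
def hypersurface (C : SurgeryCobordism L W) (I : InternalVertex l) : Set W :=
  {w | C.height w = C.cutHeight I.1 w}

/-- The part of `W` below `Y_I`, i.e. the interior side of the cobordism from `Y` to `Y_I`. -/
def below (C : SurgeryCobordism L W) (I : InternalVertex l) : Set W :=
  {w | C.height w < C.cutHeight I.1 w}

/-- The part of `W` above `Y_I`. -/
def above (C : SurgeryCobordism L W) (I : InternalVertex l) : Set W :=
  {w | C.cutHeight I.1 w < C.height w}

/-- The incoming end `Y` of `W`. -/
def incoming (C : SurgeryCobordism L W) : Set W := {w | C.height w = -1}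

/-- The outgoing end `Y'` of `W`. -/
def outgoing (C : SurgeryCobordism L W) : Set W := {w | C.height w = 1}

end SurgeryCobordism

/-! ### Metrics with cylindrical collars, and neck stretching -/

section Metrics

variable {W : Type*} [TopologicalSpace W] [ChartedSpace (EuclideanHalfSpace 4) W]
  [IsManifold (𝓡∂ 4) ∞ W]

/-- A field of bilinear forms on the tangent spaces of `W`. -/
abbrev BilinField (W : Type*) [TopologicalSpace W] [ChartedSpace (EuclideanHalfSpace 4) W] :
    Type _ :=
  ∀ w : W, TangentSpace (𝓡∂ 4) w →L[ℝ] TangentSpace (𝓡∂ 4) w →L[ℝ] ℝ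

/-- Smooth Riemannian metrics on the compact manifold with boundary `W`. -/
abbrev SmoothMetric (W : Type*) [TopologicalSpace W] [ChartedSpace (EuclideanHalfSpace 4) W]
    [IsManifold (𝓡∂ 4) ∞ W] : Type _ :=
  ContMDiffRiemannianMetric (𝓡∂ 4) ∞ (EuclideanSpace ℝ (Fin 4))
    (fun w : W => TangentSpace (𝓡∂ 4) w)

/-- A field of bilinear forms, as a section of the bundle of bilinear forms. -/
def BilinField.toSection (g : BilinField W) (w : W) :
    TotalSpace (EuclideanSpace ℝ (Fin 4) →L[ℝ] EuclideanSpace ℝ (Fin 4) →L[ℝ] ℝ)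
      (fun w : W => TangentSpace (𝓡∂ 4) w →L[ℝ] TangentSpace (𝓡∂ 4) w →L[ℝ] ℝ) :=
  TotalSpace.mk' (EuclideanSpace ℝ (Fin 4) →L[ℝ] EuclideanSpace ℝ (Fin 4) →L[ℝ] ℝ) w (g w)

/-- `g` is a smooth Riemannian metric on the open subset `U` of `W`. -/
structure IsRiemannianOn (g : BilinField W) (U : Set W) : Prop where
  symm : ∀ w ∈ U, ∀ v v' : TangentSpace (𝓡∂ 4) w, g w v v' = g w v' v
  pos : ∀ w ∈ U, ∀ v : TangentSpace (𝓡∂ 4) w, v ≠ 0 → 0 < g w v v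
  smooth : ContMDiffOn (𝓡∂ 4) ((𝓡∂ 4).prod
    𝓘(ℝ, EuclideanSpace ℝ (Fin 4) →L[ℝ] EuclideanSpace ℝ (Fin 4) →L[ℝ] ℝ)) ∞ g.toSection U

/-- The differential of a real function on `W`, as a linear form on the tangent space. -/
def coordDiff (f : W → ℝ) (w : W) : TangentSpace (𝓡∂ 4) w →L[ℝ] ℝ :=
  mfderiv (𝓡∂ 4) 𝓘(ℝ, ℝ) f w

/-- A collar `S × J` of the hypersurface `S` in `W`, `J = (-ε, ε) ∩ D`, on which the metric `g` is
cylindrical, i.e. equal to `dt² + h` for the metric `h` induced by `g` on `S`. One takes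
`D = ℝ` for interior hypersurfaces and a closed half-line for boundary components. The open
neighbourhood of `S` is `chart.source`, and `chart` gives the two coordinates
`w ↦ (foot of w in S, t)`. -/
structure CylindricalCollar (g : SmoothMetric W) (S : Set W) (D : Set ℝ) where
  ε : ℝ
  ε_pos : 0 < ε
  chart : PartialEquiv W (W × ℝ)
  isOpen_source : IsOpen chart.source
  target_eq : chart.target = S ×ˢ (Ioo (-ε) ε ∩ D)
  chart_self : ∀ w ∈ S, w ∈ chart.source ∧ chart w = (w, 0)
  smooth_chart : ContMDiffOn (𝓡∂ 4) ((𝓡∂ 4).prod 𝓘(ℝ, ℝ)) ∞ chart chart.source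
  smooth_chart_symm :
    ContMDiffOn ((𝓡∂ 4).prod 𝓘(ℝ, ℝ)) (𝓡∂ 4) ∞ chart.symm chart.target
  cylindrical : ∀ w ∈ chart.source, ∀ v v' : TangentSpace (𝓡∂ 4) w,
    g.inner w v v' =
      coordDiff (fun z => (chart z).2) w v * coordDiff (fun z => (chart z).2) w v' +
        g.inner (chart w).1 (mfderiv (𝓡∂ 4) (𝓡∂ 4) (fun z => (chart z).1) w v)
          (mfderiv (𝓡∂ 4) (𝓡∂ 4) (fun z => (chart z).1) w v')

namespace CylindricalCollar

variable {g : SmoothMetric W} {S : Set W} {D : Set ℝ}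

/-- The collar of half-width `δ ≤ ε`. -/
def sub (K : CylindricalCollar g S D) (δ : ℝ) : Set W :=
  {w | w ∈ K.chart.source ∧ |(K.chart w).2| < δ}

/-- The bilinear form `dt ⊗ dt` on the collar. -/
def dtSq (K : CylindricalCollar g S D) (w : W) :
    TangentSpace (𝓡∂ 4) w →L[ℝ] TangentSpace (𝓡∂ 4) w →L[ℝ] ℝ :=
  (coordDiff (fun z => (K.chart z).2) w).smulRight (coordDiff (fun z => (K.chart z).2) w)

end CylindricalCollar

/-- An initial Riemannian metric on the surgery cobordism `W` that is cylindrical near every `Y_I`,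
the two ends of `W` included, with a choice of cylindrical collars. -/
structure AdaptedMetric {l : ℕ} {Y : Type*} [TopologicalSpace Y]
    [ChartedSpace (EuclideanSpace ℝ (Fin 3)) Y] {L : FramedLink l Y}
    (C : SurgeryCobordism L W) where
  metric : SmoothMetric W
  collar : ∀ I : InternalVertex l, CylindricalCollar metric (C.hypersurface I) univ
  collarIn : CylindricalCollar metric C.incoming (Ici 0)
  collarOut : CylindricalCollar metric C.outgoing (Iic 0)

/-- `prof : ℝ → ℝ` is the profile of a neck of half-length `T ∈ [0,∞]` spliced into a
collar `(-δ,δ) × S`: stretching the metric `dt² + h` of the collar to `prof(t)² dt² + h` makes each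
half of it a cylinder over `S` of length `δ + T`. So for `T < ∞` the stretched collar is
isometric to the collar cut open along `S` with `[-T,T] × S` inserted, and for `T = ∞` it is a pair
of half-infinite cylinders (the neck is broken along `S`, and `prof` is only relevant for
`t ≠ 0`). -/
structure IsNeckProfile (δ : ℝ) (T : ℝ≥0∞) (prof : ℝ → ℝ) : Prop where
  one_le : ∀ t, 1 ≤ prof t
  eq_one : ∀ t, δ ≤ |t| → prof t = 1
  smooth : ∀ t, (T = ⊤ → t ≠ 0) → ContDiffAt ℝ ∞ prof t
  length_left : ∫⁻ t in Ioo (-δ) 0, ENNReal.ofReal (prof t) = ENNReal.ofReal δ + T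
  length_right : ∫⁻ t in Ioo 0 δ, ENNReal.ofReal (prof t) = ENNReal.ofReal δ + T

/-- The metric obtained from the initial metric by stretching the collar of `Y_I` with the profile
`prof I`, for all internal `I`: it is `prof(t)² dt² + h` on a collar, and the initial metric
elsewhere. (Only meaningful where at most one `prof I` differs from `1`.) -/
def AdaptedMetric.stretch {l : ℕ} {Y : Type*} [TopologicalSpace Y]
    [ChartedSpace (EuclideanSpace ℝ (Fin 3)) Y] {L : FramedLink l Y}
    {C : SurgeryCobordism L W} (A : AdaptedMetric C) (prof : InternalVertex l → ℝ → ℝ) :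
    BilinField W := fun w =>
  open Classical in
  A.metric.inner w + ∑ I : InternalVertex l,
    if w ∈ (A.collar I).chart.source then
      (prof I ((A.collar I).chart w).2 ^ 2 - 1) • (A.collar I).dtSq w
    else 0

end Metrics

end

/-! Combinatorics. Put slack_I(x) = Σ_{i∈I} x_i − |I|(|I|+1)/2. Sort the coordinates by the
coefficients of a linear functional; summation by parts then writes the functional, minus its value
at the corresponding vertex of the permutohedron, as a combination with nonnegative coefficients of
slacks of nested sets. Together with Hahn-Banach this shows that P_l is cut out by slack_I ≥ 0 for
all I and slack = 0 for the full set (`permutohedron_eq_permPolytope`), and the equality case shows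
that every face is given by the vanishing of some slacks. If slack_I(x) = 0, then x_i ≤ |I| < |I|+1
≤ x_j for i ∈ I, j ∉ I, so the sets that are tight at a point form a chain. Faces thus correspond to
chains, and the dimension formula is the linear independence of the indicator functions of a chain.

Neck lengths. Take T_I = E_I/(1−E_I), where E_I(x) is the product over i ∈ I, j ∉ I of
exp(−slack_I(x)/(x_j−x_i)), a factor being 0 when x_j ≤ x_i. Then E_I > 0 exactly when all
coordinates in I are smaller than those outside, which forces a chain, and E_I = 1 exactly when
slack_I = 0. For a sorted point only initial segments matter, and −log E_k is the k-th slack times a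
repulsion Σ 1/(x_j−x_i) across the k-th gap. The resulting map to the cube complex is injective by a
discrete maximum principle (`repulsion_lt`, `partialSum_le_of_gates_eq`) and surjective because a
point that maximizes the total slack under the constraints E_k ≥ c_k must have equality everywhere
(`exists_monotone_neckCoord_eq`). Compactness turns this continuous bijection into a homeomorphism.

Stretching. The profile of a neck is an explicit function of (E,t), the derivative of a rational
expression in a smooth step. For E in [0,1] it is smooth in both variables except at E = 1, t = 0.
Substituting E = E_I(p) yields all regularity claims about g_p.

Existence of cylindrical metrics. The hypersurfaces Y_I and Y_J of incomparable vertices intersect,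
so their collars cannot be treated separately. They meet only inside tubes of components K_i with i
in exactly one of I, J, and only where χ_i is well inside (0,1). There the normal coordinates are h
− χ_i and h up to constants, with h the height, so that (χ_i, h) can be translated along one while
the other is kept. This gives collars with commuting motions (`wallSystem`), continued over the
cocores by the hyperbolic flow of the handles. Collapsing all collars along their motions, embedding
the result in a euclidean space and adjoining the cut-off normal coordinates gives an immersion. All
its components but t_a factor through the projection to the a-th hypersurface near it, so the
induced metric is dt² + h along every hypersurface simultaneously (`CollarSystem.exists_metric`). -/

noncomputable section

/-! ### Fields of bilinear forms in local trivializations -/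

section Sections

variable {W : Type*} [TopologicalSpace W] [ChartedSpace (EuclideanHalfSpace 4) W]

local notation "E4" => EuclideanSpace ℝ (Fin 4)
local notation "TW" => (TangentSpace (𝓡∂ 4) : W → Type _)

lemma sum_dsq_pos {ι : Type*} [Fintype ι] (F : ι → W → ℝ)
    (hinj : ∀ w (v : TangentSpace (𝓡∂ 4) w), (∀ a, coordDiff (F a) w v = 0) → v = 0)
    (w : W) (v : TangentSpace (𝓡∂ 4) w) (hv : v ≠ 0) :
    0 < (∑ a, (coordDiff (F a) w).smulRight (coordDiff (F a) w)) v v := by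
  by_contra hcon
  apply hv
  apply hinj
  intro a
  simp only [sum_apply, ContinuousLinearMap.smulRight_apply,
    smul_apply, smul_eq_mul, not_lt] at hcon
  have h0 : ∑ a, coordDiff (F a) w v * coordDiff (F a) w v = 0 :=
    le_antisymm hcon (Finset.sum_nonneg fun a _ => mul_self_nonneg _)
  have := (Finset.sum_eq_zero_iff_of_nonneg (fun a _ => mul_self_nonneg _)).1 h0 a
    (Finset.mem_univ _)
  exact mul_self_eq_zero.1 this

variable [IsManifold (𝓡∂ 4) ∞ W]

/-- A bilinear form on a tangent space, read in the trivialization at `w₀`. -/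
def bilinCoord (w₀ w : W) (φ : TangentSpace (𝓡∂ 4) w →L[ℝ] TangentSpace (𝓡∂ 4) w →L[ℝ] ℝ) :
    E4 →L[ℝ] E4 →L[ℝ] ℝ :=
  ContinuousLinearMap.inCoordinates E4 (fun w : W => TangentSpace (𝓡∂ 4) w)
      (E4 →L[ℝ] ℝ) (fun w : W => TangentSpace (𝓡∂ 4) w →L[ℝ] ℝ) w₀ w w₀ w φ

/-- A linear form on a tangent space, read in the trivialization at `w₀`. -/
def linCoord (w₀ w : W) (φ : TangentSpace (𝓡∂ 4) w →L[ℝ] ℝ) : E4 →L[ℝ] ℝ :=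
  φ.comp ((trivializationAt E4 (TangentSpace (𝓡∂ 4)) w₀).symmL ℝ w)

lemma bilinCoord_apply {w₀ w : W} (hw : w ∈ (trivializationAt E4 TW w₀).baseSet)
    (φ : TangentSpace (𝓡∂ 4) w →L[ℝ] TangentSpace (𝓡∂ 4) w →L[ℝ] ℝ) (v v' : E4) :
    bilinCoord w₀ w φ v v' = φ ((trivializationAt E4 TW w₀).symm w v)
      ((trivializationAt E4 TW w₀).symm w v') := by
  have := inCoordinates_apply_eq₂ (𝕜 := ℝ) (E₁ := TW) (E₂ := TW) (E₃ := fun _ : W => ℝ)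
    (F₁ := E4) (F₂ := E4) (F₃ := ℝ) (ϕ := φ) (v := v) (w := v') hw hw (x₀ := w₀) (by simp)
  simpa [bilinCoord] using this

lemma linCoord_apply {w₀ w : W} (hw : w ∈ (trivializationAt E4 TW w₀).baseSet) (φ : TangentSpace (𝓡∂ 4) w →L[ℝ] ℝ) (v : E4) :
    linCoord w₀ w φ v = φ ((trivializationAt E4 TW w₀).symm w v) := by
  simp [linCoord, Trivialization.symmL_apply _ hw]

lemma bilinCoord_smulRight {w₀ w : W} (hw : w ∈ (trivializationAt E4 TW w₀).baseSet)
    (φ ψ : TangentSpace (𝓡∂ 4) w →L[ℝ] ℝ) :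
    bilinCoord w₀ w (φ.smulRight ψ) = (linCoord w₀ w φ).smulRight (linCoord w₀ w ψ) := by
  ext v v'
  rw [bilinCoord_apply hw]
  simp [linCoord_apply hw]

lemma bilinCoord_add (w₀ w : W)
    (φ ψ : TangentSpace (𝓡∂ 4) w →L[ℝ] TangentSpace (𝓡∂ 4) w →L[ℝ] ℝ) :
    bilinCoord w₀ w (φ + ψ) = bilinCoord w₀ w φ + bilinCoord w₀ w ψ := by
  simp [bilinCoord, ContinuousLinearMap.inCoordinates]

lemma bilinCoord_smul (w₀ w : W) (a : ℝ)
    (φ : TangentSpace (𝓡∂ 4) w →L[ℝ] TangentSpace (𝓡∂ 4) w →L[ℝ] ℝ) :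
    bilinCoord w₀ w (a • φ) = a • bilinCoord w₀ w φ := by
  simp [bilinCoord, ContinuousLinearMap.inCoordinates]

lemma bilinCoord_zero (w₀ w : W) :
    bilinCoord w₀ w 0 = 0 := by
  simp [bilinCoord, ContinuousLinearMap.inCoordinates]

lemma bilinCoord_zero_smul (w₀ w : W)
    (φ : TangentSpace (𝓡∂ 4) w →L[ℝ] TangentSpace (𝓡∂ 4) w →L[ℝ] ℝ) :
    (0 : ℝ) • bilinCoord w₀ w φ = 0 := by
  rw [← bilinCoord_smul, ← bilinCoord_zero w₀ w]
  congr 1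
  ext
  simp

lemma continuousAdd_clm (F G : Type*) [NormedAddCommGroup F] [NormedSpace ℝ F]
    [NormedAddCommGroup G] [NormedSpace ℝ G] : ContinuousAdd (F →L[ℝ] G) := inferInstance

instance continuousAdd_bilin : ContinuousAdd (E4 →L[ℝ] E4 →L[ℝ] ℝ) :=
  continuousAdd_clm E4 (E4 →L[ℝ] ℝ)

lemma bilinCoord_sum (w₀ w : W) {ι : Type*} (s : Finset ι)
    (φ : ι → TangentSpace (𝓡∂ 4) w →L[ℝ] TangentSpace (𝓡∂ 4) w →L[ℝ] ℝ) :
    bilinCoord w₀ w (∑ i ∈ s, φ i) = ∑ i ∈ s, bilinCoord w₀ w (φ i) := by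
  classical
  induction s using Finset.induction_on with
  | empty => simp [bilinCoord_zero]
  | insert a s ha ih => rw [Finset.sum_insert ha, bilinCoord_add, ih, Finset.sum_insert ha]

/-- Reduces smoothness in the bundle of forms to smoothness of a map into one fixed normed space,
the trivialization at q x₀. It is stated along a map q so that it serves both a single metric (q the
identity of W) and a family (q the projection from parameters times W). -/
lemma contMDiffWithinAt_section_iff {EX HX X : Type*} [NormedAddCommGroup EX] [NormedSpace ℝ EX]
    [TopologicalSpace HX] {IX : ModelWithCorners ℝ EX HX} [TopologicalSpace X] [ChartedSpace HX X]
    {q : X → W} {s : Set X} {x₀ : X}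
    (G : ∀ x, TangentSpace (𝓡∂ 4) (q x) →L[ℝ] TangentSpace (𝓡∂ 4) (q x) →L[ℝ] ℝ) :
    ContMDiffWithinAt IX ((𝓡∂ 4).prod 𝓘(ℝ, E4 →L[ℝ] E4 →L[ℝ] ℝ)) ∞
      (fun x => TotalSpace.mk' (E := fun w : W =>
        TangentSpace (𝓡∂ 4) w →L[ℝ] TangentSpace (𝓡∂ 4) w →L[ℝ] ℝ)
        (E4 →L[ℝ] E4 →L[ℝ] ℝ) (q x) (G x)) s x₀ ↔
    ContMDiffWithinAt IX (𝓡∂ 4) ∞ q s x₀ ∧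
      ContMDiffWithinAt IX 𝓘(ℝ, E4 →L[ℝ] E4 →L[ℝ] ℝ) ∞
        (fun x => bilinCoord (q x₀) (q x) (G x)) s x₀ :=
  contMDiffWithinAt_hom_bundle _

lemma continuousWithinAt_section_iff {X : Type*} [TopologicalSpace X]
    {q : X → W} {s : Set X} {x₀ : X}
    (G : ∀ x, TangentSpace (𝓡∂ 4) (q x) →L[ℝ] TangentSpace (𝓡∂ 4) (q x) →L[ℝ] ℝ) :
    ContinuousWithinAt
      (fun x => TotalSpace.mk' (E := fun w : W =>
        TangentSpace (𝓡∂ 4) w →L[ℝ] TangentSpace (𝓡∂ 4) w →L[ℝ] ℝ)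
        (E4 →L[ℝ] E4 →L[ℝ] ℝ) (q x) (G x)) s x₀ ↔
    ContinuousWithinAt q s x₀ ∧
      ContinuousWithinAt (fun x => bilinCoord (q x₀) (q x) (G x)) s x₀ :=
  continuousWithinAt_hom_bundle (σ := RingHom.id ℝ)
    (fun x => TotalSpace.mk' (E := fun w : W =>
        TangentSpace (𝓡∂ 4) w →L[ℝ] TangentSpace (𝓡∂ 4) w →L[ℝ] ℝ)
        (E4 →L[ℝ] E4 →L[ℝ] ℝ) (q x) (G x))

lemma contMDiffAt_linCoord_coordDiff {f : W → ℝ} {w₀ : W}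
    (hf : ContMDiffAt (𝓡∂ 4) 𝓘(ℝ, ℝ) ∞ f w₀) :
    ContMDiffAt (𝓡∂ 4) 𝓘(ℝ, E4 →L[ℝ] ℝ) ∞ (fun w => linCoord w₀ w (coordDiff f w)) w₀ := by
  have h := hf.mfderiv_const (m := ∞) (by norm_num)
  refine h.congr_of_eventuallyEq (Filter.Eventually.of_forall fun w => ?_)
  simp only [linCoord, coordDiff, inTangentCoordinates, ContinuousLinearMap.inCoordinates]
  ext v
  simp
  rfl

lemma contMDiffAt_bilinCoord_dsq {f : W → ℝ} {w₀ : W}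
    (hf : ContMDiffAt (𝓡∂ 4) 𝓘(ℝ, ℝ) ∞ f w₀) :
    ContMDiffAt (𝓡∂ 4) 𝓘(ℝ, E4 →L[ℝ] E4 →L[ℝ] ℝ) ∞
      (fun w => bilinCoord w₀ w ((coordDiff f w).smulRight (coordDiff f w))) w₀ := by
  have h := contMDiffAt_linCoord_coordDiff hf
  have h2 : ContMDiffAt (𝓡∂ 4) 𝓘(ℝ, E4 →L[ℝ] E4 →L[ℝ] ℝ) ∞
      (fun w => (linCoord w₀ w (coordDiff f w)).smulRight (linCoord w₀ w (coordDiff f w))) w₀ := by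
    have hB : ContDiff ℝ ∞ (fun φ : E4 →L[ℝ] ℝ => φ.smulRight φ) := by
      fun_prop
    exact hB.contMDiff.contMDiffAt.comp w₀ h
  refine h2.congr_of_eventuallyEq ?_
  have : (trivializationAt E4 TW w₀).baseSet ∈ 𝓝 w₀ :=
    (trivializationAt E4 TW w₀).open_baseSet.mem_nhds (mem_baseSet_trivializationAt _ _ _)
  filter_upwards [this] with w hw
  exact bilinCoord_smulRight hw _ _

/-- By compactness of the unit sphere, B(v,v) ≥ m‖v‖² for some m > 0. This supplies the boundedness
field of a Riemannian metric on the bundle. -/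
lemma isVonNBounded_of_pos (B : E4 →L[ℝ] E4 →L[ℝ] ℝ) (hB : ∀ v, v ≠ 0 → 0 < B v v) :
    Bornology.IsVonNBounded ℝ {v : E4 | B v v < 1} := by
  have hc : Continuous fun v : E4 => B v v := by fun_prop
  obtain ⟨m, hm, hmB⟩ : ∃ m > 0, ∀ v ∈ Metric.sphere (0 : E4) 1, m ≤ B v v := by
    obtain ⟨v₀, hv₀, hmin⟩ := (isCompact_sphere (0 : E4) 1).exists_isMinOn
      (NormedSpace.sphere_nonempty.2 zero_le_one) hc.continuousOn
    refine ⟨B v₀ v₀, hB _ ?_, fun v hv => hmin hv⟩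
    rintro rfl
    simp at hv₀
  rw [NormedSpace.isVonNBounded_iff]
  refine (Metric.isBounded_closedBall (x := (0 : E4)) (r := 1 / m + 1)).subset ?_
  intro v hv
  rw [mem_closedBall_zero_iff]
  by_cases hv0 : v = 0
  · subst hv0; simp; positivity
  have hn : 0 < ‖v‖ := norm_pos_iff.2 hv0
  have h1 := hmB (‖v‖⁻¹ • v) (by simp [norm_smul, hn.ne'])
  simp only [map_smul, smul_apply, smul_eq_mul] at h1
  have h2 : m * ‖v‖ ^ 2 ≤ B v v := by
    have := mul_le_mul_of_nonneg_right h1 (sq_nonneg ‖v‖)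
    field_simp at this
    nlinarith
  have h3 : m * ‖v‖ ^ 2 < 1 := lt_of_le_of_lt h2 hv
  have h4 : ‖v‖ ^ 2 < 1 / m := by rw [lt_div_iff₀ hm]; linarith
  have h5 : 0 < 1 / m := by positivity
  nlinarith

/-- The Riemannian metric induced by an immersion into a euclidean space. -/
def immersionMetric {ι : Type*} [Fintype ι] (F : ι → W → ℝ)
    (hF : ∀ a, ContMDiff (𝓡∂ 4) 𝓘(ℝ, ℝ) ∞ (F a))
    (hinj : ∀ w (v : TangentSpace (𝓡∂ 4) w), (∀ a, coordDiff (F a) w v = 0) → v = 0) :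
    SmoothMetric W where
  inner w := ∑ a, (coordDiff (F a) w).smulRight (coordDiff (F a) w)
  symm w v v' := by
    simp [mul_comm]
  pos w v hv := by
    exact sum_dsq_pos F hinj w v hv
  isVonNBounded w := by
    refine isVonNBounded_of_pos (∑ a, (coordDiff (F a) w).smulRight (coordDiff (F a) w)) ?_
    intro v hv
    exact sum_dsq_pos F hinj w v hv
  contMDiff := by
    intro w₀
    rw [← contMDiffWithinAt_univ, contMDiffWithinAt_section_iff (q := fun w => w)]
    refine ⟨contMDiffWithinAt_id, ?_⟩
    simp_rw [bilinCoord_sum]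
    rw [contMDiffWithinAt_univ]
    apply ContMDiffAt.sum
    intro a _
    exact contMDiffAt_bilinCoord_dsq (hF a w₀)

lemma contMDiffAt_bilinCoord_metric (g : SmoothMetric W) (w₀ : W) :
    ContMDiffAt (𝓡∂ 4) 𝓘(ℝ, E4 →L[ℝ] E4 →L[ℝ] ℝ) ∞ (fun w => bilinCoord w₀ w (g.inner w)) w₀ := by
  have h := g.contMDiff w₀
  rw [← contMDiffWithinAt_univ, contMDiffWithinAt_section_iff (q := fun w => w)] at h
  exact contMDiffWithinAt_univ.1 h.2

/-! ### Smoothness and positivity of the stretched metric -/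

section Stretch

variable {l : ℕ} {Y : Type*} [TopologicalSpace Y]
    [ChartedSpace (EuclideanSpace ℝ (Fin 3)) Y] {L : FramedLink l Y}
    {C : SurgeryCobordism L W} (A : AdaptedMetric C)

lemma CylindricalCollar.contMDiffAt_coord {g : SmoothMetric W} {S : Set W} {D : Set ℝ}
    (K : CylindricalCollar g S D) {w : W} (hw : w ∈ K.chart.source) :
    ContMDiffAt (𝓡∂ 4) 𝓘(ℝ, ℝ) ∞ (fun z => (K.chart z).2) w :=
  contMDiffAt_snd.comp w ((K.smooth_chart w hw).contMDiffAt (K.isOpen_source.mem_nhds hw))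

/-- One summand of the stretched metric, in coordinates. -/
lemma bilinCoord_stretch (prof : InternalVertex l → ℝ → ℝ) (w₀ w : W) :
    bilinCoord w₀ w (A.stretch prof w) = bilinCoord w₀ w (A.metric.inner w) +
      ∑ I : InternalVertex l, open Classical in
        if w ∈ (A.collar I).chart.source then
          (prof I ((A.collar I).chart w).2 ^ 2 - 1) • bilinCoord w₀ w ((A.collar I).dtSq w)
        else 0 := by
  simp only [AdaptedMetric.stretch]
  rw [bilinCoord_add, bilinCoord_sum]
  congr 1
  refine Finset.sum_congr rfl fun I _ => ?_
  split_ifs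
  · rw [bilinCoord_smul]
  · rw [bilinCoord_zero]

/-- The summand of I is defined by cases on the chart domain, hence the alternative in `hprof`.
Inside the open chart the normal coordinate is smooth. Outside it the summand has to vanish nearby,
which holds if the profile is 1 on whatever part of the chart comes close. -/
lemma contMDiffWithinAt_stretch {EX HX X : Type*} [NormedAddCommGroup EX] [NormedSpace ℝ EX]
    [TopologicalSpace HX] {IX : ModelWithCorners ℝ EX HX} [TopologicalSpace X] [ChartedSpace HX X]
    {q : X → W} {s : Set X} {x₀ : X} (hx₀ : x₀ ∈ s) (prof : X → InternalVertex l → ℝ → ℝ)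
    (hq : ContMDiffWithinAt IX (𝓡∂ 4) ∞ q s x₀)
    (hprof : ∀ I, (q x₀ ∈ (A.collar I).chart.source ∧
        ContMDiffWithinAt IX 𝓘(ℝ, ℝ) ∞ (fun x => prof x I ((A.collar I).chart (q x)).2) s x₀) ∨
      ∀ᶠ x in 𝓝[s] x₀, q x ∈ (A.collar I).chart.source →
        prof x I ((A.collar I).chart (q x)).2 = 1) :
    ContMDiffWithinAt IX ((𝓡∂ 4).prod 𝓘(ℝ, E4 →L[ℝ] E4 →L[ℝ] ℝ)) ∞
      (fun x => (A.stretch (prof x)).toSection (q x)) s x₀ := by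
  unfold BilinField.toSection
  rw [contMDiffWithinAt_section_iff (fun x => A.stretch (prof x) (q x))]
  refine ⟨hq, ?_⟩
  simp_rw [bilinCoord_stretch]
  have h0 := (contMDiffAt_bilinCoord_metric A.metric (q x₀)).comp_contMDiffWithinAt x₀ hq
  refine h0.add ?_
  refine ContMDiffWithinAt.sum fun I _ => ?_
  rcases hprof I with ⟨hsrc, hsm⟩ | hev
  · have h1 : ContMDiffWithinAt IX 𝓘(ℝ, E4 →L[ℝ] E4 →L[ℝ] ℝ) ∞ (fun x =>
        (prof x I ((A.collar I).chart (q x)).2 ^ 2 - 1) •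
          bilinCoord (q x₀) (q x) ((A.collar I).dtSq (q x))) s x₀ := by
      refine ContMDiffWithinAt.smul ((hsm.pow 2).sub contMDiffWithinAt_const) ?_
      exact (contMDiffAt_bilinCoord_dsq
        ((A.collar I).contMDiffAt_coord hsrc)).comp_contMDiffWithinAt x₀ hq
    refine h1.congr_of_eventuallyEq_of_mem ?_ hx₀
    filter_upwards [hq.continuousWithinAt ((A.collar I).isOpen_source.mem_nhds hsrc)] with x hx
    exact if_pos hx
  · refine (contMDiffWithinAt_const (c := 0)).congr_of_eventuallyEq_of_mem ?_ hx₀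
    filter_upwards [hev] with x hx
    split_ifs with h
    · rw [hx h, one_pow, sub_self]
      exact bilinCoord_zero_smul _ _ _
    · rfl

lemma continuousWithinAt_stretch {X : Type*} [TopologicalSpace X]
    {q : X → W} {s : Set X} {x₀ : X} (hx₀ : x₀ ∈ s) (prof : X → InternalVertex l → ℝ → ℝ)
    (hq : ContinuousWithinAt q s x₀)
    (hprof : ∀ I, (q x₀ ∈ (A.collar I).chart.source ∧
        ContinuousWithinAt (fun x => prof x I ((A.collar I).chart (q x)).2) s x₀) ∨
      ∀ᶠ x in 𝓝[s] x₀, q x ∈ (A.collar I).chart.source →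
        prof x I ((A.collar I).chart (q x)).2 = 1) :
    ContinuousWithinAt (fun x => (A.stretch (prof x)).toSection (q x)) s x₀ := by
  unfold BilinField.toSection
  rw [continuousWithinAt_section_iff (fun x => A.stretch (prof x) (q x))]
  refine ⟨hq, ?_⟩
  simp_rw [bilinCoord_stretch]
  have h0 := (contMDiffAt_bilinCoord_metric A.metric (q x₀)).continuousAt.comp_continuousWithinAt hq
  refine h0.add ?_
  refine tendsto_finsetSum _ fun I _ => ?_
  rcases hprof I with ⟨hsrc, hsm⟩ | hev
  · have h1 : ContinuousWithinAt (fun x =>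
        (prof x I ((A.collar I).chart (q x)).2 ^ 2 - 1) •
          bilinCoord (q x₀) (q x) ((A.collar I).dtSq (q x))) s x₀ := by
      refine ContinuousWithinAt.smul ((hsm.pow 2).sub continuousWithinAt_const) ?_
      exact (contMDiffAt_bilinCoord_dsq
        ((A.collar I).contMDiffAt_coord hsrc)).continuousAt.comp_continuousWithinAt hq
    refine h1.congr_of_eventuallyEq_of_mem ?_ hx₀
    filter_upwards [hq ((A.collar I).isOpen_source.mem_nhds hsrc)] with x hx
    exact if_pos hx
  · refine (continuousWithinAt_const (b := 0)).congr_of_eventuallyEq_of_mem ?_ hx₀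
    filter_upwards [hev] with x hx
    split_ifs with h
    · rw [hx h, one_pow, sub_self]
      exact bilinCoord_zero_smul _ _ _
    · rfl

lemma stretch_apply (prof : InternalVertex l → ℝ → ℝ) (w : W)
    (v v' : TangentSpace (𝓡∂ 4) w) :
    A.stretch prof w v v' = A.metric.inner w v v' +
      ∑ I : InternalVertex l, open Classical in
        if w ∈ (A.collar I).chart.source then
          (prof I ((A.collar I).chart w).2 ^ 2 - 1) *
            (coordDiff (fun z => ((A.collar I).chart z).2) w v *
              coordDiff (fun z => ((A.collar I).chart z).2) w v')
        else 0 := by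
  simp only [AdaptedMetric.stretch, add_apply, sum_apply]
  congr 1
  refine Finset.sum_congr rfl fun I _ => ?_
  split_ifs
  · simp [CylindricalCollar.dtSq]
  · simp

lemma stretch_symm (prof : InternalVertex l → ℝ → ℝ) (w : W)
    (v v' : TangentSpace (𝓡∂ 4) w) : A.stretch prof w v v' = A.stretch prof w v' v := by
  rw [stretch_apply, stretch_apply, A.metric.symm]
  simp only [mul_comm]

lemma stretch_pos (prof : InternalVertex l → ℝ → ℝ) (hprof : ∀ I t, 1 ≤ prof I t) (w : W)
    (v : TangentSpace (𝓡∂ 4) w) (hv : v ≠ 0) : 0 < A.stretch prof w v v := by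
  rw [stretch_apply]
  refine add_pos_of_pos_of_nonneg (A.metric.pos w v hv) (Finset.sum_nonneg fun I _ => ?_)
  split_ifs
  · have := hprof I ((A.collar I).chart w).2
    exact mul_nonneg (by nlinarith) (mul_self_nonneg _)
  · exact le_rfl

/-- A smooth stretched metric is a Riemannian metric. -/
def stretchMetric (prof : InternalVertex l → ℝ → ℝ) (hprof : ∀ I t, 1 ≤ prof I t)
    (hsm : ContMDiff (𝓡∂ 4) ((𝓡∂ 4).prod 𝓘(ℝ, E4 →L[ℝ] E4 →L[ℝ] ℝ)) ∞
      (A.stretch prof).toSection) : SmoothMetric W where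
  inner := A.stretch prof
  symm := stretch_symm A prof
  pos := stretch_pos A prof hprof
  isVonNBounded w := isVonNBounded_of_pos (A.stretch prof w) (stretch_pos A prof hprof w)
  contMDiff := hsm

end Stretch

end Sections

/-! ### The profile of a neck as a function of (E, t) -/

section NeckProfile

/-- A smooth step from `0` at `t ≤ 0` to `1` at `t ≥ δ`. -/
def neckStep (δ t : ℝ) : ℝ := Real.smoothTransition (t / δ)

lemma contDiff_neckStep (δ : ℝ) : ContDiff ℝ ∞ (neckStep δ) :=
  Real.smoothTransition.contDiff.comp (contDiff_id.div_const δ)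

lemma contDiff_deriv_neckStep (δ : ℝ) : ContDiff ℝ ∞ (deriv (neckStep δ)) :=
  ((contDiff_infty_iff_deriv (𝕜 := ℝ)).1 (contDiff_neckStep δ)).2

lemma hasDerivAt_neckStep (δ t : ℝ) : HasDerivAt (neckStep δ) (deriv (neckStep δ) t) t :=
  ((contDiff_neckStep δ).differentiable (by simp) t).hasDerivAt

lemma neckStep_nonneg (δ t : ℝ) : 0 ≤ neckStep δ t := Real.smoothTransition.nonneg _

lemma neckStep_le_one (δ t : ℝ) : neckStep δ t ≤ 1 := Real.smoothTransition.le_one _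

variable {δ : ℝ} (hδ : 0 < δ)
include hδ

lemma monotone_neckStep : Monotone (neckStep δ) := fun _ _ h =>
  Real.smoothTransition.monotone (div_le_div_of_nonneg_right h hδ.le)

lemma neckStep_of_nonpos {t : ℝ} (ht : t ≤ 0) : neckStep δ t = 0 :=
  Real.smoothTransition.zero_of_nonpos (div_nonpos_of_nonpos_of_nonneg ht hδ.le)

lemma neckStep_of_le {t : ℝ} (ht : δ ≤ t) : neckStep δ t = 1 :=
  Real.smoothTransition.one_of_one_le ((one_le_div hδ).2 ht)

lemma neckStep_pos {t : ℝ} (ht : 0 < t) : 0 < neckStep δ t :=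
  Real.smoothTransition.pos_of_pos (div_pos ht hδ)

lemma deriv_neckStep_nonneg (t : ℝ) : 0 ≤ deriv (neckStep δ) t :=
  (monotone_neckStep hδ).deriv_nonneg

lemma deriv_neckStep_of_nonpos {t : ℝ} (ht : t ≤ 0) : deriv (neckStep δ) t = 0 := by
  apply IsLocalMin.deriv_eq_zero
  refine Filter.Eventually.of_forall fun s => ?_
  rw [neckStep_of_nonpos hδ ht]
  exact neckStep_nonneg _ _

lemma deriv_neckStep_of_le {t : ℝ} (ht : δ ≤ t) : deriv (neckStep δ) t = 0 := by
  apply IsLocalMax.deriv_eq_zero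
  refine Filter.Eventually.of_forall fun s => ?_
  rw [neckStep_of_le hδ ht]
  exact neckStep_le_one _ _

omit hδ in
/-- The stretching of one half of a neck of half-length `E / (1 - E)`. -/
def neckHalf (δ E t : ℝ) : ℝ := E * deriv (neckStep δ) t / (1 - E * (1 - neckStep δ t)) ^ 2

/-- The profile of a neck of half-length `E / (1 - E)`. -/
def neckProfile (δ E t : ℝ) : ℝ := 1 + neckHalf δ E t + neckHalf δ E (-t)

lemma neckHalf_nonneg {E : ℝ} (hE : 0 ≤ E) (t : ℝ) : 0 ≤ neckHalf δ E t :=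
  div_nonneg (mul_nonneg hE (deriv_neckStep_nonneg hδ t)) (sq_nonneg _)

lemma neckHalf_of_nonpos (E : ℝ) {t : ℝ} (ht : t ≤ 0) : neckHalf δ E t = 0 := by
  simp [neckHalf, deriv_neckStep_of_nonpos hδ ht]

lemma neckHalf_of_le (E : ℝ) {t : ℝ} (ht : δ ≤ t) : neckHalf δ E t = 0 := by
  simp [neckHalf, deriv_neckStep_of_le hδ ht]

lemma one_le_neckProfile {E : ℝ} (hE : 0 ≤ E) (t : ℝ) : 1 ≤ neckProfile δ E t := by
  have := neckHalf_nonneg hδ hE t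
  have := neckHalf_nonneg hδ hE (-t)
  unfold neckProfile
  linarith

lemma neckProfile_of_le (E : ℝ) {t : ℝ} (ht : δ ≤ |t|) : neckProfile δ E t = 1 := by
  unfold neckProfile
  rcases le_abs.1 ht with h | h
  · rw [neckHalf_of_le hδ E h, neckHalf_of_nonpos hδ E (by linarith)]; simp
  · rw [neckHalf_of_le hδ E h, neckHalf_of_nonpos hδ E (by linarith)]; simp

omit hδ in
lemma neckProfile_neg (E t : ℝ) : neckProfile δ E (-t) = neckProfile δ E t := by
  unfold neckProfile
  rw [neg_neg]
  ring

lemma neckDenominator_pos {E t : ℝ} (hE : 0 ≤ E) (hE1 : E ≤ 1) (h : E = 1 → 0 < t) :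
    0 < 1 - E * (1 - neckStep δ t) := by
  have h0 := neckStep_nonneg δ t
  have h1 := neckStep_le_one δ t
  rcases hE1.lt_or_eq with h2 | h2
  · nlinarith
  · have := neckStep_pos hδ (h h2)
    subst h2
    linarith

/-- For t < 0 the numerator vanishes identically nearby, so the denominator does not matter.
Consequently, for E in [0,1] the only exceptional point is E = 1, t = 0. -/
lemma contDiffAt_neckHalf {E t : ℝ} (h : t < 0 ∨ 0 < 1 - E * (1 - neckStep δ t)) :
    ContDiffAt ℝ ∞ (fun q : ℝ × ℝ => neckHalf δ q.1 q.2) (E, t) := by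
  rcases h with ht | hpos
  · have : (fun q : ℝ × ℝ => neckHalf δ q.1 q.2) =ᶠ[𝓝 (E, t)] fun _ => 0 := by
      filter_upwards [(continuous_snd.isOpen_preimage _ isOpen_Iio).mem_nhds
        (show (E, t) ∈ Prod.snd ⁻¹' Iio (0 : ℝ) from ht)] with q hq
      exact neckHalf_of_nonpos hδ _ (le_of_lt hq)
    exact contDiffAt_const.congr_of_eventuallyEq this
  · have hS : ContDiff ℝ ∞ fun q : ℝ × ℝ => neckStep δ q.2 :=
      (contDiff_neckStep δ).comp contDiff_snd
    have hS' : ContDiff ℝ ∞ fun q : ℝ × ℝ => deriv (neckStep δ) q.2 :=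
      (contDiff_deriv_neckStep δ).comp contDiff_snd
    unfold neckHalf
    refine ContDiffAt.div (contDiff_fst.mul hS').contDiffAt
      ((contDiff_const.sub (contDiff_fst.mul (contDiff_const.sub hS))).pow 2).contDiffAt ?_
    exact (pow_pos hpos 2).ne'

omit hδ in
/-- The parameters at which the neck profile is smooth. -/
def neckDomain (δ : ℝ) : Set (ℝ × ℝ) :=
  {q | (q.2 < 0 ∨ 0 < 1 - q.1 * (1 - neckStep δ q.2)) ∧
    (-q.2 < 0 ∨ 0 < 1 - q.1 * (1 - neckStep δ (-q.2)))}

omit hδ in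
lemma isOpen_neckDomain (δ : ℝ) : IsOpen (neckDomain δ) := by
  have hS := (contDiff_neckStep δ).continuous
  have h1 : IsOpen {q : ℝ × ℝ | q.2 < 0} := isOpen_lt (by fun_prop) (by fun_prop)
  have h2 : IsOpen {q : ℝ × ℝ | 0 < 1 - q.1 * (1 - neckStep δ q.2)} :=
    isOpen_lt (by fun_prop) (by fun_prop)
  have h3 : IsOpen {q : ℝ × ℝ | -q.2 < 0} := isOpen_lt (by fun_prop) (by fun_prop)
  have h4 : IsOpen {q : ℝ × ℝ | 0 < 1 - q.1 * (1 - neckStep δ (-q.2))} :=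
    isOpen_lt (by fun_prop) (by fun_prop)
  exact (h1.union h2).inter (h3.union h4)

lemma mem_neckDomain {E t : ℝ} (hE : 0 ≤ E) (hE1 : E ≤ 1) (h : E = 1 → t ≠ 0) :
    (E, t) ∈ neckDomain δ := by
  constructor
  · by_cases ht : t < 0
    · exact Or.inl ht
    · exact Or.inr (neckDenominator_pos hδ hE hE1
        (fun h1 => lt_of_le_of_ne (not_lt.1 ht) (h h1).symm))
  · by_cases ht : -t < 0
    · exact Or.inl ht
    · exact Or.inr (neckDenominator_pos hδ hE hE1
        (fun h1 => lt_of_le_of_ne (not_lt.1 ht) (neg_ne_zero.2 (h h1)).symm))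

lemma contDiffOn_neckProfile :
    ContDiffOn ℝ ∞ (fun q : ℝ × ℝ => neckProfile δ q.1 q.2) (neckDomain δ) := by
  rintro ⟨E, t⟩ ⟨h1, h2⟩
  refine ContDiffAt.contDiffWithinAt ?_
  unfold neckProfile
  refine (contDiffAt_const.add (contDiffAt_neckHalf hδ h1)).add ?_
  exact ContDiffAt.comp (E, t) (g := fun q : ℝ × ℝ => neckHalf δ q.1 q.2)
    (f := fun q : ℝ × ℝ => (q.1, -q.2)) (contDiffAt_neckHalf hδ h2)
    (contDiff_fst.prodMk contDiff_snd.neg).contDiffAt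

lemma contDiffAt_neckProfile {E t : ℝ} (hE : 0 ≤ E) (hE1 : E ≤ 1) (h : E = 1 → t ≠ 0) :
    ContDiffAt ℝ ∞ (fun q : ℝ × ℝ => neckProfile δ q.1 q.2) (E, t) :=
  (contDiffOn_neckProfile hδ).contDiffAt
    ((isOpen_neckDomain δ).mem_nhds (mem_neckDomain hδ hE hE1 h))

/-- The origin of `neckHalf`: the primitive is 1 − 1/(1−E(1−S)) with S the step. For E < 1 it rises
from −E/(1−E) at t = 0 to 0 at t = δ, so one half of the neck gains the length E/(1−E). -/
lemma hasDerivAt_neckPrimitive {E t : ℝ} (hE : 0 ≤ E) (hE1 : E ≤ 1) (h : E = 1 → 0 < t) :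
    HasDerivAt (fun t => -(E * (1 - neckStep δ t)) / (1 - E * (1 - neckStep δ t)))
      (neckHalf δ E t) t := by
  have hpos := neckDenominator_pos hδ hE hE1 h
  have hS := hasDerivAt_neckStep δ t
  have h1 := (hS.const_sub 1).const_mul E
  have := h1.neg.div (h1.const_sub 1) hpos.ne'
  refine this.congr_deriv ?_
  unfold neckHalf
  congr 1
  simp only [Pi.neg_apply]
  ring

/-- The lower limit is left free because for E = 1 the profile is not integrable up to 0; that case
is reached by letting a tend to 0. -/
lemma lintegral_neckProfile_Ioo {E a : ℝ} (hE : 0 ≤ E) (hE1 : E ≤ 1) (ha : 0 ≤ a) (haδ : a ≤ δ)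
    (h : E = 1 → 0 < a) :
    ∫⁻ t in Ioo a δ, ENNReal.ofReal (neckProfile δ E t) =
      ENNReal.ofReal (δ - a + E * (1 - neckStep δ a) / (1 - E * (1 - neckStep δ a))) := by
  have hcont : ContinuousOn (fun t => neckProfile δ E t) (Icc a δ) := by
    intro t ht
    have h1 := contDiffAt_neckProfile hδ (t := t) hE hE1
      (fun h1 => (lt_of_lt_of_le (h h1) ht.1).ne')
    exact (h1.continuousAt.comp (f := fun t : ℝ => (E, t)) (by fun_prop)).continuousWithinAt
  have hint : IntegrableOn (fun t => neckProfile δ E t) (Ioo a δ) :=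
    (hcont.integrableOn_Icc).mono_set Ioo_subset_Icc_self
  rw [← ofReal_integral_eq_lintegral_ofReal hint
    (Filter.Eventually.of_forall fun t => zero_le_one.trans (one_le_neckProfile hδ hE t))]
  congr 1
  rw [← integral_Ioc_eq_integral_Ioo, ← intervalIntegral.integral_of_le haδ]
  rw [intervalIntegral.integral_eq_sub_of_hasDerivAt (f := fun t =>
    t + -(E * (1 - neckStep δ t)) / (1 - E * (1 - neckStep δ t)))]
  · rw [neckStep_of_le hδ le_rfl]
    ring
  · intro t ht
    rw [uIcc_of_le haδ] at ht
    have h1 := (hasDerivAt_id t).add (hasDerivAt_neckPrimitive hδ (t := t) hE hE1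
      (fun h1 => lt_of_lt_of_le (h h1) ht.1))
    unfold neckProfile
    rw [neckHalf_of_nonpos hδ E (t := -t) (by linarith [ht.1]), add_zero]
    exact h1
  · exact (hcont.mono (by rw [uIcc_of_le haδ])).intervalIntegrable

/-- The length `E / (1 - E) ∈ [0, ∞]` for `E ∈ [0, 1]`. -/
def neckLength (E : ℝ) : ℝ≥0∞ := ENNReal.ofReal E / ENNReal.ofReal (1 - E)

lemma lintegral_neckProfile_right {E : ℝ} (hE : 0 ≤ E) (hE1 : E ≤ 1) :
    ∫⁻ t in Ioo 0 δ, ENNReal.ofReal (neckProfile δ E t) = ENNReal.ofReal δ + neckLength E := by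
  rcases hE1.lt_or_eq with h | rfl
  · rw [lintegral_neckProfile_Ioo hδ hE hE1 le_rfl hδ.le (fun h1 => absurd h1 h.ne),
      neckStep_of_nonpos hδ le_rfl, ENNReal.ofReal_add (by linarith)
        (div_nonneg (by linarith) (by linarith)), neckLength, sub_zero, sub_zero, mul_one,
        ENNReal.ofReal_div_of_pos (by linarith)]
  · have : neckLength 1 = ⊤ := by simp [neckLength]
    rw [this, add_top, eq_top_iff]
    refine ENNReal.le_of_forall_nnreal_lt fun r _ => ?_
    have hlim : Filter.Tendsto (fun a => neckStep δ a) (𝓝[>] 0) (𝓝 0) := by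
      have := (contDiff_neckStep δ).continuous.tendsto 0
      rw [neckStep_of_nonpos hδ le_rfl] at this
      exact this.mono_left nhdsWithin_le_nhds
    -- For E = 1 the integral over (a, δ) is δ − a + 1/S(a) − 1, so it exceeds r as soon as S(a) <
    -- 1/(r+1).
    have hr : (0 : ℝ) < 1 / (r + 1) := by positivity
    obtain ⟨a, ha⟩ := ((hlim.eventually_lt_const hr).and
      (Ioo_mem_nhdsGT hδ)).exists
    obtain ⟨ha1, ha0, haδ⟩ := ha
    refine le_trans ?_ (lintegral_mono_set (μ := volume) (Ioo_subset_Ioo_left ha0.le))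
    rw [lintegral_neckProfile_Ioo hδ hE hE1 ha0.le haδ.le (fun _ => ha0)]
    have hS := neckStep_pos hδ ha0
    rw [ENNReal.le_ofReal_iff_toReal_le (by simp) ?_]
    · have : (r : ℝ) + 1 ≤ 1 / neckStep δ a := by
        rw [le_div_iff₀ hS]
        rw [lt_div_iff₀ (by positivity)] at ha1
        linarith
      have e : 1 * (1 - neckStep δ a) / (1 - 1 * (1 - neckStep δ a)) = 1 / neckStep δ a - 1 := by
        have e1 : 1 - 1 * (1 - neckStep δ a) = neckStep δ a := by ring
        rw [e1, one_mul, sub_div, div_self hS.ne']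
      rw [e]
      simp only [ENNReal.coe_toReal]
      linarith
    · have : 0 ≤ 1 * (1 - neckStep δ a) / (1 - 1 * (1 - neckStep δ a)) :=
        div_nonneg (by linarith [neckStep_le_one δ a]) (by linarith)
      linarith

lemma lintegral_neckProfile_left {E : ℝ} (hE : 0 ≤ E) (hE1 : E ≤ 1) :
    ∫⁻ t in Ioo (-δ) 0, ENNReal.ofReal (neckProfile δ E t) = ENNReal.ofReal δ + neckLength E := by
  rw [← lintegral_neckProfile_right hδ hE hE1]
  have := (Measure.measurePreserving_neg (volume : Measure ℝ)).setLIntegral_comp_preimage_emb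
    (MeasurableEquiv.neg ℝ).measurableEmbedding
    (fun t => ENNReal.ofReal (neckProfile δ E t)) (Ioo 0 δ)
  rw [← this]
  simp [neckProfile_neg]

omit hδ in
lemma neckLength_eq_top_iff {E : ℝ} (hE : 0 ≤ E) (hE1 : E ≤ 1) : neckLength E = ⊤ ↔ E = 1 := by
  constructor
  · intro h
    by_contra hne
    have : E < 1 := lt_of_le_of_ne hE1 hne
    rw [neckLength, ← ENNReal.ofReal_div_of_pos (by linarith)] at h
    exact ENNReal.ofReal_ne_top h
  · rintro rfl
    simp [neckLength]

lemma isNeckProfile_neckProfile {E : ℝ} (hE : 0 ≤ E) (hE1 : E ≤ 1) :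
    IsNeckProfile δ (neckLength E) (neckProfile δ E) where
  one_le := one_le_neckProfile hδ hE
  eq_one t ht := neckProfile_of_le hδ E ht
  smooth t ht := (contDiffAt_neckProfile hδ hE hE1 (fun h =>
    ht ((neckLength_eq_top_iff hE hE1).2 h))).comp t (f := fun t : ℝ => (E, t)) (by fun_prop)
  length_left := lintegral_neckProfile_left hδ hE hE1
  length_right := lintegral_neckProfile_right hδ hE hE1

omit hδ in
-- Induction on k: a further derivative in t is the total derivative applied to (0, 1), which stays
-- smooth on the open set.
lemma contDiffOn_iteratedDeriv_snd {F : ℝ × ℝ → ℝ} {Ω : Set (ℝ × ℝ)} (hΩ : IsOpen Ω)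
    (hF : ContDiffOn ℝ ∞ F Ω) (k : ℕ) :
    ContDiffOn ℝ ∞ (fun q : ℝ × ℝ => iteratedDeriv k (fun t => F (q.1, t)) q.2) Ω := by
  induction k with
  | zero => simpa using hF
  | succ k ih =>
    have h1 : ContDiffOn ℝ ∞ (fun q : ℝ × ℝ => fderiv ℝ
        (fun q : ℝ × ℝ => iteratedDeriv k (fun t => F (q.1, t)) q.2) q (0, 1)) Ω :=
      (ih.fderiv_of_isOpen hΩ (m := ∞) (by norm_num)).clm_apply contDiffOn_const
    refine h1.congr fun q hq => ?_
    rw [iteratedDeriv_succ]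
    have h2 := ((ih.contDiffAt (hΩ.mem_nhds hq)).differentiableAt (by simp)).hasFDerivAt
    have h3 : HasDerivAt (fun t : ℝ => (q.1, t)) ((0 : ℝ), (1 : ℝ)) q.2 :=
      (hasDerivAt_const _ _).prodMk (hasDerivAt_id _)
    exact (h2.comp_hasDerivAt q.2 h3).deriv

lemma continuousAt_iteratedDeriv_neckProfile (k : ℕ) {E t : ℝ} (hE : 0 ≤ E) (hE1 : E ≤ 1)
    (h : E = 1 → t ≠ 0) :
    ContinuousAt (fun q : ℝ × ℝ => iteratedDeriv k (neckProfile δ q.1) q.2) (E, t) := by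
  exact ((contDiffOn_iteratedDeriv_snd (isOpen_neckDomain δ)
    (contDiffOn_neckProfile hδ) k).contDiffAt
    ((isOpen_neckDomain δ).mem_nhds (mem_neckDomain hδ hE hE1 h))).continuousAt

end NeckProfile

/-! ### Half-space description of the permutohedron -/

section Permutohedron

variable {l : ℕ}

/-- The excess of the `I`-th partial sum over its minimum on the permutohedron. -/
def slack (I : Finset (Fin l)) (x : Fin l → ℝ) : ℝ :=
  ∑ i ∈ I, x i - (I.card : ℝ) * (I.card + 1) / 2

/-- The first `k` indices. -/
def initialSegment (l k : ℕ) : Finset (Fin l) := Finset.univ.filter fun i => (i : ℕ) < k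

@[simp] lemma mem_initialSegment {k : ℕ} {i : Fin l} : i ∈ initialSegment l k ↔ (i : ℕ) < k := by
  simp [initialSegment]

/-- Extension of a finite sequence by `0`. -/
def extendZero (y : Fin l → ℝ) (j : ℕ) : ℝ := if h : j < l then y ⟨j, h⟩ else 0

lemma extendZero_coe (y : Fin l → ℝ) (i : Fin l) : extendZero y i = y i := by
  simp [extendZero]

lemma sum_initialSegment (F : ℕ → ℝ) {k : ℕ} (hk : k ≤ l) :
    ∑ i ∈ initialSegment l k, F i = ∑ j ∈ Finset.range k, F j := by
  have : initialSegment l k = Finset.univ.filter fun i : Fin l => (i : ℕ) < k := rfl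
  rw [this, Finset.sum_filter, Fin.sum_univ_eq_sum_range (fun j => if j < k then F j else 0) l,
    ← Finset.sum_filter]
  congr 1
  ext j
  simp only [Finset.mem_filter, Finset.mem_range]
  omega

lemma card_initialSegment {k : ℕ} (hk : k ≤ l) : (initialSegment l k).card = k := by
  have := sum_initialSegment (l := l) (fun _ => 1) hk
  simpa using this

lemma sum_range_succ_real (k : ℕ) :
    ∑ j ∈ Finset.range k, ((j : ℝ) + 1) = (k : ℝ) * (k + 1) / 2 := by
  induction k with
  | zero => simp
  | succ k ih => rw [Finset.sum_range_succ, ih]; push_cast; ring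

lemma slack_initialSegment (y : Fin l → ℝ) {k : ℕ} (hk : k ≤ l) :
    slack (initialSegment l k) y = ∑ j ∈ Finset.range k, (extendZero y j - (j + 1)) := by
  rw [slack, Finset.sum_sub_distrib, sum_range_succ_real, card_initialSegment hk,
    ← sum_initialSegment _ hk]
  simp [extendZero_coe]

lemma initialSegment_self : initialSegment l l = Finset.univ := by
  ext i; simp

lemma slack_map (σ : Equiv.Perm (Fin l)) (I : Finset (Fin l)) (x : Fin l → ℝ) :
    slack (I.map σ.toEmbedding) x = slack I (x ∘ σ) := by
  simp [slack]

/-- For an increasing sequence the first k entries have the smallest sum among all k-element sets.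
Membership of a sorted point in the polytope is thereby reduced to the initial segments. -/
lemma slack_initialSegment_le {y : Fin l → ℝ} (hy : Monotone y) (I : Finset (Fin l)) :
    slack (initialSegment l I.card) y ≤ slack I y := by
  have hIl : I.card ≤ l := by simpa using I.card_le_univ
  have hcard := card_initialSegment hIl
  rw [slack, slack, hcard]
  set A := initialSegment l I.card with hA
  have h1 : ∑ i ∈ A, y i = ∑ i ∈ A ∩ I, y i + ∑ i ∈ A \ I, y i := by
    rw [Finset.sum_inter_add_sum_sdiff]
  have h2 : ∑ i ∈ I, y i = ∑ i ∈ A ∩ I, y i + ∑ i ∈ I \ A, y i := by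
    rw [Finset.inter_comm, Finset.sum_inter_add_sum_sdiff]
  have hc : (A \ I).card = (I \ A).card := by
    have := Finset.card_sdiff_add_card_inter A I
    have := Finset.card_sdiff_add_card_inter I A
    rw [Finset.inter_comm] at this
    omega
  have key : ∑ i ∈ A \ I, y i ≤ ∑ i ∈ I \ A, y i := by
    by_cases hk : I.card < l
    -- The pivot value: entries of A \ I are at most c, those of I \ A at least c, and the two sets
    -- have equal size.
    · set c := y ⟨I.card, hk⟩
      calc ∑ i ∈ A \ I, y i ≤ (A \ I).card • c := by
            apply Finset.sum_le_card_nsmul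
            intro i hi
            apply hy
            have := (Finset.mem_sdiff.1 hi).1
            rw [hA, mem_initialSegment] at this
            rw [Fin.le_def]; exact this.le
        _ = (I \ A).card • c := by rw [hc]
        _ ≤ ∑ i ∈ I \ A, y i := by
            apply Finset.card_nsmul_le_sum
            intro i hi
            apply hy
            have := (Finset.mem_sdiff.1 hi).2
            rw [hA, mem_initialSegment, not_lt] at this
            rw [Fin.le_def]; exact this
    · have hl : I.card = l := by omega
      have : A = Finset.univ := by rw [hA, hl, initialSegment_self]
      have hI : I = Finset.univ := by
        rw [← Finset.card_eq_iff_eq_univ]; simpa using hl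
      rw [this, hI]
  linarith

/-- Summation by parts. -/
lemma sum_mul_eq_sum_sub_mul (b z : ℕ → ℝ) (n : ℕ) :
    ∑ j ∈ Finset.range (n + 1), b j * z j = b n * ∑ j ∈ Finset.range (n + 1), z j +
      ∑ k ∈ Finset.range n, (b k - b (k + 1)) * ∑ j ∈ Finset.range (k + 1), z j := by
  induction n with
  | zero => simp
  | succ n ih =>
    rw [Finset.sum_range_succ, ih, Finset.sum_range_succ _ (n + 1),
      Finset.sum_range_succ (fun k => (b k - b (k + 1)) * ∑ j ∈ Finset.range (k + 1), z j) n]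
    ring

/-- A set of indices on which `a` is larger than on the complement is an initial segment of any
order in which `a` is antitone. -/
lemma eq_map_initialSegment {a : Fin l → ℝ} {σ : Equiv.Perm (Fin l)} (hσ : Monotone (a ∘ σ))
    {I : Finset (Fin l)} (hI : ∀ i ∈ I, ∀ j ∉ I, a i < a j) :
    I = (initialSegment l I.card).map σ.toEmbedding := by
  have hIl : I.card ≤ l := by simpa using I.card_le_univ
  symm
  have hJ : ∀ i j : Fin l, σ j ∈ I → i ≤ j → σ i ∈ I := by
    intro i j hj hij
    by_contra hi
    exact absurd (hσ hij) (not_le.2 (hI _ hj _ hi))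
  set J := I.map σ.symm.toEmbedding with hJdef
  have hmem : ∀ i, i ∈ J ↔ σ i ∈ I := by
    intro i
    simp [hJdef, Finset.mem_map_equiv]
  have hJc : J.card = I.card := by simp [hJdef]
  have : initialSegment l I.card = J := by
    apply Finset.eq_of_subset_of_card_le
    · intro i hi
      by_contra hiJ
      -- J is closed downwards, so if it misses position i it lies within the first i positions and
      -- is too small.
      have hsub : J ⊆ initialSegment l i := by
        intro j hj
        rw [mem_initialSegment]
        by_contra hlt
        exact hiJ ((hmem i).2 (hJ i j ((hmem j).1 hj) (by rw [Fin.le_def]; omega)))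
      have := Finset.card_le_card hsub
      rw [card_initialSegment i.2.le, hJc] at this
      rw [mem_initialSegment] at hi
      omega
    · rw [hJc, card_initialSegment hIl]
  rw [this, hJdef]
  ext i
  simp [Finset.mem_map_equiv]

/-- The vertex of the permutohedron at which the coordinates are increasing in the order `σ`. -/
def permVertex (σ : Equiv.Perm (Fin l)) : Fin l → ℝ := fun i => ((σ.symm i : ℕ) : ℝ) + 1

/-- The permutohedron as an intersection of half-spaces. -/
def permPolytope (l : ℕ) : Set (Fin l → ℝ) :=
  {x | (∀ I, 0 ≤ slack I x) ∧ slack Finset.univ x = 0}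

lemma permVertex_comp (σ : Equiv.Perm (Fin l)) :
    permVertex σ ∘ σ = fun i : Fin l => ((i : ℕ) : ℝ) + 1 := by
  ext i; simp [permVertex]

lemma slack_initialSegment_id {k : ℕ} (hk : k ≤ l) :
    slack (initialSegment l k) (fun i : Fin l => ((i : ℕ) : ℝ) + 1) = 0 := by
  rw [slack_initialSegment _ hk]
  apply Finset.sum_eq_zero
  intro j hj
  have : j < l := lt_of_lt_of_le (Finset.mem_range.1 hj) hk
  simp [extendZero, this]

lemma mem_permPolytope_of_monotone {y : Fin l → ℝ} (hy : Monotone y)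
    (h : ∀ k ≤ l, 0 ≤ slack (initialSegment l k) y) (hl : slack Finset.univ y = 0) :
    y ∈ permPolytope l :=
  ⟨fun I => (h _ (by simpa using I.card_le_univ)).trans (slack_initialSegment_le hy I), hl⟩

lemma comp_mem_permPolytope {x : Fin l → ℝ} (σ : Equiv.Perm (Fin l)) (hx : x ∈ permPolytope l) :
    x ∘ σ ∈ permPolytope l := by
  refine ⟨fun I => ?_, ?_⟩
  · rw [← slack_map]; exact hx.1 _
  · rw [← slack_map, Finset.univ_map_equiv_to_embedding]; exact hx.2

lemma comp_mem_permPolytope_iff {x : Fin l → ℝ} (σ : Equiv.Perm (Fin l)) :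
    x ∘ σ ∈ permPolytope l ↔ x ∈ permPolytope l := by
  refine ⟨fun h => ?_, comp_mem_permPolytope σ⟩
  have := comp_mem_permPolytope σ.symm h
  rwa [Function.comp_assoc, Equiv.self_comp_symm, Function.comp_id] at this

lemma id_mem_permPolytope : (fun i : Fin l => ((i : ℕ) : ℝ) + 1) ∈ permPolytope l := by
  refine mem_permPolytope_of_monotone ?_ (fun k hk => (slack_initialSegment_id hk).ge) ?_
  · intro i j hij
    have : (i : ℕ) ≤ j := hij
    simpa using this
  · rw [← initialSegment_self]; exact slack_initialSegment_id le_rfl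

lemma permVertex_mem (σ : Equiv.Perm (Fin l)) : permVertex σ ∈ permPolytope l := by
  rw [← comp_mem_permPolytope_iff σ, permVertex_comp]
  exact id_mem_permPolytope

lemma convex_permPolytope : Convex ℝ (permPolytope l) := by
  have hs : ∀ (I : Finset (Fin l)) (x y : Fin l → ℝ) (a b : ℝ), a + b = 1 →
      slack I (a • x + b • y) = a * slack I x + b * slack I y := by
    intro I x y a b hab
    obtain rfl : b = 1 - a := by linarith
    simp only [slack, Pi.add_apply, Pi.smul_apply, smul_eq_mul, Finset.sum_add_distrib,
      ← Finset.mul_sum]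
    ring
  intro x hx y hy a b ha hb hab
  refine ⟨fun I => ?_, ?_⟩
  · rw [hs I x y a b hab]
    exact add_nonneg (mul_nonneg ha (hx.1 I)) (mul_nonneg hb (hy.1 I))
  · rw [hs _ x y a b hab, hx.2, hy.2]; simp

/-- The value of a linear functional in terms of the partial sums, for an order of the coordinates
in which its coefficients are increasing. -/
lemma sum_mul_sub_permVertex {a : Fin l → ℝ} (σ : Equiv.Perm (Fin l)) {x : Fin l → ℝ}
    (hx : slack Finset.univ x = 0) :
    ∑ i, a i * x i - ∑ i, a i * permVertex σ i = ∑ k ∈ Finset.range (l - 1),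
      (extendZero (a ∘ σ) k - extendZero (a ∘ σ) (k + 1)) *
        slack ((initialSegment l (k + 1)).map σ.toEmbedding) x := by
  rcases Nat.eq_zero_or_pos l with rfl | hl
  · simp
  obtain ⟨n, rfl⟩ : ∃ n, l = n + 1 := ⟨l - 1, by omega⟩
  have h1 : ∑ i, a i * x i - ∑ i, a i * permVertex σ i =
      ∑ j ∈ Finset.range (n + 1), extendZero (a ∘ σ) j * (extendZero (x ∘ σ) j - (j + 1)) := by
    rw [← Finset.sum_sub_distrib, ← Equiv.sum_comp σ, ← Fin.sum_univ_eq_sum_range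
      (fun j => extendZero (a ∘ σ) j * (extendZero (x ∘ σ) j - (j + 1)))]
    refine Finset.sum_congr rfl fun i _ => ?_
    rw [extendZero_coe, extendZero_coe]
    simp [permVertex]
    ring
  rw [h1, sum_mul_eq_sum_sub_mul, ← slack_initialSegment _ le_rfl, initialSegment_self]
  have h2 : slack Finset.univ (x ∘ σ) = 0 := by
    rw [← slack_map, Finset.univ_map_equiv_to_embedding]; exact hx
  rw [h2, mul_zero, zero_add]
  refine Finset.sum_congr rfl fun k hk => ?_
  rw [Finset.mem_range] at hk
  rw [slack_map, slack_initialSegment _ (by omega)]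

lemma exists_antitone_comp (a : Fin l → ℝ) : ∃ σ : Equiv.Perm (Fin l), Antitone (a ∘ σ) := by
  refine ⟨Tuple.sort (fun i => -a i), fun i j hij => ?_⟩
  have := Tuple.monotone_sort (fun i => -a i) hij
  simpa using this

lemma extendZero_anti {b : Fin l → ℝ} (hb : Antitone b) {k : ℕ} (hk : k + 1 < l) :
    extendZero b (k + 1) ≤ extendZero b k := by
  simp only [extendZero, hk, (Nat.lt_succ_self k).trans hk, dif_pos]
  exact hb (by rw [Fin.le_def]; simp)

/-- In `sum_mul_sub_permVertex` both factors of every term are nonnegative when the coefficients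
decrease along σ. -/
lemma sum_mul_permVertex_le {a : Fin l → ℝ} {σ : Equiv.Perm (Fin l)} (hσ : Antitone (a ∘ σ))
    {x : Fin l → ℝ} (hx : x ∈ permPolytope l) :
    ∑ i, a i * permVertex σ i ≤ ∑ i, a i * x i := by
  rw [← sub_nonneg, sum_mul_sub_permVertex σ hx.2]
  refine Finset.sum_nonneg fun k hk => mul_nonneg ?_ (hx.1 _)
  rw [Finset.mem_range] at hk
  rw [sub_nonneg]
  exact extendZero_anti hσ (by omega)

/-- Equality in `sum_mul_permVertex_le` kills every term. A strict superlevel set I of the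
coefficients is an initial segment of the sorted order with a strict drop at its end, so in that
term the slack has to be the zero factor. -/
lemma slack_eq_zero_of_sum_mul_eq {a : Fin l → ℝ} {σ : Equiv.Perm (Fin l)} (hσ : Antitone (a ∘ σ))
    {x : Fin l → ℝ} (hx : x ∈ permPolytope l)
    (h : ∑ i, a i * x i = ∑ i, a i * permVertex σ i)
    {I : Finset (Fin l)} (hne : I ≠ ∅) (hnu : I ≠ Finset.univ)
    (hI : ∀ i ∈ I, ∀ j ∉ I, a j < a i) : slack I x = 0 := by
  have h0 := sum_mul_sub_permVertex σ hx.2 (a := a)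
  rw [h, sub_self] at h0
  have h1 := (Finset.sum_eq_zero_iff_of_nonneg (fun k hk => mul_nonneg (by
    rw [Finset.mem_range] at hk
    rw [sub_nonneg]
    exact extendZero_anti hσ (by omega)) (hx.1 _))).1 h0.symm
  have hc0 : 0 < I.card := Finset.card_pos.2 (Finset.nonempty_iff_ne_empty.2 hne)
  have hcl : I.card < l := by
    have := (Finset.card_lt_iff_ne_univ I).2 hnu
    simpa using this
  have hIeq := eq_map_initialSegment (a := fun i => -a i) (σ := σ)
    (fun i j hij => neg_le_neg (hσ hij)) (I := I) (fun i hi j hj => neg_lt_neg (hI i hi j hj))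
  have h2 := h1 (I.card - 1) (Finset.mem_range.2 (by omega))
  rw [Nat.sub_add_cancel hc0, ← hIeq] at h2
  refine (mul_eq_zero.1 h2).resolve_left (ne_of_gt ?_)
  rw [sub_pos]
  have hk1 : I.card - 1 < l := by omega
  simp only [extendZero, hcl, hk1, dif_pos, Function.comp]
  have hmem : ∀ i, i ∈ I ↔ (σ.symm i : ℕ) < I.card := fun i => by
    conv_lhs => rw [hIeq]
    rw [Finset.mem_map_equiv, mem_initialSegment]
  apply hI
  · rw [hmem, Equiv.symm_apply_apply]
    exact Nat.sub_lt hc0 one_pos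
  · rw [hmem]
    simp

/-- Conversely, a functional is minimal where the slacks of its strict sublevel sets vanish. -/
lemma sum_mul_eq_of_slack_eq_zero {a : Fin l → ℝ} {σ : Equiv.Perm (Fin l)} (hσ : Antitone (a ∘ σ))
    {x : Fin l → ℝ} (hx : x ∈ permPolytope l)
    (h : ∀ I : Finset (Fin l), I ≠ ∅ → I ≠ Finset.univ → (∀ i ∈ I, ∀ j ∉ I, a j < a i) →
      slack I x = 0) :
    ∑ i, a i * x i = ∑ i, a i * permVertex σ i := by
  rw [← sub_eq_zero, sum_mul_sub_permVertex σ hx.2]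
  refine Finset.sum_eq_zero fun k hk => ?_
  rw [Finset.mem_range] at hk
  have hk1 : k + 1 < l := by omega
  rcases (extendZero_anti hσ hk1).eq_or_lt with heq | hlt
  · rw [heq]; simp
  · rw [h, mul_zero]
    · rw [← Finset.nonempty_iff_ne_empty]
      exact ⟨σ ⟨k, by omega⟩, by rw [Finset.mem_map_equiv]; simp⟩
    · intro hu
      have : σ ⟨k + 1, hk1⟩ ∈ (initialSegment l (k + 1)).map σ.toEmbedding := by
        rw [hu]; exact Finset.mem_univ _
      rw [Finset.mem_map_equiv] at this
      simp at this
    · intro i hi j hj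
      rw [Finset.mem_map_equiv, mem_initialSegment] at hi hj
      have hi' := hσ (show σ.symm i ≤ ⟨k, by omega⟩ by rw [Fin.le_def]; simp; omega)
      have hj' := hσ (show ⟨k + 1, hk1⟩ ≤ σ.symm j by rw [Fin.le_def]; simp; omega)
      simp only [Function.comp, Equiv.apply_symm_apply] at hi' hj'
      have hk0 : k < l := by omega
      simp only [extendZero, hk0, hk1, dif_pos, Function.comp] at hlt
      linarith

/-- A functional separating a point of the polytope from the convex hull would take a value at that
point below its value at the vertex sorted along its coefficients, contradicting
`sum_mul_permVertex_le`. The sign in the definition of a turns the maximum into a minimum. -/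
theorem permutohedron_eq_permPolytope : permutohedron l = permPolytope l := by
  apply Set.Subset.antisymm
  · refine convexHull_min ?_ convex_permPolytope
    rintro _ ⟨σ, rfl⟩
    exact permVertex_mem σ.symm
  · intro x hx
    by_contra hxP
    have hcl : IsClosed (permutohedron l) :=
      ((Set.finite_range _).isCompact_convexHull ℝ).isClosed
    obtain ⟨f, u, hfu, hux⟩ := geometric_hahn_banach_closed_point (convex_convexHull ℝ _) hcl hxP
    set a : Fin l → ℝ := fun i => -f (Pi.single i 1)
    have hf : ∀ y, f y = -∑ i, a i * y i := by
      intro y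
      have : y = ∑ i, y i • (Pi.single i (1 : ℝ) : Fin l → ℝ) := by
        ext j; simp [Finset.sum_apply, Pi.single_apply]
      conv_lhs => rw [this]
      simp only [map_sum, map_smul, smul_eq_mul, a]
      rw [← Finset.sum_neg_distrib]
      refine Finset.sum_congr rfl fun i _ => ?_
      ring
    obtain ⟨σ, hσ⟩ := exists_antitone_comp a
    have h1 := sum_mul_permVertex_le hσ hx
    have h2 := hfu (permVertex σ) (subset_convexHull ℝ _ ⟨σ.symm, rfl⟩)
    rw [hf] at h2 hux
    linarith

lemma isCompact_permPolytope : IsCompact (permPolytope l) := by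
  rw [← permutohedron_eq_permPolytope]
  exact (Set.finite_range _).isCompact_convexHull ℝ

end Permutohedron

/-! ### A discrete maximum principle for repelling points -/

section NeckCoordinates

/-- Abel summation for an antitone weight. -/
lemma sum_Ico_mul_sub_ge {w g : ℕ → ℝ} {k n : ℕ} (hkn : k < n)
    (hw : ∀ i j, k ≤ i → i ≤ j → j < n → w j ≤ w i) (hg : ∀ j, k ≤ j → j ≤ n → 0 ≤ g j) :
    w (n - 1) * g n - w k * g k ≤ ∑ j ∈ Finset.Ico k n, w j * (g (j + 1) - g j) := by
  induction n, hkn using Nat.le_induction with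
  | base => simp; linarith
  | succ n hn ih =>
    have hkn : k ≤ n := by omega
    rw [Finset.sum_Ico_succ_top hkn]
    have h1 := ih (fun i j hi hij hj => hw i j hi hij (by omega))
      (fun j hj hjn => hg j hj (by omega))
    have h2 : w n ≤ w (n - 1) := hw (n - 1) n (by omega) (by omega) (by omega)
    have h3 := mul_le_mul_of_nonneg_right h2 (hg n hkn (by omega))
    simp only [Nat.add_sub_cancel]
    linarith

/-- Abel summation for a monotone weight. -/
lemma sum_range_mul_sub_le {w g : ℕ → ℝ} {n : ℕ} (hn : 0 < n)
    (hw : ∀ i j, i ≤ j → j < n → w i ≤ w j) (hg : ∀ j, j ≤ n → 0 ≤ g j) :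
    ∑ j ∈ Finset.range n, w j * (g (j + 1) - g j) ≤ w (n - 1) * g n - w 0 * g 0 := by
  induction n, hn using Nat.le_induction with
  | base => simp; linarith
  | succ n hn ih =>
    rw [Finset.sum_range_succ]
    have h1 := ih (fun i j hij hj => hw i j hij (by omega)) (fun j hjn => hg j (by omega))
    have h2 : w (n - 1) ≤ w n := hw (n - 1) n (by omega) (by omega)
    have h3 := mul_le_mul_of_nonneg_right h2 (hg n (by omega))
    simp only [Nat.add_sub_cancel]
    linarith

/-- The total repulsion across the `k`-th gap. -/
def repulsion (l k : ℕ) (X : ℕ → ℝ) : ℝ :=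
  ∑ i ∈ Finset.range k, ∑ j ∈ Finset.Ico k l, 1 / (X j - X i)

section Comparison

variable {l : ℕ} {X X' e e' : ℕ → ℝ}
  (hmono : ∀ i j, i ≤ j → j < l → X i ≤ X j) (hmono' : ∀ i j, i ≤ j → j < l → X' i ≤ X' j)
  (he : ∀ k, e (k + 1) = e k + (X k - (k + 1))) (he' : ∀ k, e' (k + 1) = e' k + (X' k - (k + 1)))
  (he0 : e 0 = 0) (he0' : e' 0 = 0) (hel : e l = 0) (hel' : e' l = 0)
  (hnn : ∀ k ≤ l, 0 ≤ e k) (hnn' : ∀ k ≤ l, 0 ≤ e' k)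

include hmono in
lemma gap_le {k i j : ℕ} (hk : 0 < k) (hi : i < k) (hj : k ≤ j) (hjl : j < l) :
    X k - X (k - 1) ≤ X j - X i := by
  have h1 := hmono i (k - 1) (by omega) (by omega)
  have h2 := hmono k j hj hjl
  linarith

include hmono in
lemma repulsion_pos {k : ℕ} (hk : 0 < k) (hkl : k < l) (hgap : X (k - 1) < X k) :
    0 < repulsion l k X := by
  refine Finset.sum_pos (fun i hi => Finset.sum_pos (fun j hj => ?_) ⟨k, by simp [hkl]⟩)
    ⟨0, by simpa using hk⟩
  rw [Finset.mem_range] at hi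
  rw [Finset.mem_Ico] at hj
  have := gap_le hmono hk hi hj.1 hj.2
  exact one_div_pos.2 (by linarith)

include hmono hmono' he he' in
/-- Stretching all partial sums by at most `c > 1`, with equality at `k`, increases the repulsion
across the `k`-th gap by more than the factor `1 / c`. -/
lemma repulsion_lt {c : ℝ} (hc : 1 < c) (hle : ∀ k ≤ l, e' k ≤ c * e k)
    {k : ℕ} (hk : 0 < k) (hkl : k < l) (hek : e' k = c * e k)
    (hgap : X (k - 1) < X k) (hgap' : X' (k - 1) < X' k) :
    repulsion l k X < c * repulsion l k X' := by
  have hc0 : 0 < c := by linarith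
  -- The defect of the comparison: nonnegative and zero at k. Its increments record how far c(X_j −
  -- X_i) exceeds X'_j − X'_i, up to the positive term (c−1)(j−i).
  set g : ℕ → ℝ := fun k => c * e k - e' k with hg
  have hg0 : ∀ j ≤ l, 0 ≤ g j := fun j hj => sub_nonneg.2 (hle j hj)
  have hgk : g k = 0 := by simp [hg, hek]
  have hgs : ∀ j, g (j + 1) - g j = c * X j - X' j - (c - 1) * (j + 1) := by
    intro j
    simp only [hg, he, he']
    ring
  -- The convex function 1/t lies above its tangent at t = c(X_j − X_i), and w i j is minus the
  -- slope there. The estimate `hterm` is this tangent inequality.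
  set w : ℕ → ℕ → ℝ := fun i j => 1 / (c * (X j - X i)) ^ 2 with hw
  have hpos : ∀ i j, i < k → k ≤ j → j < l → 0 < X j - X i := fun i j hi hj hjl =>
    lt_of_lt_of_le (sub_pos.2 hgap) (gap_le hmono hk hi hj hjl)
  have hpos' : ∀ i j, i < k → k ≤ j → j < l → 0 < X' j - X' i := fun i j hi hj hjl =>
    lt_of_lt_of_le (sub_pos.2 hgap') (gap_le hmono' hk hi hj hjl)
  have hterm : ∀ i j, i < k → k ≤ j → j < l →
      1 / (c * (X j - X i)) + w i j * ((c - 1) * (j - i)) + w i j * (g (j + 1) - g j) -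
        w i j * (g (i + 1) - g i) ≤ 1 / (X' j - X' i) := by
    intro i j hi hj hjl
    have ht : 0 < c * (X j - X i) := mul_pos hc0 (hpos i j hi hj hjl)
    have ht' := hpos' i j hi hj hjl
    have e1 : 1 / (c * (X j - X i)) + w i j * ((c - 1) * (j - i)) + w i j * (g (j + 1) - g j) -
        w i j * (g (i + 1) - g i) = 1 / (c * (X j - X i)) +
          (c * (X j - X i) - (X' j - X' i)) / (c * (X j - X i)) ^ 2 := by
      rw [hgs, hgs, hw]
      ring
    rw [e1]
    set t := c * (X j - X i)
    set t' := X' j - X' i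
    have : 1 / t' - (1 / t + (t - t') / t ^ 2) = (t - t') ^ 2 / (t' * t ^ 2) := by
      field_simp
      ring
    have h2 : 0 ≤ (t - t') ^ 2 / (t' * t ^ 2) := by positivity
    linarith
  have hwpos : ∀ i j, i < k → k ≤ j → j < l → 0 < w i j := fun i j hi hj hjl => by
    have := mul_pos hc0 (hpos i j hi hj hjl)
    simp only [hw]
    positivity
  -- For fixed i the weight decreases in j, and g starts from its zero at k, so summation by parts
  -- leaves only nonnegative terms.
  have hA : ∀ i < k, 0 ≤ ∑ j ∈ Finset.Ico k l, w i j * (g (j + 1) - g j) := by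
    intro i hi
    have := sum_Ico_mul_sub_ge (w := w i) (g := g) hkl ?_ (fun j _ hj => hg0 j hj)
    · rw [hgk, mul_zero, sub_zero] at this
      refine le_trans ?_ this
      exact mul_nonneg (hwpos i (l - 1) hi (by omega) (by omega)).le (hg0 l le_rfl)
    · intro a b ha hab hb
      have h1 := mul_pos hc0 (hpos i a hi ha (by omega))
      have h2 : X a ≤ X b := hmono a b hab hb
      simp only [hw]
      gcongr
  -- The mirror image: for fixed j the weight increases in i, and g ends at its zero at k.
  have hB : ∀ j, k ≤ j → j < l → ∑ i ∈ Finset.range k, w i j * (g (i + 1) - g i) ≤ 0 := by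
    intro j hj hjl
    have := sum_range_mul_sub_le (w := fun i => w i j) (g := g) hk ?_
      (fun i hi => hg0 i (by omega))
    · rw [hgk, mul_zero, zero_sub] at this
      refine this.trans (neg_nonpos.2 ?_)
      exact mul_nonneg (hwpos 0 j hk hj hjl).le (hg0 0 (by omega))
    · intro a b hab hb
      have h1 := mul_pos hc0 (hpos b j hb hj hjl)
      have h2 : X a ≤ X b := hmono a b hab (by omega)
      simp only [hw]
      gcongr
  have hsum : ∑ i ∈ Finset.range k, ∑ j ∈ Finset.Ico k l,
      (1 / (c * (X j - X i)) + w i j * ((c - 1) * (j - i)) + w i j * (g (j + 1) - g j) -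
        w i j * (g (i + 1) - g i)) ≤ repulsion l k X' := by
    refine Finset.sum_le_sum fun i hi => Finset.sum_le_sum fun j hj => ?_
    rw [Finset.mem_range] at hi
    rw [Finset.mem_Ico] at hj
    exact hterm i j hi hj.1 hj.2
  simp only [Finset.sum_sub_distrib, Finset.sum_add_distrib] at hsum
  have h1 : 0 ≤ ∑ i ∈ Finset.range k, ∑ j ∈ Finset.Ico k l, w i j * (g (j + 1) - g j) :=
    Finset.sum_nonneg fun i hi => hA i (Finset.mem_range.1 hi)
  have h2 : ∑ i ∈ Finset.range k, ∑ j ∈ Finset.Ico k l, w i j * (g (i + 1) - g i) ≤ 0 := by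
    rw [Finset.sum_comm]
    exact Finset.sum_nonpos fun j hj => hB j (Finset.mem_Ico.1 hj).1 (Finset.mem_Ico.1 hj).2
  -- The strictness comes from here: c > 1 and i < j.
  have h3 : 0 < ∑ i ∈ Finset.range k, ∑ j ∈ Finset.Ico k l, w i j * ((c - 1) * ((j : ℝ) - i)) := by
    refine Finset.sum_pos (fun i hi => Finset.sum_pos (fun j hj => ?_) ⟨k, by simp [hkl]⟩)
      ⟨0, by simpa using hk⟩
    rw [Finset.mem_range] at hi
    rw [Finset.mem_Ico] at hj
    refine mul_pos (hwpos i j hi hj.1 hj.2) (mul_pos (by linarith) ?_)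
    have : (i : ℝ) < j := by exact_mod_cast (by omega : i < j)
    linarith
  have h4 : c * ∑ i ∈ Finset.range k, ∑ j ∈ Finset.Ico k l, 1 / (c * (X j - X i)) =
      repulsion l k X := by
    simp only [repulsion, Finset.mul_sum]
    refine Finset.sum_congr rfl fun i hi => Finset.sum_congr rfl fun j hj => ?_
    rw [one_div, mul_inv, one_div, mul_inv_cancel_left₀ hc0.ne']
  have h5 : ∑ i ∈ Finset.range k, ∑ j ∈ Finset.Ico k l, 1 / (c * (X j - X i)) <
      repulsion l k X' := by linarith
  calc repulsion l k X = c * _ := h4.symm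
    _ < c * repulsion l k X' := by gcongr

include hmono hmono' he he' he0 he0' hel hel' hnn hnn' in
-- If the claim failed, the ratio e'/e would have a maximum c > 1 at some interior k. A closed gap
-- there contradicts the second difference equation; an open gap contradicts equality of the
-- products, because `repulsion_lt` gives e_k R_k < c e_k R'_k = e'_k R'_k, where R and R' are the
-- repulsions.
lemma partialSum_le_of_gates_eq
    (hE : ∀ k, 0 < k → k < l → (X k = X (k - 1) ∧ X' k = X' (k - 1)) ∨
      (X (k - 1) < X k ∧ X' (k - 1) < X' k ∧ e k * repulsion l k X = e' k * repulsion l k X')) :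
    ∀ k ≤ l, e' k ≤ e k := by
  by_contra! hcon
  obtain ⟨k₁, hk₁l, hk₁⟩ := hcon
  -- The gap is 1 plus the second difference of the partial sums.
  have hgapX : ∀ k, 0 < k → X k - X (k - 1) = 1 + (e (k + 1) + e (k - 1) - 2 * e k) := by
    intro k hk
    have h1 := he k
    have h2 := he (k - 1)
    rw [Nat.sub_add_cancel hk] at h2
    have : ((k - 1 : ℕ) : ℝ) = k - 1 := by push_cast [Nat.cast_sub (by omega : 1 ≤ k)]; ring
    rw [this] at h2
    linarith
  have hgapX' : ∀ k, 0 < k → X' k - X' (k - 1) = 1 + (e' (k + 1) + e' (k - 1) - 2 * e' k) := by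
    intro k hk
    have h1 := he' k
    have h2 := he' (k - 1)
    rw [Nat.sub_add_cancel hk] at h2
    have : ((k - 1 : ℕ) : ℝ) = k - 1 := by push_cast [Nat.cast_sub (by omega : 1 ≤ k)]; ring
    rw [this] at h2
    linarith
  -- Where e_k = 0 the gap is at least 1, hence open, and the product equation forces e'_k = 0. So
  -- it suffices to bound the ratio where e is positive.
  have hzero : ∀ k ≤ l, e k = 0 → e' k = 0 := by
    intro k hkl hek
    rcases Nat.eq_zero_or_pos k with rfl | hk
    · exact he0'
    rcases hkl.eq_or_lt with rfl | hkl
    · exact hel'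
    rcases hE k hk hkl with ⟨h, -⟩ | ⟨h1, h2, h3⟩
    · have := hgapX k hk
      have := hnn (k + 1) (by omega)
      have := hnn (k - 1) (by omega)
      linarith
    · rw [hek, zero_mul] at h3
      exact (mul_eq_zero.1 h3.symm).resolve_right (repulsion_pos hmono' hk hkl h2).ne'
  have hne : ((Finset.range (l + 1)).filter fun k => 0 < e k).Nonempty := by
    refine ⟨k₁, Finset.mem_filter.2 ⟨Finset.mem_range.2 (by omega), ?_⟩⟩
    refine lt_of_le_of_ne (hnn k₁ hk₁l) fun h => ?_
    rw [hzero k₁ hk₁l h.symm, ← h] at hk₁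
    exact lt_irrefl _ hk₁
  obtain ⟨k, hkmem, hkmax⟩ := Finset.exists_max_image _ (fun k => e' k / e k) hne
  simp only [Finset.mem_filter, Finset.mem_range] at hkmem hkmax
  obtain ⟨hkl1, hekpos⟩ := hkmem
  set c := e' k / e k with hcdef
  have hle : ∀ j ≤ l, e' j ≤ c * e j := by
    intro j hj
    rcases (hnn j hj).eq_or_lt with h | h
    · rw [hzero j hj h.symm, ← h, mul_zero]
    · exact (div_le_iff₀ h).1 (hkmax j ⟨by omega, h⟩)
  have hek : e' k = c * e k := by rw [hcdef]; field_simp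
  have hc : 1 < c := by
    have h1 := hle k₁ hk₁l
    by_contra hcle
    rw [not_lt] at hcle
    have := mul_le_mul_of_nonneg_right hcle (hnn k₁ hk₁l)
    linarith
  have hk0 : 0 < k := by
    rcases Nat.eq_zero_or_pos k with rfl | h
    · rw [he0] at hekpos; exact absurd hekpos (lt_irrefl _)
    · exact h
  have hkl : k < l := by
    rcases (Nat.lt_succ_iff.1 hkl1).eq_or_lt with h | h
    · rw [h, hel] at hekpos; exact absurd hekpos (lt_irrefl _)
    · exact h
  rcases hE k hk0 hkl with ⟨h1, h2⟩ | ⟨h1, h2, h3⟩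
  -- Both gaps closed means 2e_k = 1 + e_{k+1} + e_{k−1}, and likewise for e'. Then 2c e_k = 2e'_k ≤
  -- 1 + c(2e_k − 1), which fails for c > 1.
  · have e1 := hgapX k hk0
    have e2 := hgapX' k hk0
    have e3 := hle (k + 1) (by omega)
    have e4 := hle (k - 1) (by omega)
    nlinarith
  · have h4 := repulsion_lt hmono hmono' he he' hc hle hk0 hkl hek h1 h2
    rw [hek, mul_comm c, mul_assoc] at h3
    exact absurd (mul_left_cancel₀ hekpos.ne' h3) h4.ne

end Comparison

end NeckCoordinates

/-! ### The neck coordinates E_I -/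

section NeckGates

variable {l : ℕ}

/-- `exp (-e / s)` for `s > 0`, extended by `0`. -/
def gate (s e : ℝ) : ℝ := if s ≤ 0 then 0 else Real.exp (-(e / s))

lemma gate_nonneg (s e : ℝ) : 0 ≤ gate s e := by
  unfold gate; split_ifs; exacts [le_rfl, (Real.exp_pos _).le]

lemma gate_pos_iff {s e : ℝ} : 0 < gate s e ↔ 0 < s := by
  unfold gate; split_ifs with h
  · simp [h]
  · simp [Real.exp_pos, not_le.1 h]

lemma gate_le_one {s e : ℝ} (he : 0 ≤ e) : gate s e ≤ 1 := by
  unfold gate; split_ifs with h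
  · exact zero_le_one
  · exact Real.exp_le_one_iff.2 (neg_nonpos.2 (div_nonneg he (not_le.1 h).le))

lemma gate_lt_one {s e : ℝ} (he : 0 < e) : gate s e < 1 := by
  unfold gate; split_ifs with h
  · exact zero_lt_one
  · rw [← Real.exp_zero]
    exact Real.exp_lt_exp.2 (neg_neg_of_pos (div_pos he (not_le.1 h)))

lemma gate_zero_right {s : ℝ} (hs : 0 < s) : gate s 0 = 1 := by
  simp [gate, not_le.2 hs]

/-- For positive slack the extension by 0 is the standard flat function, so gates are smooth across
closing gaps in the interior of the polytope. -/
lemma gate_eq_expNegInvGlue {s e : ℝ} (he : 0 < e) : gate s e = expNegInvGlue (s / e) := by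
  unfold gate expNegInvGlue
  have : s / e ≤ 0 ↔ s ≤ 0 := by rw [div_le_iff₀ he, zero_mul]
  simp only [this, inv_div]

/-- Moving two points towards each other decreases the repulsion. -/
lemma gate_mul_gate_le {s t η e : ℝ} (he : 0 ≤ e) (hη : 0 ≤ η) (h : s + η ≤ t - η) :
    gate s e * gate t e ≤ gate (s + η) e * gate (t - η) e := by
  by_cases hs : s ≤ 0
  · rw [gate, if_pos hs, zero_mul]
    exact mul_nonneg (gate_nonneg _ _) (gate_nonneg _ _)
  · rw [not_le] at hs
    have h1 : 0 < s + η := by linarith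
    have h2 : 0 < t - η := by linarith
    have h3 : 0 < t := by linarith
    unfold gate
    rw [if_neg hs.not_ge, if_neg h1.not_ge, if_neg h2.not_ge, if_neg h3.not_ge, ← Real.exp_add,
      ← Real.exp_add, Real.exp_le_exp]
    -- The sum of the two gaps stays s + t while their product grows.
    have : e / (s + η) + e / (t - η) ≤ e / s + e / t := by
      rw [div_add_div _ _ h1.ne' h2.ne', div_add_div _ _ hs.ne' h3.ne']
      have e1 : e * (t - η) + (s + η) * e = e * (s + t) := by ring
      have e2 : e * t + s * e = e * (s + t) := by ring
      rw [e1, e2]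
      apply div_le_div_of_nonneg_left (mul_nonneg he (by linarith)) (mul_pos hs h3)
      nlinarith
    linarith

/-- The gate jumps where the slack vanishes and the gap is not positive. On the polytope this never
occurs, since a vanishing slack keeps all the relevant gaps open (`gap_of_slack_eq_zero`). -/
lemma continuousAt_gate {s e : ℝ} (h : s ≤ 0 → 0 < e) :
    ContinuousAt (fun q : ℝ × ℝ => gate q.1 q.2) (s, e) := by
  by_cases hs : s ≤ 0
  · have he := h hs
    have h1 : ContinuousAt (fun q : ℝ × ℝ => expNegInvGlue (q.1 / q.2)) (s, e) := by
      have h2 : ContinuousAt (fun q : ℝ × ℝ => q.1 / q.2) (s, e) :=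
        continuousAt_fst.div continuousAt_snd he.ne'
      exact (expNegInvGlue.contDiff (n := 0)).continuous.continuousAt.comp h2
    refine h1.congr ?_
    filter_upwards [(isOpen_lt continuous_const continuous_snd).mem_nhds
      (show (s, e) ∈ {q : ℝ × ℝ | 0 < q.2} from he)] with q hq
    exact (gate_eq_expNegInvGlue hq).symm
  · rw [not_le] at hs
    have h1 : ContinuousAt (fun q : ℝ × ℝ => Real.exp (-(q.2 / q.1))) (s, e) :=
      Real.continuous_exp.continuousAt.comp
        (continuousAt_snd.div continuousAt_fst hs.ne').neg
    refine h1.congr ?_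
    filter_upwards [(isOpen_lt continuous_const continuous_fst).mem_nhds
      (show (s, e) ∈ {q : ℝ × ℝ | 0 < q.1} from hs)] with q hq
    rw [gate, if_neg (not_le.2 hq)]

/-- The coordinate of the neck at `I`, `0` if there is no neck, `1` if the neck is broken. -/
def neckCoord (I : Finset (Fin l)) (x : Fin l → ℝ) : ℝ :=
  ∏ i ∈ I, ∏ j ∈ Iᶜ, gate (x j - x i) (slack I x)

lemma neckCoord_nonneg (I : Finset (Fin l)) (x : Fin l → ℝ) : 0 ≤ neckCoord I x :=
  Finset.prod_nonneg fun _ _ => Finset.prod_nonneg fun _ _ => gate_nonneg _ _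

lemma neckCoord_le_one {I : Finset (Fin l)} {x : Fin l → ℝ} (h : 0 ≤ slack I x) :
    neckCoord I x ≤ 1 :=
  Finset.prod_le_one (fun _ _ => Finset.prod_nonneg fun _ _ => gate_nonneg _ _) fun _ _ =>
    Finset.prod_le_one (fun _ _ => gate_nonneg _ _) fun _ _ => gate_le_one h

lemma neckCoord_pos_iff {I : Finset (Fin l)} {x : Fin l → ℝ} :
    0 < neckCoord I x ↔ ∀ i ∈ I, ∀ j ∉ I, x i < x j := by
  constructor
  · intro h i hi j hj
    have h1 : ∏ j ∈ Iᶜ, gate (x j - x i) (slack I x) ≠ 0 := fun h0 =>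
      h.ne' (Finset.prod_eq_zero hi h0)
    have h2 : gate (x j - x i) (slack I x) ≠ 0 := fun h0 =>
      h1 (Finset.prod_eq_zero (Finset.mem_compl.2 hj) h0)
    have := gate_pos_iff.1 (lt_of_le_of_ne (gate_nonneg _ _) h2.symm)
    linarith
  · intro h
    refine Finset.prod_pos fun i hi => Finset.prod_pos fun j hj => gate_pos_iff.2 ?_
    have := h i hi j (Finset.mem_compl.1 hj)
    linarith

/-- Turns equality of positive neck coordinates into equality of slack times repulsion, the form
required by the maximum principle. -/
lemma neckCoord_eq_exp {I : Finset (Fin l)} {x : Fin l → ℝ} (h : ∀ i ∈ I, ∀ j ∉ I, x i < x j) :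
    neckCoord I x = Real.exp (-(slack I x * ∑ i ∈ I, ∑ j ∈ Iᶜ, 1 / (x j - x i))) := by
  rw [Finset.mul_sum, ← Finset.sum_neg_distrib, Real.exp_sum]
  refine Finset.prod_congr rfl fun i hi => ?_
  rw [Finset.mul_sum, ← Finset.sum_neg_distrib, Real.exp_sum]
  refine Finset.prod_congr rfl fun j hj => ?_
  have := h i hi j (Finset.mem_compl.1 hj)
  rw [gate, if_neg (by linarith), mul_one_div]

lemma neckCoord_map (σ : Equiv.Perm (Fin l)) (I : Finset (Fin l)) (x : Fin l → ℝ) :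
    neckCoord (I.map σ.toEmbedding) x = neckCoord I (x ∘ σ) := by
  unfold neckCoord
  rw [Finset.prod_map, slack_map]
  refine Finset.prod_congr rfl fun i _ => ?_
  have : (I.map σ.toEmbedding)ᶜ = Iᶜ.map σ.toEmbedding := by
    ext j; simp [Finset.mem_map_equiv]
  rw [this, Finset.prod_map]
  rfl

lemma slack_insert {I : Finset (Fin l)} {j : Fin l} (hj : j ∉ I) (x : Fin l → ℝ) :
    slack (insert j I) x = slack I x + (x j - (I.card + 1)) := by
  rw [slack, slack, Finset.sum_insert hj, Finset.card_insert_of_notMem hj]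
  push_cast
  ring

/-- Removing i from a tight set leaves a set whose sum is still at least minimal, which bounds x_i
from above. Adding an outside index bounds its coordinate from below in the next lemma; together
they separate a tight set from its complement. -/
lemma le_of_slack_eq_zero {x : Fin l → ℝ} (hx : x ∈ permPolytope l) {I : Finset (Fin l)}
    (h : slack I x = 0) {i : Fin l} (hi : i ∈ I) : x i ≤ I.card := by
  have h1 := slack_insert (Finset.notMem_erase i I) x
  rw [Finset.insert_erase hi, h, Finset.card_erase_of_mem hi] at h1
  have h2 := hx.1 (I.erase i)
  have : 1 ≤ I.card := Finset.card_pos.2 ⟨i, hi⟩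
  push_cast [this] at h1
  linarith

lemma lt_of_slack_eq_zero {x : Fin l → ℝ} (hx : x ∈ permPolytope l) {I : Finset (Fin l)}
    (h : slack I x = 0) {j : Fin l} (hj : j ∉ I) : (I.card : ℝ) + 1 ≤ x j := by
  have h1 := slack_insert hj x
  have h2 := hx.1 (insert j I)
  linarith

lemma gap_of_slack_eq_zero {x : Fin l → ℝ} (hx : x ∈ permPolytope l) {I : Finset (Fin l)}
    (h : slack I x = 0) {i j : Fin l} (hi : i ∈ I) (hj : j ∉ I) : 0 < x j - x i := by
  have := le_of_slack_eq_zero hx h hi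
  have := lt_of_slack_eq_zero hx h hj
  linarith

lemma neckCoord_lt_one {I : Finset (Fin l)} (hne : I ≠ ∅) (hnu : I ≠ Finset.univ)
    {x : Fin l → ℝ} (h : 0 < slack I x) : neckCoord I x < 1 := by
  obtain ⟨i, hi⟩ := Finset.nonempty_iff_ne_empty.2 hne
  obtain ⟨j, hj⟩ : ∃ j, j ∈ Iᶜ := by
    by_contra! hcon
    exact hnu (Finset.eq_univ_iff_forall.2 fun j => by simpa using hcon j)
  have h1 : ∏ j ∈ Iᶜ, gate (x j - x i) (slack I x) < 1 := by
    rw [← Finset.mul_prod_erase _ _ hj]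
    refine mul_lt_one_of_nonneg_of_lt_one_left (gate_nonneg _ _) (gate_lt_one h) ?_
    exact Finset.prod_le_one (fun _ _ => gate_nonneg _ _) fun _ _ => gate_le_one h.le
  unfold neckCoord
  rw [← Finset.mul_prod_erase _ _ hi]
  refine mul_lt_one_of_nonneg_of_lt_one_left
    (Finset.prod_nonneg fun _ _ => gate_nonneg _ _) h1 ?_
  exact Finset.prod_le_one (fun _ _ => Finset.prod_nonneg fun _ _ => gate_nonneg _ _) fun _ _ =>
    Finset.prod_le_one (fun _ _ => gate_nonneg _ _) fun _ _ => gate_le_one h.le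

lemma neckCoord_eq_one_iff {I : Finset (Fin l)} (hne : I ≠ ∅) (hnu : I ≠ Finset.univ)
    {x : Fin l → ℝ} (hx : x ∈ permPolytope l) : neckCoord I x = 1 ↔ slack I x = 0 := by
  constructor
  · intro h
    by_contra h0
    exact (neckCoord_lt_one hne hnu (lt_of_le_of_ne (hx.1 I) (Ne.symm h0))).ne h
  · intro h
    refine Finset.prod_eq_one fun i hi => Finset.prod_eq_one fun j hj => ?_
    rw [h, gate_zero_right (gap_of_slack_eq_zero hx h hi (Finset.mem_compl.1 hj))]

lemma continuous_slack (I : Finset (Fin l)) : Continuous (slack I) := by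
  unfold slack; fun_prop

lemma contDiff_slack (I : Finset (Fin l)) {n : WithTop ℕ∞} : ContDiff ℝ n (slack I) := by
  unfold slack; fun_prop

lemma continuousAt_neckCoord {I : Finset (Fin l)} {x : Fin l → ℝ} (hx : x ∈ permPolytope l) :
    ContinuousAt (neckCoord I) x := by
  unfold neckCoord
  refine tendsto_finsetProd _ fun i hi => tendsto_finsetProd _ fun j hj => ?_
  have h1 : ContinuousAt (fun q : ℝ × ℝ => gate q.1 q.2) (x j - x i, slack I x) := by
    refine continuousAt_gate fun hs => lt_of_le_of_ne (hx.1 I) fun h => ?_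
    have := gap_of_slack_eq_zero hx h.symm hi (Finset.mem_compl.1 hj)
    linarith
  exact ContinuousAt.comp (f := fun x : Fin l → ℝ => (x j - x i, slack I x)) h1
    (((continuous_apply j).sub (continuous_apply i)).prodMk (continuous_slack I)).continuousAt

lemma contDiffAt_neckCoord {I : Finset (Fin l)} {x : Fin l → ℝ} (hx : 0 < slack I x) :
    ContDiffAt ℝ ∞ (neckCoord I) x := by
  have hev : neckCoord I =ᶠ[𝓝 x] fun x =>
      ∏ i ∈ I, ∏ j ∈ Iᶜ, expNegInvGlue ((x j - x i) / slack I x) := by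
    filter_upwards [(isOpen_lt continuous_const (continuous_slack I)).mem_nhds hx] with y hy
    exact Finset.prod_congr rfl fun i _ => Finset.prod_congr rfl fun j _ =>
      gate_eq_expNegInvGlue hy
  refine ContDiffAt.congr_of_eventuallyEq ?_ hev
  refine contDiffAt_prod fun i _ => contDiffAt_prod fun j _ => ?_
  refine expNegInvGlue.contDiff.contDiffAt.comp x ?_
  exact ((contDiff_apply ℝ ℝ j).sub (contDiff_apply ℝ ℝ i)).contDiffAt.div
    (contDiff_slack I).contDiffAt hx.ne'

/-! #### The neck coordinates of an increasing sequence -/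

/-- Move two consecutive coordinates towards each other. -/
def squeeze (y : Fin l → ℝ) (a b : Fin l) (η : ℝ) : Fin l → ℝ :=
  y + η • (Pi.single a 1 - Pi.single b 1)

lemma squeeze_left {y : Fin l → ℝ} {a b : Fin l} (hab : a ≠ b) (η : ℝ) :
    squeeze y a b η a = y a + η := by
  simp [squeeze, hab]

lemma squeeze_right {y : Fin l → ℝ} {a b : Fin l} (hab : a ≠ b) (η : ℝ) :
    squeeze y a b η b = y b - η := by
  simp [squeeze, hab.symm, sub_eq_add_neg]

lemma squeeze_other {y : Fin l → ℝ} {a b c : Fin l} (ha : c ≠ a) (hb : c ≠ b) (η : ℝ) :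
    squeeze y a b η c = y c := by
  simp [squeeze, ha, hb]

lemma slack_squeeze (y : Fin l → ℝ) (a b : Fin l) (η : ℝ) (I : Finset (Fin l)) :
    slack I (squeeze y a b η) = slack I y +
      η * ((if a ∈ I then 1 else 0) - if b ∈ I then 1 else 0) := by
  simp only [slack, squeeze, Pi.add_apply, Pi.smul_apply, Pi.sub_apply, smul_eq_mul,
    Finset.sum_add_distrib, ← Finset.mul_sum, Finset.sum_sub_distrib]
  simp [Pi.single_apply]
  ring

/-- With a and b on the same side of I the slack does not change. Only the gates joining a and b to
a common index on the other side do, and each such pair is controlled by `gate_mul_gate_le`. -/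
lemma neckCoord_le_squeeze {y : Fin l → ℝ} {a b : Fin l} (hab : a ≠ b) {η : ℝ} (hη : 0 ≤ η)
    (h : y a + η ≤ y b - η) {I : Finset (Fin l)} (hI : 0 ≤ slack I y) (habI : a ∈ I ↔ b ∈ I) :
    neckCoord I y ≤ neckCoord I (squeeze y a b η) := by
  have hs : slack I (squeeze y a b η) = slack I y := by
    rw [slack_squeeze]; simp [habI]
  unfold neckCoord
  rw [hs]
  by_cases ha : a ∈ I
  · have hb := habI.1 ha
    rw [Finset.prod_comm, Finset.prod_comm (s := I)]
    refine Finset.prod_le_prod (fun _ _ => Finset.prod_nonneg fun _ _ => gate_nonneg _ _)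
      fun j hj => ?_
    have hja : j ≠ a := fun h => Finset.mem_compl.1 hj (h ▸ ha)
    have hjb : j ≠ b := fun h => Finset.mem_compl.1 hj (h ▸ hb)
    have hb' : b ∈ I.erase a := Finset.mem_erase.2 ⟨hab.symm, hb⟩
    rw [squeeze_other hja hjb, ← Finset.mul_prod_erase _ _ ha, ← Finset.mul_prod_erase _ _ hb',
      ← Finset.mul_prod_erase _ (fun i => gate (y j - squeeze y a b η i) (slack I y)) ha,
      ← Finset.mul_prod_erase _ (fun i => gate (y j - squeeze y a b η i) (slack I y)) hb',
      squeeze_left hab, squeeze_right hab, ← mul_assoc, ← mul_assoc]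
    refine mul_le_mul ?_ (le_of_eq ?_) (Finset.prod_nonneg fun _ _ => gate_nonneg _ _)
      (mul_nonneg (gate_nonneg _ _) (gate_nonneg _ _))
    · have := gate_mul_gate_le (s := y j - y b) (t := y j - y a) hI hη (by linarith)
      rw [mul_comm, mul_comm (gate (y j - (y a + η)) _),
        show y j - (y b - η) = y j - y b + η by ring,
        show y j - (y a + η) = y j - y a - η by ring]
      exact this
    · refine Finset.prod_congr rfl fun i hi => ?_
      simp only [Finset.mem_erase] at hi
      rw [squeeze_other hi.2.1 hi.1]
  · have hb : b ∉ I := fun h => ha (habI.2 h)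
    refine Finset.prod_le_prod (fun _ _ => Finset.prod_nonneg fun _ _ => gate_nonneg _ _)
      fun i hi => ?_
    have hia : i ≠ a := fun h => ha (h ▸ hi)
    have hib : i ≠ b := fun h => hb (h ▸ hi)
    have ha' : a ∈ Iᶜ := Finset.mem_compl.2 ha
    have hb' : b ∈ Iᶜ.erase a := Finset.mem_erase.2 ⟨hab.symm, Finset.mem_compl.2 hb⟩
    rw [squeeze_other hia hib, ← Finset.mul_prod_erase _ _ ha', ← Finset.mul_prod_erase _ _ hb',
      ← Finset.mul_prod_erase _ (fun j => gate (squeeze y a b η j - y i) (slack I y)) ha',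
      ← Finset.mul_prod_erase _ (fun j => gate (squeeze y a b η j - y i) (slack I y)) hb',
      squeeze_left hab, squeeze_right hab, ← mul_assoc, ← mul_assoc]
    refine mul_le_mul ?_ (le_of_eq ?_) (Finset.prod_nonneg fun _ _ => gate_nonneg _ _)
      (mul_nonneg (gate_nonneg _ _) (gate_nonneg _ _))
    · have := gate_mul_gate_le (s := y a - y i) (t := y b - y i) hI hη (by linarith)
      rw [show y a + η - y i = y a - y i + η by ring, show y b - η - y i = y b - y i - η by ring]
      exact this
    · refine Finset.prod_congr rfl fun j hj => ?_
      simp only [Finset.mem_erase] at hj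
      rw [squeeze_other hj.2.1 hj.1]

end NeckGates

/-! ### The neck lengths as coordinates on the permutohedron -/

section NeckLengths

variable {l : ℕ}

lemma sum_compl_initialSegment (F : ℕ → ℝ) (k : ℕ) :
    ∑ j ∈ (initialSegment l k)ᶜ, F j = ∑ j ∈ Finset.Ico k l, F j := by
  have : (initialSegment l k)ᶜ = Finset.univ.filter fun i : Fin l => k ≤ (i : ℕ) := by
    ext i; simp
  rw [this, Finset.sum_filter, Fin.sum_univ_eq_sum_range (fun j => if k ≤ j then F j else 0) l,
    ← Finset.sum_filter]
  congr 1
  ext j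
  simp only [Finset.mem_filter, Finset.mem_range, Finset.mem_Ico]
  omega

lemma sum_repulsion (y : Fin l → ℝ) {k : ℕ} (hk : k ≤ l) :
    ∑ i ∈ initialSegment l k, ∑ j ∈ (initialSegment l k)ᶜ, 1 / (y j - y i) =
      repulsion l k (extendZero y) := by
  unfold repulsion
  rw [← sum_initialSegment _ hk]
  refine Finset.sum_congr rfl fun i _ => ?_
  rw [← sum_compl_initialSegment]
  simp only [extendZero_coe]

lemma extendZero_mono {y : Fin l → ℝ} (hy : Monotone y) (i j : ℕ) (hij : i ≤ j) (hj : j < l) :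
    extendZero y i ≤ extendZero y j := by
  simp only [extendZero, hj, lt_of_le_of_lt hij hj, dif_pos]
  exact hy hij

lemma extendZero_lt_iff {y : Fin l → ℝ} (hy : Monotone y) {k : ℕ} (hk : 0 < k) (hkl : k < l) :
    extendZero y (k - 1) < extendZero y k ↔
      ∀ i ∈ initialSegment l k, ∀ j ∉ initialSegment l k, y i < y j := by
  have hk1 : k - 1 < l := by omega
  simp only [extendZero, hkl, hk1, dif_pos]
  constructor
  · intro h i hi j hj
    rw [mem_initialSegment] at hi hj
    have h1 : y i ≤ y ⟨k - 1, hk1⟩ := hy (by rw [Fin.le_def]; simp; omega)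
    have h2 : y ⟨k, hkl⟩ ≤ y j := hy (by rw [Fin.le_def]; simp; omega)
    linarith
  · intro h
    exact h _ (by simp; omega) _ (by simp)

/-- The comparison applied in both directions gives equal slacks on all initial segments, and the
coordinates are recovered as consecutive differences. -/
lemma eq_of_neckCoord_eq_of_monotone {y y' : Fin l → ℝ} (hy : Monotone y) (hy' : Monotone y')
    (hyP : y ∈ permPolytope l) (hyP' : y' ∈ permPolytope l)
    (h : ∀ k, 0 < k → k < l →
      neckCoord (initialSegment l k) y = neckCoord (initialSegment l k) y') : y = y' := by
  have key : ∀ y y' : Fin l → ℝ, Monotone y → Monotone y' → y ∈ permPolytope l →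
      y' ∈ permPolytope l → (∀ k, 0 < k → k < l →
      neckCoord (initialSegment l k) y = neckCoord (initialSegment l k) y') →
      ∀ k ≤ l, slack (initialSegment l k) y' ≤ slack (initialSegment l k) y := by
    intro y y' hy hy' hyP hyP' h k hk
    rw [slack_initialSegment _ hk, slack_initialSegment _ hk]
    have hl : ∀ z ∈ permPolytope l,
        ∑ j ∈ Finset.range l, (extendZero z j - ((j : ℝ) + 1)) = 0 := fun z hz => by
      rw [← slack_initialSegment _ le_rfl, initialSegment_self]; exact hz.2
    refine partialSum_le_of_gates_eq (l := l) (X := extendZero y) (X' := extendZero y')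
      (e := fun k => ∑ j ∈ Finset.range k, (extendZero y j - ((j : ℝ) + 1)))
      (e' := fun k => ∑ j ∈ Finset.range k, (extendZero y' j - ((j : ℝ) + 1)))
      (extendZero_mono hy) (extendZero_mono hy')
      (fun k => Finset.sum_range_succ _ k) (fun k => Finset.sum_range_succ _ k) (by simp)
      (by simp) (hl y hyP) (hl y' hyP') (fun k hk => ?_) (fun k hk => ?_) ?_ k hk
    · rw [← slack_initialSegment _ hk]; exact hyP.1 _
    · rw [← slack_initialSegment _ hk]; exact hyP'.1 _
    · intro k hk hkl
      have hm := extendZero_mono hy (k - 1) k (by omega) hkl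
      have hm' := extendZero_mono hy' (k - 1) k (by omega) hkl
      have hE := h k hk hkl
      by_cases hpos : 0 < neckCoord (initialSegment l k) y
      · right
        have hpos' := hpos
        rw [hE] at hpos'
        have h1 := neckCoord_pos_iff.1 hpos
        have h2 := neckCoord_pos_iff.1 hpos'
        refine ⟨(extendZero_lt_iff hy hk hkl).2 h1, (extendZero_lt_iff hy' hk hkl).2 h2, ?_⟩
        rw [neckCoord_eq_exp h1, neckCoord_eq_exp h2, Real.exp_eq_exp, neg_inj,
          sum_repulsion _ hkl.le, sum_repulsion _ hkl.le, slack_initialSegment _ hkl.le,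
          slack_initialSegment _ hkl.le] at hE
        exact hE
      -- A vanishing neck coordinate means that the k-th gap is closed, for both sequences alike.
      · left
        have hpos' := hpos
        rw [hE] at hpos'
        rw [neckCoord_pos_iff, ← extendZero_lt_iff hy hk hkl, not_lt] at hpos
        rw [neckCoord_pos_iff, ← extendZero_lt_iff hy' hk hkl, not_lt] at hpos'
        exact ⟨le_antisymm hpos hm, le_antisymm hpos' hm'⟩
  have heq : ∀ k ≤ l, slack (initialSegment l k) y = slack (initialSegment l k) y' := fun k hk =>
    le_antisymm (key y' y hy' hy hyP' hyP (fun k h0 h1 => (h k h0 h1).symm) k hk)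
      (key y y' hy hy' hyP hyP' h k hk)
  ext i
  have h1 := heq i i.2.le
  have h2 := heq (i + 1) i.2
  rw [slack_initialSegment _ i.2.le, slack_initialSegment _ i.2.le] at h1
  rw [slack_initialSegment _ (by omega), slack_initialSegment _ (by omega),
    Finset.sum_range_succ, Finset.sum_range_succ, h1, extendZero_coe, extendZero_coe] at h2
  linarith

lemma monotone_squeeze {y : Fin l → ℝ} (hy : Monotone y) {k : ℕ} (hk : 0 < k) (hkl : k < l) {η : ℝ}
    (hη : 0 ≤ η) (h : y ⟨k - 1, by omega⟩ + η ≤ y ⟨k, hkl⟩ - η) :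
    Monotone (squeeze y ⟨k - 1, by omega⟩ ⟨k, hkl⟩ η) := by
  set a : Fin l := ⟨k - 1, by omega⟩ with ha
  set b : Fin l := ⟨k, hkl⟩ with hb
  have hab : a ≠ b := by rw [ha, hb]; simp; omega
  intro i j hij
  rcases hij.eq_or_lt with rfl | hij'
  · exact le_rfl
  have hmono := hy hij
  have hij'' : (i : ℕ) < j := hij'
  by_cases hia : i = a
  · subst hia
    by_cases hjb : j = b
    · rw [hjb, squeeze_left hab, squeeze_right hab]; exact h
    · have hja : j ≠ a := hij'.ne'
      have : y b ≤ y j := hy (by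
        rw [Fin.le_def]
        have : (a : ℕ) = k - 1 := rfl
        have : (b : ℕ) = k := rfl
        omega)
      rw [squeeze_left hab, squeeze_other hja hjb]
      linarith
  · by_cases hib : i = b
    · have hja : j ≠ a := by
        rintro rfl
        rw [hib] at hij''
        have : (a : ℕ) = k - 1 := rfl
        have : (b : ℕ) = k := rfl
        omega
      have hjb : j ≠ b := by rintro rfl; exact hij'.ne hib
      rw [hib, squeeze_right hab, squeeze_other hja hjb]
      rw [hib] at hmono
      linarith
    · rw [squeeze_other hia hib]
      by_cases hja : j = a
      · rw [hja, squeeze_left hab]; rw [hja] at hmono; linarith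
      · by_cases hjb : j = b
        · have : y i ≤ y a := hy (by
            rw [Fin.le_def]
            rw [hjb] at hij''
            have : (a : ℕ) = k - 1 := rfl
            have : (b : ℕ) = k := rfl
            omega)
          rw [hjb, squeeze_right hab]
          linarith
        · rw [squeeze_other hja hjb]; exact hmono

/-- Maximize the total slack of the initial segments over sorted points with E_k ≥ c_k for all k;
the sorted vertex, where all E_k are 1, is admissible. If E_k > c_k at a maximum, the k-th gap is
open, and squeezing it slightly raises the k-th slack, keeps E_k > c_k by continuity and does not
lower any other E_m. This contradicts maximality. -/
lemma exists_monotone_neckCoord_eq (c : ℕ → ℝ) (hc0 : ∀ k, 0 ≤ c k) (hc1 : ∀ k, c k ≤ 1) :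
    ∃ y : Fin l → ℝ, Monotone y ∧ y ∈ permPolytope l ∧
      ∀ k, 0 < k → k < l → neckCoord (initialSegment l k) y = c k := by
  set K : Set (Fin l → ℝ) := {y ∈ permPolytope l | Monotone y ∧
    ∀ k, 0 < k → k < l → c k ≤ neckCoord (initialSegment l k) y} with hK
  have hcontP : ∀ I : Finset (Fin l), ContinuousOn (neckCoord I) (permPolytope l) := fun I x hx =>
    (continuousAt_neckCoord hx).continuousWithinAt
  have hKc : IsCompact K := by
    have h1 : IsClosed {y : Fin l → ℝ | Monotone y} := isClosed_monotone
    have h2 : ∀ k, IsClosed (permPolytope l ∩ (neckCoord (initialSegment l k)) ⁻¹' Ici (c k)) :=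
      fun k => (hcontP _).preimage_isClosed_of_isClosed isCompact_permPolytope.isClosed isClosed_Ici
    have h3 : K = permPolytope l ∩ ({y | Monotone y} ∩ ⋂ k, ⋂ (_ : 0 < k ∧ k < l),
        (permPolytope l ∩ (neckCoord (initialSegment l k)) ⁻¹' Ici (c k))) := by
      ext y
      simp only [hK, mem_ofPred_eq, mem_inter_iff, mem_iInter, mem_preimage, mem_Ici]
      constructor
      · rintro ⟨hyP, hym, h⟩
        exact ⟨hyP, hym, fun k hk => ⟨hyP, h k hk.1 hk.2⟩⟩
      · rintro ⟨hyP, hym, h⟩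
        exact ⟨hyP, hym, fun k hk hkl => (h k ⟨hk, hkl⟩).2⟩
    rw [h3]
    exact isCompact_permPolytope.inter_right
      (h1.inter (isClosed_iInter fun k => isClosed_iInter fun _ => h2 k))
  have hne : K.Nonempty := by
    refine ⟨fun i => ((i : ℕ) : ℝ) + 1, id_mem_permPolytope, fun i j hij => ?_, ?_⟩
    · have : (i : ℕ) ≤ j := hij
      simpa using this
    · intro k hk hkl
      rw [(neckCoord_eq_one_iff ?_ ?_ id_mem_permPolytope).2 (slack_initialSegment_id hkl.le)]
      · exact hc1 k
      · rw [← Finset.nonempty_iff_ne_empty]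
        exact ⟨⟨0, by omega⟩, by simpa using hk⟩
      · intro h
        have : (⟨k, hkl⟩ : Fin l) ∈ initialSegment l k := h ▸ Finset.mem_univ _
        simp at this
  obtain ⟨y, ⟨hyP, hym, hyc⟩, hmax⟩ := hKc.exists_isMaxOn hne
    (f := fun y => ∑ k ∈ Finset.range l, slack (initialSegment l k) y)
    (continuous_finsetSum _ fun k _ => continuous_slack _).continuousOn
  refine ⟨y, hym, hyP, fun k hk hkl => le_antisymm ?_ (hyc k hk hkl)⟩
  by_contra! hlt
  set a : Fin l := ⟨k - 1, by omega⟩ with ha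
  set b : Fin l := ⟨k, hkl⟩ with hb
  have hak : (a : ℕ) = k - 1 := rfl
  have hbk : (b : ℕ) = k := rfl
  have hab : a ≠ b := fun h => by
    have := congrArg (fun i : Fin l => (i : ℕ)) h
    simp only [hak, hbk] at this
    omega
  have hgap : y a < y b := neckCoord_pos_iff.1 (lt_of_le_of_lt (hc0 k) hlt) a
    (by rw [mem_initialSegment]; omega) b (by rw [mem_initialSegment]; omega)
  have hcont : ContinuousAt (fun η : ℝ => neckCoord (initialSegment l k) (squeeze y a b η)) 0 := by
    have h1 : squeeze y a b 0 = y := by simp [squeeze]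
    refine ContinuousAt.comp (g := neckCoord (initialSegment l k)) (f := squeeze y a b) (x := 0) ?_ ?_
    · rw [h1]; exact continuousAt_neckCoord hyP
    · unfold squeeze; fun_prop
  have h0 : neckCoord (initialSegment l k) (squeeze y a b 0) = neckCoord (initialSegment l k) y := by
    simp [squeeze]
  have hev : ∀ᶠ η in 𝓝[>] (0 : ℝ), c k < neckCoord (initialSegment l k) (squeeze y a b η) := by
    have := hcont.tendsto
    rw [h0] at this
    exact (this.mono_left nhdsWithin_le_nhds).eventually_const_lt hlt
  obtain ⟨η, hη1, hη0, hη2⟩ := (hev.and (Ioo_mem_nhdsGT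
    (show (0 : ℝ) < (y b - y a) / 2 by linarith))).exists
  have hηg : y a + η ≤ y b - η := by linarith
  have hmono := monotone_squeeze hym hk hkl hη0.le hηg
  -- A segment shorter than k contains neither of a, b and a longer one contains both; only the k-th
  -- contains a alone.
  have hslk : ∀ m ≤ l, slack (initialSegment l m) (squeeze y a b η) =
      slack (initialSegment l m) y + if m = k then η else 0 := by
    intro m _
    rw [slack_squeeze]
    simp only [mem_initialSegment, hak, hbk]
    congr 1
    split_ifs <;> first | omega | simp
  have hmem : squeeze y a b η ∈ K := by
    refine ⟨mem_permPolytope_of_monotone hmono (fun m hm => ?_) ?_, hmono, fun m hm hml => ?_⟩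
    · rw [hslk m hm]
      have := hyP.1 (initialSegment l m)
      split_ifs <;> linarith
    · rw [slack_squeeze]
      simp [hyP.2]
    · by_cases hmk : m = k
      · rw [hmk]; exact hη1.le
      · refine (hyc m hm hml).trans (neckCoord_le_squeeze hab hη0.le hηg (hyP.1 _) ?_)
        rw [mem_initialSegment, mem_initialSegment]
        omega
  have h1 := hmax hmem
  simp only [mem_ofPred_eq] at h1
  rw [Finset.sum_congr rfl fun m hm => hslk m (Finset.mem_range.1 hm).le,
    Finset.sum_add_distrib, Finset.sum_ite_eq' (Finset.range l) k (fun _ => η),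
    if_pos (Finset.mem_range.2 hkl)] at h1
  linarith

/-- The pattern of positive neck coordinates determines the order of the entries, so both points can
be sorted by the same permutation. -/
lemma eq_of_neckCoord_eq {x x' : Fin l → ℝ} (hx : x ∈ permPolytope l) (hx' : x' ∈ permPolytope l)
    (h : ∀ I : InternalVertex l, neckCoord I.1 x = neckCoord I.1 x') : x = x' := by
  set σ := Tuple.sort x
  have hσ : Monotone (x ∘ σ) := Tuple.monotone_sort x
  have hσ' : Monotone (x' ∘ σ) := by
    intro a b hab
    by_contra hlt
    rw [not_le] at hlt
    simp only [Function.comp] at hlt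
    -- If x' reverses the order of σ a and σ b, this sublevel set contains σ b but not σ a. Its neck
    -- coordinate is positive at x', hence also at x, which forces x (σ b) < x (σ a).
    set I : Finset (Fin l) := Finset.univ.filter fun i => x' i ≤ x' (σ b)
    have hbI : σ b ∈ I := by simp [I]
    have haI : σ a ∉ I := by simp [I, hlt]
    have hI : I ≠ ∅ ∧ I ≠ Finset.univ :=
      ⟨fun h => by simp [h] at hbI, fun h => haI (h ▸ Finset.mem_univ _)⟩
    have hpos : 0 < neckCoord I x' := by
      rw [neckCoord_pos_iff]
      intro i hi j hj
      simp only [I, Finset.mem_filter, Finset.mem_univ, true_and, not_le] at hi hj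
      linarith
    rw [← h ⟨I, hI⟩] at hpos
    have := neckCoord_pos_iff.1 hpos _ hbI _ haI
    exact absurd (hσ hab) (not_le.2 this)
  have := eq_of_neckCoord_eq_of_monotone hσ hσ' (comp_mem_permPolytope σ hx)
    (comp_mem_permPolytope σ hx') fun k hk hkl => by
      rw [← neckCoord_map, ← neckCoord_map]
      refine h ⟨(initialSegment l k).map σ.toEmbedding, ?_, ?_⟩
      · rw [← Finset.nonempty_iff_ne_empty]
        exact ⟨σ ⟨0, by omega⟩, by rw [Finset.mem_map_equiv]; simpa using hk⟩
      · intro hu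
        have : σ ⟨k, hkl⟩ ∈ (initialSegment l k).map σ.toEmbedding := hu ▸ Finset.mem_univ _
        rw [Finset.mem_map_equiv] at this
        simp at this
  ext i
  have := congrFun this (σ.symm i)
  simpa using this

lemma exists_neckCoord_eq (c : InternalVertex l → ℝ) (hc0 : ∀ I, 0 ≤ c I) (hc1 : ∀ I, c I ≤ 1)
    (hc : IsChain (· ≤ ·) {I | c I ≠ 0}) :
    ∃ x ∈ permPolytope l, ∀ I : InternalVertex l, neckCoord I.1 x = c I := by
  classical
  -- Minus the number of members of the chain that contain i. Sorting by a puts each member of the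
  -- chain first, making it an initial segment.
  set a : Fin l → ℝ := fun i =>
    -((Finset.univ.filter fun I : InternalVertex l => c I ≠ 0 ∧ i ∈ I.1).card : ℝ)
  set σ := Tuple.sort a
  have hσ : Monotone (a ∘ σ) := Tuple.monotone_sort a
  have hinit : ∀ I : InternalVertex l, c I ≠ 0 →
      I.1 = (initialSegment l I.1.card).map σ.toEmbedding := by
    intro I hI
    refine eq_map_initialSegment hσ fun i hi j hj => ?_
    simp only [a, neg_lt_neg_iff, Nat.cast_lt]
    apply Finset.card_lt_card
    rw [Finset.ssubset_iff_of_subset]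
    · exact ⟨I, by simp [hI, hi], by simp [hj]⟩
    · intro J hJ
      simp only [Finset.mem_filter, Finset.mem_univ, true_and] at hJ ⊢
      refine ⟨hJ.1, ?_⟩
      rcases hc.total (show I ∈ {I | c I ≠ 0} from hI) (show J ∈ {I | c I ≠ 0} from hJ.1) with h | h
      · exact h hi
      · exact absurd (h hJ.2) hj
  set c' : ℕ → ℝ := fun k =>
    if h : (initialSegment l k).map σ.toEmbedding ≠ ∅ ∧
      (initialSegment l k).map σ.toEmbedding ≠ Finset.univ then c ⟨_, h⟩ else 0
  obtain ⟨y, hym, hyP, hy⟩ := exists_monotone_neckCoord_eq (l := l) c'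
    (fun k => by simp only [c']; split_ifs; exacts [hc0 _, le_rfl])
    (fun k => by simp only [c']; split_ifs; exacts [hc1 _, zero_le_one])
  have hyσ : (y ∘ σ.symm) ∘ σ = y := by
    ext i; simp
  refine ⟨y ∘ σ.symm, comp_mem_permPolytope _ hyP, fun I => ?_⟩
  have hcase : ∀ I : InternalVertex l, I.1 = (initialSegment l I.1.card).map σ.toEmbedding →
      neckCoord I.1 (y ∘ σ.symm) = c I := by
    rintro ⟨I, hI⟩ hIeq
    simp only at hIeq ⊢
    have hcard0 : 0 < I.card := Finset.card_pos.2 (Finset.nonempty_iff_ne_empty.2 hI.1)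
    have hcardl : I.card < l := by
      simpa using (Finset.card_lt_iff_ne_univ I).2 hI.2
    have h1 := hy I.card hcard0 hcardl
    have h2 : neckCoord I (y ∘ σ.symm) = neckCoord (initialSegment l I.card) y := by
      conv_lhs => rw [hIeq]
      rw [neckCoord_map, hyσ]
    rw [h2, h1]
    have hI' := hI
    rw [hIeq] at hI'
    simp only [c', dif_pos hI']
    congr 1
    exact Subtype.ext hIeq.symm
  by_cases hI : c I = 0
  -- A vertex with positive neck coordinate is an initial segment of the sorted order, so its
  -- coordinate was prescribed to be c I after all.
  · by_contra hne
    have hpos : 0 < neckCoord I.1 (y ∘ σ.symm) :=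
      lt_of_le_of_ne (neckCoord_nonneg _ _) fun h => hne (by rw [← h, hI])
    refine hne (hcase I (eq_map_initialSegment (a := y ∘ σ.symm) ?_ (neckCoord_pos_iff.1 hpos)))
    rw [hyσ]; exact hym
  · exact hcase I (hinit I hI)

/-! #### The neck lengths -/

lemma continuous_neckLength_aux : ContinuousOn neckLength (Icc 0 1) := by
  intro E hE
  refine ContinuousAt.continuousWithinAt ?_
  unfold neckLength
  refine ENNReal.Tendsto.div (ENNReal.continuous_ofReal.continuousAt) ?_
    (ENNReal.continuous_ofReal.comp (continuous_const.sub continuous_id)).continuousAt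
    (Or.inr ENNReal.ofReal_ne_top)
  by_cases h : E = 0
  · right
    subst h
    simp
  · left
    rw [ENNReal.ofReal_ne_zero_iff]
    exact lt_of_le_of_ne hE.1 (Ne.symm h)

lemma neckLength_injOn : InjOn neckLength (Icc 0 1) := by
  intro E hE E' hE' h
  by_cases h1 : E = 1
  · rw [(neckLength_eq_top_iff hE.1 hE.2).2 h1] at h
    rw [h1, (neckLength_eq_top_iff hE'.1 hE'.2).1 h.symm]
  by_cases h2 : E' = 1
  · rw [(neckLength_eq_top_iff hE'.1 hE'.2).2 h2] at h
    rw [h2, (neckLength_eq_top_iff hE.1 hE.2).1 h]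
  have h3 : 0 < 1 - E := sub_pos.2 (lt_of_le_of_ne hE.2 h1)
  have h4 : 0 < 1 - E' := sub_pos.2 (lt_of_le_of_ne hE'.2 h2)
  rw [neckLength, neckLength, ← ENNReal.ofReal_div_of_pos h3, ← ENNReal.ofReal_div_of_pos h4,
    ENNReal.ofReal_eq_ofReal_iff (div_nonneg hE.1 h3.le) (div_nonneg hE'.1 h4.le),
    div_eq_div_iff h3.ne' h4.ne'] at h
  linarith

lemma exists_neckLength_eq (T : ℝ≥0∞) : ∃ E ∈ Icc (0 : ℝ) 1, neckLength E = T := by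
  induction T with
  | top => exact ⟨1, by simp, by simp [neckLength]⟩
  | coe r =>
    have hr : (0 : ℝ) ≤ r := r.2
    refine ⟨r / (1 + r), ⟨by positivity, (div_le_one (by positivity)).2 (by linarith)⟩, ?_⟩
    have h1 : 1 - (r : ℝ) / (1 + r) = 1 / (1 + r) := by field_simp; ring
    rw [neckLength, h1, ← ENNReal.ofReal_div_of_pos (by positivity)]
    have : (r : ℝ) / (1 + r) / (1 / (1 + r)) = r := by field_simp
    rw [this, ENNReal.ofReal_coe_nnreal]

lemma neckLength_pos_iff {E : ℝ} : neckLength E ≠ 0 ↔ 0 < E := by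
  unfold neckLength
  rw [Ne, ENNReal.div_eq_zero_iff]
  simp

lemma toReal_neckLength {E : ℝ} (hE : 0 ≤ E) (hE1 : E ≤ 1) :
    (neckLength E).toReal = E / (1 - E) := by
  unfold neckLength
  rw [ENNReal.toReal_div, ENNReal.toReal_ofReal hE, ENNReal.toReal_ofReal (by linarith)]

/-- The neck lengths over a point of the permutohedron. -/
def neckLengths (p : Fin l → ℝ) (I : InternalVertex l) : ℝ≥0∞ := neckLength (neckCoord I.1 p)

lemma neckCoord_mem_Icc {p : Fin l → ℝ} (hp : p ∈ permPolytope l) (I : Finset (Fin l)) :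
    neckCoord I p ∈ Icc (0 : ℝ) 1 :=
  ⟨neckCoord_nonneg _ _, neckCoord_le_one (hp.1 I)⟩

lemma neckLengths_pos_iff {p : Fin l → ℝ} {I : InternalVertex l} :
    0 < neckLengths p I ↔ ∀ i ∈ I.1, ∀ j ∉ I.1, p i < p j := by
  rw [pos_iff_ne_zero, neckLengths, neckLength_pos_iff, neckCoord_pos_iff]

lemma neckLengths_eq_top_iff {p : Fin l → ℝ} (hp : p ∈ permPolytope l) {I : InternalVertex l} :
    neckLengths p I = ⊤ ↔ slack I.1 p = 0 := by
  rw [neckLengths, neckLength_eq_top_iff (neckCoord_nonneg _ _) (neckCoord_le_one (hp.1 _)),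
    neckCoord_eq_one_iff I.2.1 I.2.2 hp]

lemma isChain_neckLengths (p : Fin l → ℝ) : IsChain (· ≤ ·) {I | neckLengths p I ≠ 0} := by
  intro I hI J hJ _
  have hI' := neckLengths_pos_iff.1 (pos_iff_ne_zero.2 hI)
  have hJ' := neckLengths_pos_iff.1 (pos_iff_ne_zero.2 hJ)
  by_contra! hcon
  obtain ⟨i, hi, hi'⟩ := Finset.not_subset.1 (show ¬ I.1 ⊆ J.1 from hcon.1)
  obtain ⟨j, hj, hj'⟩ := Finset.not_subset.1 (show ¬ J.1 ⊆ I.1 from hcon.2)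
  exact absurd (hI' i hi j hj') (hJ' j hj i hi').asymm

/-- A continuous bijection from a compact space to a Hausdorff space; no inverse has to be written
down. -/
theorem exists_homeomorph_neckComplex :
    ∃ h : permutohedron l ≃ₜ NeckComplex l, ∀ p, (h p).1 = neckLengths p.1 := by
  have hP : ∀ p : permutohedron l, p.1 ∈ permPolytope l := fun p => by
    rw [← permutohedron_eq_permPolytope]; exact p.2
  set f : permutohedron l → NeckComplex l := fun p => ⟨neckLengths p.1, isChain_neckLengths p.1⟩
  have hf : Continuous f := by
    refine Continuous.subtype_mk (continuous_pi fun I => ?_) _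
    rw [continuous_iff_continuousAt]
    intro p
    have h1 := continuous_neckLength_aux _ (neckCoord_mem_Icc (hP p) I.1)
    have h2 : ContinuousAt (fun q : permutohedron l => neckCoord I.1 q.1) p :=
      (continuousAt_neckCoord (hP p)).comp continuousAt_subtype_val
    exact h1.tendsto.comp (tendsto_nhdsWithin_iff.2
      ⟨h2, Filter.Eventually.of_forall fun q => neckCoord_mem_Icc (hP q) I.1⟩)
  have hinj : Function.Injective f := by
    intro p q hpq
    apply Subtype.ext
    refine eq_of_neckCoord_eq (hP p) (hP q) fun I => ?_
    exact neckLength_injOn (neckCoord_mem_Icc (hP p) _) (neckCoord_mem_Icc (hP q) _)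
      (congrFun (congrArg Subtype.val hpq) I)
  have hsurj : Function.Surjective f := by
    rintro ⟨T, hT⟩
    choose c hc hcT using fun I => exists_neckLength_eq (T I)
    obtain ⟨x, hx, hxc⟩ := exists_neckCoord_eq c (fun I => (hc I).1) (fun I => (hc I).2) (by
      refine hT.mono fun I hI => ?_
      have h0 : 0 < c I := lt_of_le_of_ne (hc I).1 (Ne.symm hI)
      rw [mem_ofPred_eq, ← hcT I]
      exact neckLength_pos_iff.2 h0)
    refine ⟨⟨x, by rw [permutohedron_eq_permPolytope]; exact hx⟩, Subtype.ext (funext fun I => ?_)⟩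
    simp only [f, neckLengths, hxc, hcT]
  have : CompactSpace (permutohedron l) := isCompact_iff_compactSpace.1 (by
    rw [permutohedron_eq_permPolytope]; exact isCompact_permPolytope)
  exact ⟨Continuous.homeoOfEquivCompactToT2 (f := Equiv.ofBijective f ⟨hinj, hsurj⟩) hf,
    fun p => rfl⟩

end NeckLengths

/-! ### Faces, chains, dimensions and relative interiors -/

section Faces

variable {l : ℕ}

lemma slack_sub (I : Finset (Fin l)) (x y : Fin l → ℝ) :
    slack I y = slack I x + ∑ i ∈ I, (y - x) i := by
  simp [slack]

/-- The sets of vanishing slack at a point of the permutohedron are totally ordered. -/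
lemma subset_or_subset_of_slack {x : Fin l → ℝ} (hx : x ∈ permPolytope l) {I J : Finset (Fin l)}
    (hI : slack I x = 0) (hJ : slack J x = 0) : I ⊆ J ∨ J ⊆ I := by
  by_contra! hcon
  obtain ⟨i, hi, hi'⟩ := Finset.not_subset.1 hcon.1
  obtain ⟨j, hj, hj'⟩ := Finset.not_subset.1 hcon.2
  have h1 := gap_of_slack_eq_zero hx hI hi hj'
  have h2 := gap_of_slack_eq_zero hx hJ hj hi'
  linarith

/-- The face on which the slacks of all members of `c` vanish. -/
def chainFace (c : Set (InternalVertex l)) : Set (Fin l → ℝ) :=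
  {x ∈ permPolytope l | ∀ I ∈ c, slack I.1 x = 0}

/-- Surjectivity of the neck coordinates, applied to the indicator function of the chain, yields a
point that is tight exactly on it. It serves as a relative interior point of the face. -/
lemma exists_slack_eq_zero_iff (c : VertexChain l) :
    ∃ x ∈ permPolytope l, ∀ I : InternalVertex l, slack I.1 x = 0 ↔ I ∈ c.1 := by
  classical
  obtain ⟨x, hx, h⟩ := exists_neckCoord_eq (fun I => if I ∈ c.1 then 1 else 0)
    (fun I => by split_ifs <;> norm_num) (fun I => by split_ifs <;> norm_num)
    (c.2.mono fun I hI => by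
      by_contra h
      exact hI (if_neg h))
  refine ⟨x, hx, fun I => ?_⟩
  rw [← neckCoord_eq_one_iff I.2.1 I.2.2 hx, h]
  split_ifs with hI <;> simp [hI]

/-- The exposing functional is, up to a constant, minus the sum of the slacks in the chain. Its
maximum is attained at x₀, where all of them vanish. -/
lemma isExposed_chainFace (c : VertexChain l) :
    IsExposed ℝ (permutohedron l) (chainFace (c.1 : Set (InternalVertex l))) := by
  intro _
  obtain ⟨x₀, hx₀, h₀⟩ := exists_slack_eq_zero_iff c
  refine ⟨-∑ I ∈ c.1, ∑ i ∈ I.1, ContinuousLinearMap.proj (R := ℝ) (φ := fun _ : Fin l => ℝ) i, ?_⟩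
  have hval : ∀ x : Fin l → ℝ,
      (-∑ I ∈ c.1, ∑ i ∈ I.1, ContinuousLinearMap.proj (R := ℝ) (φ := fun _ : Fin l => ℝ) i) x =
      -∑ I ∈ c.1, slack I.1 x - ∑ I ∈ c.1, (I.1.card : ℝ) * (I.1.card + 1) / 2 := by
    intro x
    simp [slack]
  ext x
  simp only [hval, permutohedron_eq_permPolytope, mem_sep_iff, chainFace]
  refine and_congr_right fun hx => ?_
  constructor
  · intro h y hy
    have h1 : ∑ I ∈ c.1, slack I.1 x = 0 := Finset.sum_eq_zero fun I hI => h I hI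
    have h2 : 0 ≤ ∑ I ∈ c.1, slack I.1 y := Finset.sum_nonneg fun I _ => hy.1 _
    linarith
  · intro h I hI
    have h1 := h x₀ hx₀
    have h2 : ∑ I ∈ c.1, slack I.1 x₀ = 0 := Finset.sum_eq_zero fun I hI => (h₀ I).2 hI
    have h3 : ∑ I ∈ c.1, slack I.1 x = 0 :=
      le_antisymm (by linarith) (Finset.sum_nonneg fun I _ => hx.1 _)
    exact (Finset.sum_eq_zero_iff_of_nonneg fun I _ => hx.1 _).1 h3 I hI

/-- The chain of a face. -/
def faceChain (F : PermFace l) : VertexChain l := by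
  classical
  exact ⟨Finset.univ.filter fun I : InternalVertex l => ∀ x ∈ F.1, slack I.1 x = 0, by
    obtain ⟨x, hx⟩ := F.2.2
    have hxP : x ∈ permPolytope l := by
      rw [← permutohedron_eq_permPolytope]; exact F.2.1.subset hx
    intro I hI J hJ _
    simp only [Finset.coe_filter, Finset.mem_univ, true_and, mem_ofPred_eq] at hI hJ
    exact subset_or_subset_of_slack hxP (hI x hx) (hJ x hx)⟩

lemma mem_faceChain {F : PermFace l} {I : InternalVertex l} :
    I ∈ (faceChain F).1 ↔ ∀ x ∈ F.1, slack I.1 x = 0 := by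
  simp [faceChain]

/-- The face minimizes a functional with coefficients a. On it, the slacks of all strict superlevel
sets of a vanish. Conversely a point where these vanish is a minimizer, by
`sum_mul_eq_of_slack_eq_zero`. -/
lemma chainFace_faceChain (F : PermFace l) :
    chainFace ((faceChain F).1 : Set (InternalVertex l)) = F.1 := by
  apply Set.Subset.antisymm
  · obtain ⟨F, hF, hne⟩ := F
    obtain ⟨f, hf⟩ := hF hne
    intro x hx
    set a : Fin l → ℝ := fun i => -f (Pi.single i 1)
    have hfa : ∀ y, f y = -∑ i, a i * y i := by
      intro y
      have : y = ∑ i, y i • (Pi.single i (1 : ℝ) : Fin l → ℝ) := by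
        ext j; simp [Finset.sum_apply, Pi.single_apply]
      conv_lhs => rw [this]
      simp only [map_sum, map_smul, smul_eq_mul, a]
      rw [← Finset.sum_neg_distrib]
      exact Finset.sum_congr rfl fun i _ => by ring
    obtain ⟨σ, hσ⟩ := exists_antitone_comp a
    have hmin : ∀ y ∈ F, ∑ i, a i * y i = ∑ i, a i * permVertex σ i := by
      intro y hy
      rw [hf] at hy
      have h1 := hy.2 (permVertex σ) (by
        rw [permutohedron_eq_permPolytope]; exact permVertex_mem σ)
      rw [hfa, hfa] at h1
      refine le_antisymm (by linarith) (sum_mul_permVertex_le hσ ?_)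
      rw [← permutohedron_eq_permPolytope]; exact hy.1
    have hval : ∑ i, a i * x i = ∑ i, a i * permVertex σ i := by
      refine sum_mul_eq_of_slack_eq_zero hσ hx.1 fun I hI0 hIu hI => ?_
      refine hx.2 ⟨I, hI0, hIu⟩ (mem_faceChain.2 fun y hy => ?_)
      refine slack_eq_zero_of_sum_mul_eq hσ ?_ (hmin y hy) hI0 hIu hI
      rw [← permutohedron_eq_permPolytope]; exact hF.subset hy
    change x ∈ F
    rw [hf]
    refine ⟨by rw [permutohedron_eq_permPolytope]; exact hx.1, fun y hy => ?_⟩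
    rw [permutohedron_eq_permPolytope] at hy
    rw [hfa, hfa, hval]
    exact neg_le_neg (sum_mul_permVertex_le hσ hy)
  · intro x hx
    refine ⟨by rw [← permutohedron_eq_permPolytope]; exact F.2.1.subset hx, fun I hI => ?_⟩
    exact mem_faceChain.1 hI x hx

/-- The face of a chain. -/
def chainToFace (c : VertexChain l) : PermFace l :=
  ⟨chainFace (c.1 : Set (InternalVertex l)), isExposed_chainFace c, by
    obtain ⟨x, hx, h⟩ := exists_slack_eq_zero_iff c
    exact ⟨x, hx, fun I hI => (h I).2 hI⟩⟩

lemma faceChain_chainToFace (c : VertexChain l) : faceChain (chainToFace c) = c := by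
  apply Subtype.ext
  ext I
  rw [mem_faceChain]
  constructor
  · intro h
    obtain ⟨x, hx, h'⟩ := exists_slack_eq_zero_iff c
    exact (h' I).1 (h x ⟨hx, fun J hJ => (h' J).2 hJ⟩)
  · intro hI x hx
    exact hx.2 I hI

/-- The face poset of the permutohedron is anti-isomorphic to the poset of chains. -/
def faceOrderIso (l : ℕ) : PermFace l ≃o (VertexChain l)ᵒᵈ where
  toFun F := OrderDual.toDual (faceChain F)
  invFun c := chainToFace (OrderDual.ofDual c)
  left_inv F := Subtype.ext (chainFace_faceChain F)
  right_inv c := congrArg OrderDual.toDual (faceChain_chainToFace _)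
  map_rel_iff' := by
    intro F F'
    constructor
    · intro h x hx
      rw [← chainFace_faceChain F] at hx
      rw [← chainFace_faceChain F']
      have h' : (faceChain F').1 ⊆ (faceChain F).1 := h
      exact ⟨hx.1, fun I hI => hx.2 I (h' hI)⟩
    · intro h I hI
      exact mem_faceChain.2 fun x hx => mem_faceChain.1 hI x (h hx)

/-- The directions along which all slacks in `c` and the total are constant. -/
def chainDirection (C : Finset (Finset (Fin l))) : Submodule ℝ (Fin l → ℝ) where
  carrier := {v | ∀ I ∈ C, ∑ i ∈ I, v i = 0}
  add_mem' := by
    intro v w hv hw I hI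
    simp [Finset.sum_add_distrib, hv I hI, hw I hI]
  zero_mem' := by simp
  smul_mem' := by
    intro a v hv I hI
    simp [← Finset.mul_sum, hv I hI]

/-- Rank-nullity for the map of partial sums. It is onto because the indicator functions of distinct
nonempty sets in a chain are linearly independent. -/
lemma finrank_chainDirection (C : Finset (Finset (Fin l))) (hne : ∅ ∉ C)
    (hC : ∀ I ∈ C, ∀ J ∈ C, I ⊆ J ∨ J ⊆ I) :
    Module.finrank ℝ (chainDirection C) + C.card = l := by
  classical
  set M : (Fin l → ℝ) →ₗ[ℝ] (C → ℝ) :=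
    LinearMap.pi fun I => ∑ i ∈ I.1, LinearMap.proj (R := ℝ) (φ := fun _ : Fin l => ℝ) i with hM
  have hMv : ∀ v I, M v I = ∑ i ∈ I.1, v i := by
    intro v I
    simp [hM]
  have hker : LinearMap.ker M = chainDirection C := by
    ext v
    rw [LinearMap.mem_ker]
    constructor
    · intro h I hI
      rw [← hMv v ⟨I, hI⟩, h]
      rfl
    · intro h
      ext I
      rw [hMv, h I.1 I.2]
      rfl
  have hrange : LinearMap.range M = ⊤ := by
    by_contra hlt
    obtain ⟨f, hf0, hf⟩ := Submodule.exists_le_ker_of_lt_top _ (lt_top_iff_ne_top.2 hlt)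
    set μ : C → ℝ := fun I => f (Pi.single I 1)
    have hfμ : ∀ g, f g = ∑ I, μ I * g I := by
      intro g
      have : g = ∑ I, g I • (Pi.single I (1 : ℝ) : C → ℝ) := by
        ext j; simp [Finset.sum_apply, Pi.single_apply]
      conv_lhs => rw [this]
      simp only [map_sum, map_smul, smul_eq_mul, μ]
      exact Finset.sum_congr rfl fun i _ => by ring
    have hsum : ∀ i : Fin l, ∑ I : C, (if i ∈ I.1 then μ I else 0) = 0 := by
      intro i
      have h1 : f (M (Pi.single i 1)) = 0 := hf (LinearMap.mem_range_self M _)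
      rw [hfμ] at h1
      refine Eq.trans (Finset.sum_congr rfl fun I _ => ?_) h1
      have h2 : M (Pi.single i 1) I = if i ∈ I.1 then 1 else 0 := by
        rw [hMv]
        simp [Pi.single_apply]
      rw [h2]
      simp
    have hne0 : ((Finset.univ : Finset C).filter fun I => μ I ≠ 0).Nonempty := by
      by_contra hemp
      rw [Finset.not_nonempty_iff_eq_empty, Finset.filter_eq_empty_iff] at hemp
      apply hf0
      ext g
      simp only [LinearMap.coe_comp, LinearMap.coe_single, Function.comp,
        LinearMap.zero_apply]
      exact not_not.1 (hemp (Finset.mem_univ g))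
    obtain ⟨I, hI, hmax⟩ := Finset.exists_max_image _ (fun I : C => I.1.card) hne0
    simp only [Finset.mem_filter, Finset.mem_univ, true_and] at hI hmax
    -- The members not containing I are proper subsets of I and nested, so a point of I outside the
    -- largest one lies only in members that contain I. As I is the largest set with nonzero
    -- coefficient, the relation at i reduces to μ I = 0.
    obtain ⟨i, hiI, hi⟩ : ∃ i ∈ I.1, ∀ J : C, i ∈ J.1 → I.1 ⊆ J.1 := by
      by_cases hS : ((Finset.univ : Finset C).filter fun J => ¬ I.1 ⊆ J.1).Nonempty
      · obtain ⟨J, hJ, hJmax⟩ := Finset.exists_max_image _ (fun J : C => J.1.card) hS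
        simp only [Finset.mem_filter, Finset.mem_univ, true_and] at hJ hJmax
        obtain ⟨i, hiI, hiJ⟩ := Finset.not_subset.1 hJ
        refine ⟨i, hiI, fun J' hiJ' => ?_⟩
        by_contra hJ'
        have hle := hJmax J' hJ'
        rcases hC J'.1 J'.2 J.1 J.2 with h | h
        · exact hiJ (h hiJ')
        · have := Finset.eq_of_subset_of_card_le h hle
          exact hiJ (this ▸ hiJ')
      · rw [Finset.not_nonempty_iff_eq_empty, Finset.filter_eq_empty_iff] at hS
        obtain ⟨i, hi⟩ := Finset.nonempty_iff_ne_empty.2 fun h => hne (h ▸ I.2)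
        exact ⟨i, hi, fun J _ => not_not.1 (hS (Finset.mem_univ J))⟩
    have h1 := hsum i
    rw [Finset.sum_eq_single I, if_pos hiI] at h1
    · exact hI h1
    · intro J _ hJI
      split_ifs with hiJ
      · by_contra hμ
        have h2 := hi J hiJ
        exact hJI (Subtype.ext (Finset.eq_of_subset_of_card_le h2 (hmax J hμ)).symm)
      · rfl
    · intro h; exact absurd (Finset.mem_univ I) h
  have := LinearMap.finrank_range_add_finrank_ker M
  rw [hker, hrange, finrank_top, Module.finrank_fintype_fun_eq_card, Fintype.card_coe,
    Module.finrank_fintype_fun_eq_card, Fintype.card_fin] at this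
  omega

/-- The members of a chain, and the full set. -/
def chainSets (c : VertexChain l) : Finset (Finset (Fin l)) :=
  insert Finset.univ (c.1.map (Function.Embedding.subtype _))

lemma mem_chainSets {c : VertexChain l} {I : Finset (Fin l)} :
    I ∈ chainSets c ↔ I = Finset.univ ∨ ∃ J ∈ c.1, J.1 = I := by
  rw [chainSets, Finset.mem_insert, Finset.mem_map]
  rfl

lemma card_chainSets (c : VertexChain l) : (chainSets c).card = c.1.card + 1 := by
  rw [chainSets, Finset.card_insert_of_notMem, Finset.card_map]
  simp only [Finset.mem_map, not_exists, not_and]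
  intro J _ h
  exact J.2.2 h

/-- From a point tight exactly on the chain one can move a short way in any direction that keeps the
tight slacks, since the finitely many others stay positive. -/
lemma vectorSpan_chainFace (c : VertexChain l) :
    vectorSpan ℝ (chainFace (c.1 : Set (InternalVertex l))) = chainDirection (chainSets c) := by
  obtain ⟨x, hx, hxc⟩ := exists_slack_eq_zero_iff c
  apply le_antisymm
  · rw [vectorSpan_def, Submodule.span_le]
    rintro _ ⟨y, hy, z, hz, rfl⟩ I hI
    rw [mem_chainSets] at hI
    have key := slack_sub I z y
    rcases hI with rfl | ⟨J, hJ, rfl⟩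
    · rw [hy.1.2, hz.1.2, zero_add] at key
      exact key.symm
    · rw [hy.2 J hJ, hz.2 J hJ, zero_add] at key
      exact key.symm
  · intro v hv
    have hF : x ∈ chainFace (c.1 : Set (InternalVertex l)) := ⟨hx, fun I hI => (hxc I).2 hI⟩
    have hev : ∀ᶠ t in 𝓝[>] (0 : ℝ), x + t • v ∈ chainFace (c.1 : Set (InternalVertex l)) := by
      have hI : ∀ I : Finset (Fin l), ∀ᶠ t in 𝓝[>] (0 : ℝ), 0 ≤ slack I (x + t • v) := by
        intro I
        have hval : ∀ t : ℝ, slack I (x + t • v) = slack I x + t * ∑ i ∈ I, v i := by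
          intro t
          rw [slack_sub I x (x + t • v)]
          simp [Finset.mul_sum]
        by_cases h0 : 0 < slack I x
        · have hc : Filter.Tendsto (fun t : ℝ => slack I (x + t • v)) (𝓝[>] 0)
              (𝓝 (slack I x)) := by
            have : ContinuousAt (fun t : ℝ => slack I (x + t • v)) 0 := by
              simp only [hval]; fun_prop
            have h2 := this.tendsto
            simp only [zero_smul, add_zero] at h2
            exact h2.mono_left nhdsWithin_le_nhds
          filter_upwards [hc.eventually_const_lt h0] with t ht using ht.le
        · have h1 : slack I x = 0 := le_antisymm (not_lt.1 h0) (hx.1 I)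
          refine Filter.Eventually.of_forall fun t => ?_
          rw [hval, h1, zero_add]
          by_cases hIe : I = ∅
          · subst hIe; simp
          rw [hv I ?_, mul_zero]
          rw [mem_chainSets]
          by_cases hIu : I = Finset.univ
          · exact Or.inl hIu
          · exact Or.inr ⟨⟨I, hIe, hIu⟩, (hxc ⟨I, hIe, hIu⟩).1 h1, rfl⟩
      filter_upwards [(Filter.eventually_all (ι := Finset (Fin l))).2 hI] with t ht
      refine ⟨⟨ht, ?_⟩, fun I hI => ?_⟩
      · rw [slack_sub _ x, hx.2]
        have := hv Finset.univ (mem_chainSets.2 (Or.inl rfl))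
        simp [← Finset.mul_sum, this]
      · rw [slack_sub _ x, (hxc I).2 hI]
        have := hv I.1 (mem_chainSets.2 (Or.inr ⟨I, hI, rfl⟩))
        simp [← Finset.mul_sum, this]
    obtain ⟨t, ht, ht0⟩ := (hev.and self_mem_nhdsWithin).exists
    have h1 := vsub_mem_vectorSpan ℝ ht hF
    simp only [vsub_eq_sub, add_sub_cancel_left] at h1
    have := Submodule.smul_mem _ t⁻¹ h1
    rwa [smul_smul, inv_mul_cancel₀ (ne_of_gt ht0), one_smul] at this

lemma finrank_vectorSpan_face (F : PermFace l) :
    Module.finrank ℝ (vectorSpan ℝ F.1) + (faceChain F).1.card = l - 1 := by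
  rw [← chainFace_faceChain F, vectorSpan_chainFace]
  -- For l = 0 the full set is empty and imposes no condition, so the count below does not apply.
  -- The truncated l − 1 is 0 there.
  rcases Nat.eq_zero_or_pos l with rfl | hl
  · have h1 : (faceChain F).1.card = 0 := by
      rw [Finset.card_eq_zero, Finset.eq_empty_iff_forall_notMem]
      intro I _
      exact I.2.1 (Finset.eq_empty_of_isEmpty _)
    rw [h1]
    have : Module.finrank ℝ (chainDirection (chainSets (faceChain F))) = 0 :=
      Module.finrank_zero_of_subsingleton
    omega
  · have h1 := finrank_chainDirection (chainSets (faceChain F)) (by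
        intro h
        rcases mem_chainSets.1 h with h | ⟨J, _, h⟩
        · have : (⟨0, hl⟩ : Fin l) ∈ (∅ : Finset (Fin l)) := h ▸ Finset.mem_univ _
          simp at this
        · exact J.2.1 h) (by
        intro I hI J hJ
        rcases mem_chainSets.1 hI with rfl | ⟨I', hI', rfl⟩
        · exact Or.inr (Finset.subset_univ _)
        rcases mem_chainSets.1 hJ with rfl | ⟨J', hJ', rfl⟩
        · exact Or.inl (Finset.subset_univ _)
        exact (faceChain F).2.total hI' hJ')
    rw [card_chainSets] at h1
    omega

/-- At a relative interior point no further slack can vanish, since one could step beyond it.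
Conversely, positivity of the other slacks is an open condition and the tight ones are constant on
the affine span. -/
lemma mem_intrinsicInterior_face {F : PermFace l} {x : Fin l → ℝ} :
    x ∈ intrinsicInterior ℝ F.1 ↔
      x ∈ permPolytope l ∧ ∀ I : InternalVertex l, slack I.1 x = 0 ↔ I ∈ (faceChain F).1 := by
  set c := faceChain F with hc
  have hF := chainFace_faceChain F
  rw [← hc] at hF
  obtain ⟨x₀, hx₀, hxc⟩ := exists_slack_eq_zero_iff c
  have hx₀F : x₀ ∈ F.1 := by
    rw [← hF]; exact ⟨hx₀, fun I hI => (hxc I).2 hI⟩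
  rw [mem_intrinsicInterior]
  constructor
  · rintro ⟨y, hy, rfl⟩
    have hyF : y ∈ ((↑) ⁻¹' F.1 : Set (affineSpan ℝ F.1)) := interior_subset hy
    have hyc : y.1 ∈ chainFace (c.1 : Set (InternalVertex l)) := by rw [hF]; exact hyF
    refine ⟨hyc.1, fun I => ⟨fun h0 => ?_, fun hI => hyc.2 I hI⟩⟩
    by_contra hI
    have hpos : 0 < slack I.1 x₀ :=
      lt_of_le_of_ne (hx₀.1 _) fun h => hI ((hxc I).1 h.symm)
    -- Prolongs the segment from x₀ beyond y. A slack that is positive at x₀ and zero at y becomes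
    -- negative there.
    set g : ℝ → affineSpan ℝ F.1 := fun t => ⟨AffineMap.lineMap x₀ y.1 (1 + t),
      AffineMap.lineMap_mem _ (mem_affineSpan ℝ hx₀F) y.2⟩ with hg
    have hgc : Continuous g := by
      refine Continuous.subtype_mk ?_ _
      have : (fun t : ℝ => (AffineMap.lineMap x₀ y.1 (1 + t) : Fin l → ℝ)) =
          fun t => x₀ + (1 + t) • (y.1 - x₀) := by
        ext t
        simp [AffineMap.lineMap_apply]
        ring
      rw [this]
      fun_prop
    have hg0 : g 0 = y := by
      apply Subtype.ext
      simp [hg]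
    have hnhds : g ⁻¹' (interior ((↑) ⁻¹' F.1)) ∈ 𝓝 (0 : ℝ) :=
      hgc.continuousAt.preimage_mem_nhds (by rw [hg0]; exact isOpen_interior.mem_nhds hy)
    obtain ⟨t, ht, ht0⟩ := ((Filter.eventually_of_mem (nhdsWithin_le_nhds hnhds)
      (fun t ht => ht)).and (self_mem_nhdsWithin (a := (0 : ℝ)) (s := Ioi 0))).exists
    have htF : g t ∈ ((↑) ⁻¹' F.1 : Set (affineSpan ℝ F.1)) := interior_subset ht
    have h1 : 0 ≤ slack I.1 (g t).1 := by
      exact (hF.ge htF).1.1 _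
    have h2 : slack I.1 (g t).1 = -t * slack I.1 x₀ := by
      have e1 : (g t).1 = y.1 + t • (y.1 - x₀) := by
        ext i
        simp [hg, AffineMap.lineMap_apply]
        ring
      have e2 := slack_sub I.1 x₀ y.1
      rw [e1, slack_sub I.1 y.1, h0]
      rw [h0] at e2
      have e3 : ∑ i ∈ I.1, (y.1 + t • (y.1 - x₀) - y.1) i = t * ∑ i ∈ I.1, (y.1 - x₀) i := by
        rw [Finset.mul_sum]
        simp
      rw [e3]
      have : ∑ i ∈ I.1, (y.1 - x₀) i = -slack I.1 x₀ := by linarith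
      rw [this]
      ring
    have : 0 < t * slack I.1 x₀ := mul_pos ht0 hpos
    linarith
  · rintro ⟨hx, hxc'⟩
    have hxF : x ∈ F.1 := by rw [← hF]; exact ⟨hx, fun I hI => (hxc' I).2 hI⟩
    refine ⟨⟨x, mem_affineSpan ℝ hxF⟩, ?_, rfl⟩
    rw [mem_interior_iff_mem_nhds]
    have hU : ∀ I : InternalVertex l, ∀ᶠ y in 𝓝 x, I ∉ c.1 → 0 < slack I.1 y := by
      intro I
      by_cases hI : I ∈ c.1
      · exact Filter.Eventually.of_forall fun y h => absurd hI h
      · have hpos : 0 < slack I.1 x :=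
          lt_of_le_of_ne (hx.1 _) fun h => hI ((hxc' I).1 h.symm)
        filter_upwards [(continuous_slack I.1).continuousAt.eventually_const_lt hpos] with y hy _
        exact hy
    have hU' := (Filter.eventually_all (ι := InternalVertex l)).2 hU
    have hV : ∀ᶠ y in 𝓝 (⟨x, mem_affineSpan ℝ hxF⟩ : affineSpan ℝ F.1),
        ∀ I : InternalVertex l, I ∉ c.1 → 0 < slack I.1 y.1 :=
      (continuous_subtype_val.continuousAt (x := ⟨x, mem_affineSpan ℝ hxF⟩)).eventually hU'
    filter_upwards [hV] with y hy
    change y.1 ∈ F.1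
    have hdir : y.1 - x ∈ chainDirection (chainSets c) := by
      rw [← vectorSpan_chainFace, hF, ← direction_affineSpan]
      exact AffineSubspace.vsub_mem_direction y.2 (mem_affineSpan ℝ hxF)
    refine hF.le (?_ : y.1 ∈ chainFace (c.1 : Set (InternalVertex l)))
    have hz : ∀ I ∈ c.1, slack I.1 y.1 = 0 := by
      intro I hI
      rw [slack_sub I.1 x, (hxc' I).2 hI, hdir I.1 (mem_chainSets.2 (Or.inr ⟨I, hI, rfl⟩)),
        zero_add]
    have hu : slack Finset.univ y.1 = 0 := by
      rw [slack_sub _ x, hx.2, hdir _ (mem_chainSets.2 (Or.inl rfl)), zero_add]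
    refine ⟨⟨fun I => ?_, hu⟩, hz⟩
    by_cases hIe : I = ∅
    · subst hIe; simp [slack]
    by_cases hIu : I = Finset.univ
    · rw [hIu, hu]
    by_cases hI : (⟨I, hIe, hIu⟩ : InternalVertex l) ∈ c.1
    · exact (hz _ hI).ge
    · exact (hy ⟨I, hIe, hIu⟩ hI).le

/-- The permutohedron as a face of itself. -/
lemma mem_intrinsicInterior_permutohedron {x : Fin l → ℝ} :
    x ∈ intrinsicInterior ℝ (permutohedron l) ↔
      x ∈ permPolytope l ∧ ∀ I : InternalVertex l, 0 < slack I.1 x := by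
  have hbot : permutohedron l = (chainToFace (⟨∅, by simp⟩ : VertexChain l)).1 := by
    refine permutohedron_eq_permPolytope.trans ?_
    ext x
    simp [chainToFace, chainFace]
  rw [hbot, mem_intrinsicInterior_face, faceChain_chainToFace]
  refine and_congr_right fun hx => forall_congr' fun I => ?_
  simp only [Finset.notMem_empty, iff_false]
  exact ⟨fun h => lt_of_le_of_ne (hx.1 _) (Ne.symm h), fun h => h.ne'⟩

end Faces

/-! ### Background levels of the hypersurfaces -/

section VertexRank

variable {l : ℕ}

lemma sum_two_pow_lt (I : Finset (Fin l)) : ∑ i ∈ I, 2 ^ (i : ℕ) < 2 ^ l := by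
  have h1 : ∑ i ∈ I, 2 ^ (i : ℕ) ≤ ∑ i : Fin l, 2 ^ (i : ℕ) :=
    Finset.sum_le_sum_of_subset (Finset.subset_univ _)
  have h2 : ∑ i : Fin l, 2 ^ (i : ℕ) = ∑ i ∈ Finset.range l, 2 ^ i :=
    Fin.sum_univ_eq_sum_range (fun i => 2 ^ i) l
  have h3 := Nat.geomSum_eq (le_refl 2) l
  have h4 : 0 < 2 ^ l := by positivity
  omega

/-- The number by which vertices are listed. -/
def vertexKey (I : Finset (Fin l)) : ℕ := I.card * 2 ^ l + ∑ i ∈ I, 2 ^ (i : ℕ)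

/-- The binary code of I is less than 2^l, so it is the residue of the key modulo 2^l. -/
lemma vertexKey_injective : Function.Injective (vertexKey (l := l)) := by
  intro I J h
  have h1 := congrArg (· % 2 ^ l) h
  simp only [vertexKey, Nat.mul_add_mod_self_right, Nat.mod_eq_of_lt (sum_two_pow_lt _)] at h1
  have h2 := Finset.geomSum_injective (le_refl 2)
    (a₁ := I.map Fin.valEmbedding) (a₂ := J.map Fin.valEmbedding) (by simpa using h1)
  exact Finset.map_injective _ h2

lemma vertexKey_lt_of_ssubset {I J : Finset (Fin l)} (h : I ⊂ J) : vertexKey I < vertexKey J := by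
  have h1 := Finset.card_lt_card h
  have h2 : (I.card + 1) * 2 ^ l ≤ J.card * 2 ^ l := Nat.mul_le_mul_right _ h1
  have h3 := sum_two_pow_lt I
  rw [add_mul] at h2
  unfold vertexKey
  omega

lemma vertexRank_lt {I J : Finset (Fin l)} (h : vertexKey I < vertexKey J) :
    vertexRank I < vertexRank J := by
  refine Finset.card_lt_card ⟨fun K hK => ?_, fun hsub => ?_⟩
  · simp only [Finset.mem_filter, Finset.mem_univ, true_and] at hK ⊢
    exact hK.trans h
  · have : I ∈ Finset.univ.filter fun K : Finset (Fin l) =>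
        K.card * 2 ^ l + ∑ i ∈ K, 2 ^ (i : ℕ) < J.card * 2 ^ l + ∑ i ∈ J, 2 ^ (i : ℕ) := by
      simpa [vertexKey] using h
    have := hsub this
    simp at this

lemma vertexRank_pos {I : Finset (Fin l)} (h : I ≠ ∅) : 0 < vertexRank I := by
  have h1 := vertexRank_lt (vertexKey_lt_of_ssubset
    (Finset.empty_ssubset.2 (Finset.nonempty_iff_ne_empty.2 h)))
  omega

lemma vertexRank_lt_two_pow (I : Finset (Fin l)) : vertexRank I < 2 ^ l := by
  have h : vertexRank I < (Finset.univ : Finset (Finset (Fin l))).card := by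
    refine Finset.card_lt_card (Finset.filter_ssubset.2 ⟨I, Finset.mem_univ _, ?_⟩)
    simp
  simpa using h

lemma vertexLevel_lt_of_ssubset {I J : Finset (Fin l)} (h : I ⊂ J) :
    vertexLevel I < vertexLevel J := by
  have h1 := vertexRank_lt (vertexKey_lt_of_ssubset h)
  unfold vertexLevel
  have : (vertexRank I : ℝ) < vertexRank J := by exact_mod_cast h1
  gcongr

lemma le_vertexLevel {I : Finset (Fin l)} (h : I ≠ ∅) : -1 + 1 / 2 ^ l ≤ vertexLevel I := by
  have h1 : (1 : ℝ) ≤ vertexRank I := by exact_mod_cast vertexRank_pos h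
  unfold vertexLevel
  gcongr

lemma vertexLevel_le (I : Finset (Fin l)) : vertexLevel I ≤ -(1 / 2 ^ l) := by
  have h1 : (vertexRank I : ℝ) + 1 ≤ 2 ^ l := by exact_mod_cast vertexRank_lt_two_pow I
  unfold vertexLevel
  have : (0 : ℝ) < 2 ^ l := by positivity
  rw [← sub_nonneg]
  have : -(1 / 2 ^ l) - (-1 + (vertexRank I : ℝ) / 2 ^ l) =
    (2 ^ l - ((vertexRank I : ℝ) + 1)) / 2 ^ l := by field_simp; ring
  rw [this]
  apply div_nonneg <;> linarith

/-- Distinct vertices occupy distinct positions. The resulting distance κ = 2^{-l} is the scale for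
all the collars constructed below. -/
lemma vertexLevel_separated {I J : Finset (Fin l)} (h : I ≠ J) :
    1 / 2 ^ l ≤ |vertexLevel I - vertexLevel J| := by
  have h0 : (1 : ℝ) ≤ |(vertexRank I : ℝ) - vertexRank J| := by
    rcases lt_or_gt_of_ne (vertexKey_injective.ne h) with h1 | h1
    · have h2 : (vertexRank I : ℝ) + 1 ≤ vertexRank J := by exact_mod_cast vertexRank_lt h1
      rw [abs_sub_comm]
      exact le_trans (by linarith) (le_abs_self _)
    · have h2 : (vertexRank J : ℝ) + 1 ≤ vertexRank I := by exact_mod_cast vertexRank_lt h1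
      exact le_trans (by linarith) (le_abs_self _)
  have : vertexLevel I - vertexLevel J = ((vertexRank I : ℝ) - vertexRank J) / 2 ^ l := by
    unfold vertexLevel; ring
  rw [this, abs_div, abs_of_pos (by positivity : (0 : ℝ) < 2 ^ l)]
  gcongr

end VertexRank

/-! ### The radial cut-off function -/

section RadialCutoff

lemma radialCutoff_nonneg (r : ℝ) : 0 ≤ radialCutoff r := Real.smoothTransition.nonneg _

lemma radialCutoff_le_one (r : ℝ) : radialCutoff r ≤ 1 := Real.smoothTransition.le_one _

lemma radialCutoff_of_le {r : ℝ} (h : r ≤ 1 / 3) : radialCutoff r = 1 :=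
  Real.smoothTransition.one_of_one_le (by linarith)

lemma radialCutoff_of_ge {r : ℝ} (h : 2 / 3 ≤ r) : radialCutoff r = 0 :=
  Real.smoothTransition.zero_of_nonpos (by linarith)

lemma radialCutoff_lt_one {r : ℝ} : radialCutoff r < 1 ↔ 1 / 3 < r := by
  rw [(radialCutoff_le_one r).lt_iff_ne, radialCutoff, ne_eq,
    Real.smoothTransition.eq_one_iff_one_le, not_le]
  constructor <;> intro h <;> linarith

lemma radialCutoff_pos {r : ℝ} : 0 < radialCutoff r ↔ r < 2 / 3 := by
  rw [(radialCutoff_nonneg r).lt_iff_ne', radialCutoff, ne_eq,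
    Real.smoothTransition.zero_iff_nonpos, not_le]
  constructor <;> intro h <;> linarith

lemma contDiff_radialCutoff : ContDiff ℝ ∞ radialCutoff :=
  (Real.smoothTransition.contDiff (n := ⊤)).comp (by fun_prop : ContDiff ℝ ∞ fun r : ℝ => 2 - 3 * r)

lemma contDiff_radialCutoff_norm : ContDiff ℝ ∞ fun ζ : ℂ => radialCutoff ‖ζ‖ := by
  rw [contDiff_iff_contDiffAt]
  intro ζ
  by_cases h : ζ = 0
  · subst h
    refine (contDiffAt_const (c := (1 : ℝ))).congr_of_eventuallyEq ?_
    filter_upwards [Metric.ball_mem_nhds (0 : ℂ) (by norm_num : (0 : ℝ) < 1 / 3)] with ζ hζ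
    exact radialCutoff_of_le (mem_ball_zero_iff.1 hζ).le
  · exact contDiff_radialCutoff.contDiffAt.comp ζ (contDiffAt_norm ℝ h)

end RadialCutoff

/-! ### Cut-off functions of a framed link -/

namespace FramedLink

variable {l : ℕ} {Y : Type*} [TopologicalSpace Y] [ChartedSpace (EuclideanSpace ℝ (Fin 3)) Y]
  (L : FramedLink l Y)

lemma mem_tube_source {i : Fin l} {u : Circle} {ζ : ℂ} :
    (u, ζ) ∈ (L.tube i).source ↔ ‖ζ‖ < 1 := by
  simp [L.tube_source]

lemma tube_mem {i : Fin l} {u : Circle} {ζ : ℂ} (h : ‖ζ‖ < 1) :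
    L.tube i (u, ζ) ∈ (L.tube i).target :=
  (L.tube i).map_source (L.mem_tube_source.2 h)

lemma exists_of_mem_tube {i : Fin l} {z : Y} (h : z ∈ (L.tube i).target) :
    ∃ u ζ, ‖ζ‖ < 1 ∧ z = L.tube i (u, ζ) :=
  ⟨((L.tube i).symm z).1, ((L.tube i).symm z).2,
    L.mem_tube_source.1 ((L.tube i).map_target h), ((L.tube i).right_inv h).symm⟩

lemma eq_of_mem_tube {i j : Fin l} {z : Y} (hi : z ∈ (L.tube i).target)
    (hj : z ∈ (L.tube j).target) : i = j := by
  by_contra h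
  exact Set.disjoint_left.1 (L.disjoint_tube i j h) hi hj

lemma bump_tube {i : Fin l} {u : Circle} {ζ : ℂ} (h : ‖ζ‖ < 1) :
    L.bump i (L.tube i (u, ζ)) = radialCutoff ‖ζ‖ := by
  rw [bump, if_pos (L.tube_mem h), (L.tube i).left_inv (L.mem_tube_source.2 h)]

lemma bump_of_notMem {i : Fin l} {z : Y} (h : z ∉ (L.tube i).target) : L.bump i z = 0 :=
  if_neg h

lemma bump_nonneg (i : Fin l) (z : Y) : 0 ≤ L.bump i z := by
  unfold bump
  split_ifs
  exacts [radialCutoff_nonneg _, le_rfl]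

lemma bump_le_one (i : Fin l) (z : Y) : L.bump i z ≤ 1 := by
  unfold bump
  split_ifs
  exacts [radialCutoff_le_one _, zero_le_one]

/-- The total cut-off function of a sublink. -/
def bumpSum (I : Finset (Fin l)) (z : Y) : ℝ := ∑ i ∈ I, L.bump i z

lemma bumpSum_of_mem {I : Finset (Fin l)} {i : Fin l} {z : Y} (h : z ∈ (L.tube i).target) :
    L.bumpSum I z = if i ∈ I then L.bump i z else 0 := by
  have h0 : ∀ j ∈ I, j ≠ i → L.bump j z = 0 := fun j _ hj =>
    L.bump_of_notMem fun hz => hj (L.eq_of_mem_tube hz h)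
  split_ifs with hi
  · exact Finset.sum_eq_single i h0 fun hn => absurd hi hn
  · exact Finset.sum_eq_zero fun j hj => h0 j hj fun hji => hi (hji ▸ hj)

lemma bumpSum_of_forall_notMem {I : Finset (Fin l)} {z : Y} (h : ∀ i, z ∉ (L.tube i).target) :
    L.bumpSum I z = 0 :=
  Finset.sum_eq_zero fun i _ => L.bump_of_notMem (h i)

lemma bumpSum_tube {I : Finset (Fin l)} {i : Fin l} {u : Circle} {ζ : ℂ} (h : ‖ζ‖ < 1) :
    L.bumpSum I (L.tube i (u, ζ)) = if i ∈ I then radialCutoff ‖ζ‖ else 0 := by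
  rw [L.bumpSum_of_mem (L.tube_mem h), L.bump_tube h]

lemma bumpSum_nonneg (I : Finset (Fin l)) (z : Y) : 0 ≤ L.bumpSum I z :=
  Finset.sum_nonneg fun i _ => L.bump_nonneg i z

lemma bumpSum_le_one (I : Finset (Fin l)) (z : Y) : L.bumpSum I z ≤ 1 := by
  by_cases h : ∃ i, z ∈ (L.tube i).target
  · obtain ⟨i, hi⟩ := h
    rw [L.bumpSum_of_mem hi]
    split_ifs
    exacts [L.bump_le_one _ _, zero_le_one]
  · push Not at h
    rw [L.bumpSum_of_forall_notMem h]
    exact zero_le_one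

lemma bumpSum_mono {I J : Finset (Fin l)} (h : I ⊆ J) (z : Y) : L.bumpSum I z ≤ L.bumpSum J z :=
  Finset.sum_le_sum_of_subset_of_nonneg h fun i _ _ => L.bump_nonneg i z

lemma mem_carrier_tube {i : Fin l} {u : Circle} {ζ : ℂ} (h : ‖ζ‖ < 1) :
    L.tube i (u, ζ) ∈ L.carrier ↔ ζ = 0 := by
  constructor
  · rintro ⟨j, u', h'⟩
    have h0 : ‖(0 : ℂ)‖ < 1 := by simp
    have hij : i = j := L.eq_of_mem_tube (L.tube_mem h) (h' ▸ L.tube_mem h0)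
    subst hij
    have := (L.tube i).injOn (L.mem_tube_source.2 h) (L.mem_tube_source.2 h0) h'
    exact congrArg Prod.snd this
  · rintro rfl
    exact ⟨i, u, rfl⟩

/-- A closed solid torus in a tube is compact. -/
lemma isCompact_image_tube (i : Fin l) {s : Set ℂ} (hs : IsCompact s) (hs1 : ∀ ζ ∈ s, ‖ζ‖ < 1) :
    IsCompact (L.tube i '' (univ ×ˢ s)) := by
  refine (isCompact_univ.prod hs).image_of_continuousOn ((L.tube i).continuousOn.mono ?_)
  rintro ⟨u, ζ⟩ h
  exact L.mem_tube_source.2 (hs1 ζ h.2)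

/-- The closed solid torus of radius 2/3 is compact, hence closed since Y is Hausdorff. So the
extension by 0 is locally constant at points outside the open tube. -/
lemma contMDiff_bump [T2Space Y] (i : Fin l) : ContMDiff (𝓡 3) 𝓘(ℝ, ℝ) ∞ (L.bump i) := by
  intro z
  by_cases hz : z ∈ (L.tube i).target
  · have h1 := (L.smooth_tube_symm i z hz).contMDiffAt ((L.tube i).open_target.mem_nhds hz)
    have h2 : ContMDiffAt (𝓡 3) 𝓘(ℝ, ℂ) ∞ (fun z => ((L.tube i).symm z).2) z :=
      contMDiffAt_snd.comp z h1
    have h3 := contDiff_radialCutoff_norm.contMDiff.contMDiffAt.comp z h2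
    refine h3.congr_of_eventuallyEq ?_
    filter_upwards [(L.tube i).open_target.mem_nhds hz] with z' hz'
    exact if_pos hz'
  · have hK := L.isCompact_image_tube i (isCompact_closedBall (0 : ℂ) (2 / 3)) (fun ζ hζ => by
      rw [mem_closedBall_zero_iff] at hζ; linarith)
    refine (contMDiffAt_const (c := (0 : ℝ))).congr_of_eventuallyEq ?_
    have hmem : z ∉ L.tube i '' (univ ×ˢ Metric.closedBall (0 : ℂ) (2 / 3)) := by
      rintro ⟨⟨u, ζ⟩, hζ, rfl⟩
      have h2 := hζ.2
      rw [mem_closedBall_zero_iff] at h2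
      exact hz (L.tube_mem (by simp only at h2; linarith))
    filter_upwards [hK.isClosed.isOpen_compl.mem_nhds hmem] with z' hz'
    by_cases h : z' ∈ (L.tube i).target
    · obtain ⟨u, ζ, hζ, rfl⟩ := L.exists_of_mem_tube h
      rw [L.bump_tube hζ]
      apply radialCutoff_of_ge
      by_contra hlt
      exact hz' ⟨(u, ζ), ⟨mem_univ _, mem_closedBall_zero_iff.2 (by simp only; linarith)⟩, rfl⟩
    · exact L.bump_of_notMem h

lemma contMDiff_bumpSum [T2Space Y] (I : Finset (Fin l)) :
    ContMDiff (𝓡 3) 𝓘(ℝ, ℝ) ∞ (L.bumpSum I) :=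
  contMDiff_finsetSum fun i _ => L.contMDiff_bump i

end FramedLink

/-! ### Height and walls on the surgery cobordism -/

namespace SurgeryCobordism

variable {l : ℕ} {Y : Type*} [TopologicalSpace Y] [ChartedSpace (EuclideanSpace ℝ (Fin 3)) Y]
  {L : FramedLink l Y} {W : Type*} [TopologicalSpace W] [ChartedSpace (EuclideanHalfSpace 4) W]
  (C : SurgeryCobordism L W)

lemma exists_polar {x : ℂ} (hx : x ≠ 0) : ∃ (r : ℝ) (u : Circle), 0 < r ∧ x = r * u ∧ ‖x‖ = r :=
  ⟨‖x‖, Circle.exp x.arg, norm_pos_iff.2 hx,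
    by rw [Circle.coe_exp, Complex.norm_mul_exp_arg_mul_I], rfl⟩

lemma norm_ofReal_mul_circle {r : ℝ} (hr : 0 < r) (u : Circle) : ‖(r : ℂ) * u‖ = r := by
  simp [abs_of_pos hr, Circle.norm_coe]

/-- The point of the base that corresponds to a point of a handle off the cocore. -/
lemma glue_mem {i : Fin l} {u : Circle} {r : ℝ} {y : ℂ} (hr : 0 < r)
    (h : ((r : ℂ) * u, y) ∈ handleRegion) :
    ‖(r : ℂ) * y‖ < 1 ∧ (L.tube i (u, (r : ℂ) * y), ‖y‖ ^ 2 - r ^ 2) ∈ L.baseRegion := by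
  obtain ⟨h1, h2⟩ := h
  simp only [norm_ofReal_mul_circle hr] at h1 h2
  have h3 : ‖(r : ℂ) * y‖ < 1 := by
    simpa [abs_of_pos hr] using h1
  refine ⟨h3, h2, fun hc => ?_⟩
  simp only at hc ⊢
  rw [L.mem_carrier_tube h3] at hc
  have hy : y = 0 := by
    rcases mul_eq_zero.1 hc with h | h
    · exact absurd (Complex.ofReal_eq_zero.1 h) hr.ne'
    · exact h
  rw [hy, norm_zero]
  nlinarith

lemma base_mem {p : Y × ℝ} (hp : p ∈ L.baseRegion) : C.base p ∈ C.base.target :=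
  C.base.map_source (C.base_source ▸ hp)

lemma symm_base {p : Y × ℝ} (hp : p ∈ L.baseRegion) : C.base.symm (C.base p) = p :=
  C.base.left_inv (C.base_source ▸ hp)

lemma exists_of_mem_base {w : W} (hw : w ∈ C.base.target) :
    ∃ p ∈ L.baseRegion, w = C.base p :=
  ⟨C.base.symm w, C.base_source ▸ C.base.map_target hw, (C.base.right_inv hw).symm⟩

lemma handle_mem {i : Fin l} {p : ℂ × ℂ} (hp : p ∈ handleRegion) :
    C.handle i p ∈ (C.handle i).target :=
  (C.handle i).map_source (C.handle_source i ▸ hp)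

lemma symm_handle {i : Fin l} {p : ℂ × ℂ} (hp : p ∈ handleRegion) :
    (C.handle i).symm (C.handle i p) = p :=
  (C.handle i).left_inv (C.handle_source i ▸ hp)

lemma exists_of_mem_handle {i : Fin l} {w : W} (hw : w ∈ (C.handle i).target) :
    ∃ p ∈ handleRegion, w = C.handle i p :=
  ⟨(C.handle i).symm w, C.handle_source i ▸ (C.handle i).map_target hw,
    ((C.handle i).right_inv hw).symm⟩

lemma handle_mem_base_iff {i : Fin l} {x y : ℂ} (h : (x, y) ∈ handleRegion) :
    C.handle i (x, y) ∈ C.base.target ↔ x ≠ 0 := by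
  constructor
  · rintro hb rfl
    exact C.cocore_notMem_base i y h hb
  · intro hx
    obtain ⟨r, u, hr, rfl, -⟩ := exists_polar hx
    rw [C.glue i u r y hr h]
    exact C.base_mem (glue_mem hr h).2

lemma exists_of_notMem_base {w : W} (hw : w ∉ C.base.target) :
    ∃ i y, ((0 : ℂ), y) ∈ handleRegion ∧ w = C.handle i (0, y) := by
  have h := C.cover.ge (mem_univ w)
  rcases h with h | h
  · exact absurd h hw
  obtain ⟨i, hi⟩ := mem_iUnion.1 h
  obtain ⟨⟨x, y⟩, hxy, rfl⟩ := C.exists_of_mem_handle hi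
  rw [C.handle_mem_base_iff hxy, not_not] at hw
  subst hw
  exact ⟨i, y, hxy, rfl⟩

lemma cocore_mem_handle_iff {i j : Fin l} {y : ℂ} (h : ((0 : ℂ), y) ∈ handleRegion) :
    C.handle i (0, y) ∈ (C.handle j).target ↔ j = i := by
  constructor
  · intro hj
    by_contra hij
    obtain ⟨⟨x', y'⟩, hxy, he⟩ := C.exists_of_mem_handle hj
    have h1 := C.cocore_notMem_base i y h
    rw [he, C.handle_mem_base_iff hxy, not_not] at h1
    subst h1
    exact C.disjoint_cocore i j y y' (Ne.symm hij) h hxy he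
  · rintro rfl
    exact C.handle_mem h

/-- The height over a base point `Y` of the graph with background level `v` that passes above the
handles in `I`. -/
def cut (I : Finset (Fin l)) (v : ℝ) (w : W) : ℝ :=
  open Classical in
  if w ∈ C.base.target then v + L.bumpSum I (C.base.symm w).1
  else v + ∑ i ∈ I, if w ∈ (C.handle i).target then 1 else 0

/-- The height relative to the graph with background level `v` over the handles in `I`. -/
def wallCoord (I : Finset (Fin l)) (v : ℝ) (w : W) : ℝ := C.height w - C.cut I v w

lemma height_base {p : Y × ℝ} (hp : p ∈ L.baseRegion) : C.height (C.base p) = p.2 := by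
  rw [height, if_pos (C.base_mem hp), C.symm_base hp]

lemma height_handle {i : Fin l} {x y : ℂ} (h : (x, y) ∈ handleRegion) :
    C.height (C.handle i (x, y)) = ‖y‖ ^ 2 - ‖x‖ ^ 2 := by
  by_cases hx : x = 0
  · subst hx
    rw [height, if_neg (C.cocore_notMem_base i y h)]
    simp only [C.cocore_mem_handle_iff h]
    rw [Finset.sum_ite_eq' Finset.univ i, if_pos (Finset.mem_univ _), C.symm_handle h]
  · obtain ⟨r, u, hr, rfl, hn⟩ := exists_polar hx
    rw [C.glue i u r y hr h, C.height_base (glue_mem hr h).2, hn]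

lemma cut_base (I : Finset (Fin l)) (v : ℝ) {p : Y × ℝ} (hp : p ∈ L.baseRegion) :
    C.cut I v (C.base p) = v + L.bumpSum I p.1 := by
  rw [cut, if_pos (C.base_mem hp), C.symm_base hp]

/-- Under the gluing, (ru, y) lies over the tube point (u, ry), so the cut-off depends on |xy| only.
This expression remains smooth across the cocore x = 0. -/
lemma cut_handle (I : Finset (Fin l)) (v : ℝ) {i : Fin l} {x y : ℂ} (h : (x, y) ∈ handleRegion) :
    C.cut I v (C.handle i (x, y)) = v + if i ∈ I then radialCutoff ‖x * y‖ else 0 := by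
  by_cases hx : x = 0
  · subst hx
    rw [cut, if_neg (C.cocore_notMem_base i y h)]
    simp only [C.cocore_mem_handle_iff h]
    rw [Finset.sum_ite_eq' I i, zero_mul, norm_zero, radialCutoff_of_le (by norm_num)]
  · obtain ⟨r, u, hr, rfl, hn⟩ := exists_polar hx
    obtain ⟨h1, h2⟩ := glue_mem (L := L) (i := i) hr h
    rw [C.glue i u r y hr h, C.cut_base I v h2, L.bumpSum_tube h1]
    simp [Circle.norm_coe]

lemma wallCoord_base (I : Finset (Fin l)) (v : ℝ) {p : Y × ℝ} (hp : p ∈ L.baseRegion) :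
    C.wallCoord I v (C.base p) = p.2 - (v + L.bumpSum I p.1) := by
  rw [wallCoord, C.height_base hp, C.cut_base I v hp]

lemma wallCoord_handle (I : Finset (Fin l)) (v : ℝ) {i : Fin l} {x y : ℂ}
    (h : (x, y) ∈ handleRegion) :
    C.wallCoord I v (C.handle i (x, y)) =
      ‖y‖ ^ 2 - ‖x‖ ^ 2 - (v + if i ∈ I then radialCutoff ‖x * y‖ else 0) := by
  rw [wallCoord, C.height_handle h, C.cut_handle I v h]

lemma contMDiff_wallCoord [T2Space Y] (I : Finset (Fin l)) (v : ℝ) :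
    ContMDiff (𝓡∂ 4) 𝓘(ℝ, ℝ) ∞ (C.wallCoord I v) := by
  intro w
  by_cases hw : w ∈ C.base.target
  · have h1 := (C.smooth_base_symm w hw).contMDiffAt (C.isOpen_base.mem_nhds hw)
    have h2 : ContMDiff ((𝓡 3).prod 𝓘(ℝ, ℝ)) 𝓘(ℝ, ℝ) ∞
        (fun p : Y × ℝ => p.2 - (v + L.bumpSum I p.1)) :=
      contMDiff_snd.sub (contMDiff_const.add ((L.contMDiff_bumpSum I).comp contMDiff_fst))
    refine (h2.contMDiffAt.comp w h1).congr_of_eventuallyEq ?_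
    filter_upwards [C.isOpen_base.mem_nhds hw] with w' hw'
    obtain ⟨p, hp, rfl⟩ := C.exists_of_mem_base hw'
    rw [C.wallCoord_base I v hp, Function.comp, C.symm_base hp]
  · obtain ⟨i, y, h, rfl⟩ := C.exists_of_notMem_base hw
    have hm := C.handle_mem (i := i) h
    have h1 := (C.smooth_handle_symm i _ hm).contMDiffAt ((C.isOpen_handle i).mem_nhds hm)
    have h2 : ContDiff ℝ ∞ (fun p : ℂ × ℂ =>
        ‖p.2‖ ^ 2 - ‖p.1‖ ^ 2 - (v + if i ∈ I then radialCutoff ‖p.1 * p.2‖ else 0)) := by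
      refine ContDiff.sub ?_ (contDiff_const.add ?_)
      · exact (contDiff_snd.norm_sq ℝ).sub (contDiff_fst.norm_sq ℝ)
      · split_ifs
        · exact contDiff_radialCutoff_norm.comp (contDiff_fst.mul contDiff_snd)
        · exact contDiff_const
    refine (h2.contMDiff.contMDiffAt.comp _ h1).congr_of_eventuallyEq ?_
    filter_upwards [(C.isOpen_handle i).mem_nhds hm] with w' hw'
    obtain ⟨⟨x', y'⟩, hp, rfl⟩ := C.exists_of_mem_handle hw'
    rw [C.wallCoord_handle I v hp, Function.comp, C.symm_handle hp]

lemma cut_le_add_one (I : Finset (Fin l)) (v : ℝ) (w : W) : C.cut I v w ≤ v + 1 := by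
  by_cases hw : w ∈ C.base.target
  · obtain ⟨p, hp, rfl⟩ := C.exists_of_mem_base hw
    rw [C.cut_base I v hp]
    linarith [L.bumpSum_le_one I p.1]
  · obtain ⟨i, y, h, rfl⟩ := C.exists_of_notMem_base hw
    rw [C.cut_handle I v h]
    split_ifs
    · linarith [radialCutoff_le_one ‖0 * y‖]
    · linarith

lemma cut_mono {I J : Finset (Fin l)} (hIJ : I ⊆ J) {v v' : ℝ} (hv : v ≤ v') (w : W) :
    C.cut I v w ≤ C.cut J v' w := by
  by_cases hw : w ∈ C.base.target
  · obtain ⟨p, hp, rfl⟩ := C.exists_of_mem_base hw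
    rw [C.cut_base I v hp, C.cut_base J v' hp]
    linarith [L.bumpSum_mono hIJ p.1]
  · obtain ⟨i, y, h, rfl⟩ := C.exists_of_notMem_base hw
    rw [C.cut_handle I v h, C.cut_handle J v' h]
    have := radialCutoff_nonneg ‖0 * y‖
    split_ifs with h1 h2 h2
    · linarith
    · exact absurd (hIJ h1) h2
    · linarith
    · linarith

lemma cut_empty (v : ℝ) (w : W) : C.cut ∅ v w = v := by
  unfold cut
  simp [FramedLink.bumpSum]

lemma le_cut (I : Finset (Fin l)) (v : ℝ) (w : W) : v ≤ C.cut I v w := by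
  rw [← C.cut_empty v w]
  exact C.cut_mono (Finset.empty_subset _) (by rw [C.cut_empty]) w

lemma cutHeight_eq (I : Finset (Fin l)) (w : W) : C.cutHeight I w = C.cut I (vertexLevel I) w := rfl

lemma hypersurface_eq (I : InternalVertex l) :
    C.hypersurface I = {w | C.wallCoord I.1 (vertexLevel I.1) w = 0} := by
  ext w
  simp only [hypersurface, cutHeight_eq, wallCoord, mem_ofPred_eq, sub_eq_zero]

lemma isOpen_below [T2Space Y] (I : InternalVertex l) : IsOpen (C.below I) := by
  have : C.below I = {w | C.wallCoord I.1 (vertexLevel I.1) w < 0} := by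
    ext w
    simp only [below, cutHeight_eq, wallCoord, mem_ofPred_eq, sub_neg]
  rw [this]
  exact isOpen_lt (C.contMDiff_wallCoord _ _).continuous continuous_const

lemma isOpen_above [T2Space Y] (I : InternalVertex l) : IsOpen (C.above I) := by
  have : C.above I = {w | 0 < C.wallCoord I.1 (vertexLevel I.1) w} := by
    ext w
    simp only [above, cutHeight_eq, wallCoord, mem_ofPred_eq, sub_pos]
  rw [this]
  exact isOpen_lt continuous_const (C.contMDiff_wallCoord _ _).continuous

lemma isCompact_wall [T2Space Y] [CompactSpace W] (I : Finset (Fin l)) (v : ℝ) :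
    IsCompact {w | C.wallCoord I v w = 0} :=
  (isClosed_eq (C.contMDiff_wallCoord I v).continuous continuous_const).isCompact

lemma incoming_subset_below (I : InternalVertex l) : C.incoming ⊆ C.below I := by
  intro w (hw : C.height w = -1)
  change C.height w < C.cutHeight I.1 w
  have h1 := C.le_cut I.1 (vertexLevel I.1) w
  have h2 := le_vertexLevel I.2.1
  have h3 : (0 : ℝ) < 1 / 2 ^ l := by positivity
  rw [hw, cutHeight_eq]
  linarith

lemma outgoing_subset_above (I : InternalVertex l) : C.outgoing ⊆ C.above I := by
  intro w (hw : C.height w = 1)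
  change C.cutHeight I.1 w < C.height w
  have h1 := C.cut_le_add_one I.1 (vertexLevel I.1) w
  have h2 := vertexLevel_le I.1
  have h3 : (0 : ℝ) < 1 / 2 ^ l := by positivity
  rw [hw, cutHeight_eq]
  linarith

lemma core_mem_below (I : InternalVertex l) {i : Fin l} (hi : i ∈ I.1) {x : ℂ}
    (hx : (x, (0 : ℂ)) ∈ handleRegion) : C.handle i (x, 0) ∈ C.below I := by
  change C.height _ < C.cutHeight I.1 _
  have h2 := le_vertexLevel I.2.1
  have h3 : (0 : ℝ) < 1 / 2 ^ l := by positivity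
  rw [cutHeight_eq, C.height_handle hx, C.cut_handle _ _ hx, if_pos hi, mul_zero, norm_zero,
    radialCutoff_of_le (by norm_num)]
  nlinarith [sq_nonneg ‖x‖]

lemma cocore_mem_above (I : InternalVertex l) {i : Fin l} (hi : i ∉ I.1) {y : ℂ}
    (hy : ((0 : ℂ), y) ∈ handleRegion) : C.handle i (0, y) ∈ C.above I := by
  change C.cutHeight I.1 _ < C.height _
  have h2 := vertexLevel_le I.1
  have h3 : (0 : ℝ) < 1 / 2 ^ l := by positivity
  rw [cutHeight_eq, C.height_handle hy, C.cut_handle _ _ hy, if_neg hi, norm_zero]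
  nlinarith [sq_nonneg ‖y‖]

lemma cutHeight_lt {I J : InternalVertex l} (h : I < J) (w : W) :
    C.cutHeight I.1 w < C.cutHeight J.1 w := by
  have h1 : I.1 ⊂ J.1 := h
  have h2 := vertexLevel_lt_of_ssubset h1
  have h3 := C.cut_mono h1.1 (le_refl (vertexLevel I.1)) w
  have h4 : C.cut J.1 (vertexLevel J.1) w =
      C.cut J.1 (vertexLevel I.1) w + (vertexLevel J.1 - vertexLevel I.1) := by
    unfold cut
    split_ifs <;> ring
  rw [cutHeight_eq, cutHeight_eq, h4]
  linarith

lemma hypersurface_subset_below {I J : InternalVertex l} (h : I < J) :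
    C.hypersurface I ⊆ C.below J := by
  intro w (hw : C.height w = C.cutHeight I.1 w)
  change C.height w < C.cutHeight J.1 w
  rw [hw]
  exact C.cutHeight_lt h w

lemma hypersurface_subset_above {I J : InternalVertex l} (h : I < J) :
    C.hypersurface J ⊆ C.above I := by
  intro w (hw : C.height w = C.cutHeight J.1 w)
  change C.cutHeight I.1 w < C.height w
  rw [hw]
  exact C.cutHeight_lt h w

lemma exists_radialCutoff_eq {c : ℝ} (h0 : 0 ≤ c) (h1 : c ≤ 1) :
    ∃ r ∈ Icc (1 / 3 : ℝ) (2 / 3), radialCutoff r = c := by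
  have := intermediate_value_Icc' (by norm_num : (1 / 3 : ℝ) ≤ 2 / 3)
    contDiff_radialCutoff.continuous.continuousOn
  rw [radialCutoff_of_le le_rfl, radialCutoff_of_ge le_rfl] at this
  exact this ⟨h0, h1⟩

/-- In the tube of some i in I but not in J, the hypersurface Y_J has constant height v_J while Y_I
has height v_I + χ_i. Since 0 ≤ v_J − v_I ≤ 1, the two agree at some radius, and they meet at the
negative height v_J, which is in the base. -/
lemma inter_nonempty_of_not_subset {I J : InternalVertex l}
    (hlt : vertexLevel I.1 ≤ vertexLevel J.1) (hIJ : ¬ I.1 ⊆ J.1) :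
    (C.hypersurface I ∩ C.hypersurface J).Nonempty := by
  obtain ⟨i, hi, hi'⟩ := Finset.not_subset.1 hIJ
  have h1 := le_vertexLevel I.2.1
  have h2 := vertexLevel_le J.1
  have h3 : (0 : ℝ) < 1 / 2 ^ l := by positivity
  obtain ⟨r, hr, hrc⟩ := exists_radialCutoff_eq (c := vertexLevel J.1 - vertexLevel I.1)
    (by linarith) (by linarith)
  have hn : ‖(r : ℂ)‖ = r := by
    rw [Complex.norm_real, Real.norm_of_nonneg (by linarith [hr.1])]
  have hn1 : ‖(r : ℂ)‖ < 1 := by rw [hn]; linarith [hr.2]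
  have hp : (L.tube i (1, (r : ℂ)), vertexLevel J.1) ∈ L.baseRegion := by
    refine ⟨abs_le.2 ⟨?_, ?_⟩, fun _ => ?_⟩
    · simp only; linarith [le_vertexLevel J.2.1]
    · simp only; linarith
    · simp only; linarith
  refine ⟨C.base (L.tube i (1, (r : ℂ)), vertexLevel J.1), ?_, ?_⟩
  · rw [hypersurface_eq, mem_ofPred_eq, C.wallCoord_base _ _ hp]
    simp only [L.bumpSum_tube hn1, if_pos hi, hn, hrc]
    ring
  · rw [hypersurface_eq, mem_ofPred_eq, C.wallCoord_base _ _ hp]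
    simp only [L.bumpSum_tube hn1, if_neg hi']
    ring

lemma disjoint_hypersurface_iff {I J : InternalVertex l} (hne : I ≠ J) :
    Disjoint (C.hypersurface I) (C.hypersurface J) ↔ I ≤ J ∨ J ≤ I := by
  constructor
  · intro h
    by_contra! hcon
    rw [Set.disjoint_iff_inter_eq_empty] at h
    rcases le_total (vertexLevel I.1) (vertexLevel J.1) with hl | hl
    · exact (C.inter_nonempty_of_not_subset hl hcon.1).ne_empty h
    · have h2 := (C.inter_nonempty_of_not_subset hl hcon.2).ne_empty
      rw [Set.inter_comm] at h2
      exact h2 h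
  · intro h
    rw [Set.disjoint_left]
    intro w (hI : C.height w = C.cutHeight I.1 w) (hJ : C.height w = C.cutHeight J.1 w)
    rcases h with h | h
    · exact (C.cutHeight_lt (lt_of_le_of_ne h hne) w).ne (hI.symm.trans hJ)
    · exact (C.cutHeight_lt (lt_of_le_of_ne h hne.symm) w).ne (hJ.symm.trans hI)

end SurgeryCobordism

/-! ### Metrics that are cylindrical along a system of commuting collars -/

/-- A smooth cut-off function, `0` on `[-a, a]` and `1` outside `(-b, b)`. -/
def outerCutoff (a b t : ℝ) : ℝ := Real.smoothTransition ((t ^ 2 - a ^ 2) / (b ^ 2 - a ^ 2))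

lemma outerCutoff_of_le {a b t : ℝ} (ha : 0 ≤ a) (hab : a < b) (h : |t| ≤ a) :
    outerCutoff a b t = 0 := by
  refine Real.smoothTransition.zero_of_nonpos (div_nonpos_of_nonpos_of_nonneg ?_ ?_)
  · rw [← sq_abs t]; nlinarith [abs_nonneg t]
  · nlinarith

lemma outerCutoff_of_ge {a b t : ℝ} (ha : 0 ≤ a) (hab : a < b) (h : b ≤ |t|) :
    outerCutoff a b t = 1 := by
  refine Real.smoothTransition.one_of_one_le ?_
  rw [one_le_div (by nlinarith), ← sq_abs t]
  nlinarith

lemma contDiff_outerCutoff (a b : ℝ) : ContDiff ℝ ∞ (outerCutoff a b) :=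
  (Real.smoothTransition.contDiff (n := ⊤)).comp
    (by fun_prop : ContDiff ℝ ∞ fun t : ℝ => (t ^ 2 - a ^ 2) / (b ^ 2 - a ^ 2))

/-- A family of collars of hypersurfaces `{t_a = 0}`, given by their normal coordinates `t_a` and
by the motions along their normal lines, such that the motions of any two collars commute and each
one preserves the normal coordinate of the other. -/
structure CollarSystem (ι W : Type*) [TopologicalSpace W]
    [ChartedSpace (EuclideanHalfSpace 4) W] where
  ε : ℝ
  ε_pos : 0 < ε
  coord : ι → W → ℝ
  side : ι → Set ℝ
  zero_mem : ∀ a, (0 : ℝ) ∈ side a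
  mul_mem : ∀ a, ∀ s ∈ side a, ∀ r ∈ Icc (0 : ℝ) 1, s * r ∈ side a
  smooth_coord : ∀ a, ContMDiff (𝓡∂ 4) 𝓘(ℝ, ℝ) ∞ (coord a)
  coord_mem : ∀ a w, |coord a w| < ε → coord a w ∈ side a
  move : ι → W → ℝ → W
  smooth_move : ∀ a, ContMDiffOn ((𝓡∂ 4).prod 𝓘(ℝ, ℝ)) (𝓡∂ 4) ∞
    (fun p : W × ℝ => move a p.1 p.2) ({w | |coord a w| < ε} ×ˢ (Ioo (-ε) ε ∩ side a))
  coord_move : ∀ a w s, |coord a w| < ε → |s| < ε → s ∈ side a → coord a (move a w s) = s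
  move_coord : ∀ a w, |coord a w| < ε → move a w (coord a w) = w
  move_move : ∀ a w s s', |coord a w| < ε → |s| < ε → s ∈ side a → |s'| < ε → s' ∈ side a →
    move a (move a w s) s' = move a w s'
  coord_move_of_ne : ∀ a b w s, a ≠ b → |coord a w| < ε → |coord b w| < ε → |s| < ε →
    s ∈ side a → coord b (move a w s) = coord b w
  move_comm : ∀ a b w s s', a ≠ b → |coord a w| < ε → |coord b w| < ε → |s| < ε →
    s ∈ side a → |s'| < ε → s' ∈ side b → move a (move b w s') s = move b (move a w s) s'

namespace CollarSystem

variable {ι W : Type*} [TopologicalSpace W] [ChartedSpace (EuclideanHalfSpace 4) W]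
  (Γ : CollarSystem ι W)

lemma isOpen_collar (a : ι) (r : ℝ) : IsOpen {w | |Γ.coord a w| < r} :=
  isOpen_lt (Γ.smooth_coord a).continuous.abs continuous_const

/-- A motion along one collar does not change any other collar. -/
lemma mem_collar_move_iff {a b : ι} (hab : a ≠ b) {w : W} {s : ℝ} (hw : |Γ.coord a w| < Γ.ε)
    (hs : |s| < Γ.ε) (hs' : s ∈ Γ.side a) :
    |Γ.coord b (Γ.move a w s)| < Γ.ε ↔ |Γ.coord b w| < Γ.ε := by
  constructor
  · intro h
    have h1 : |Γ.coord a (Γ.move a w s)| < Γ.ε := by rwa [Γ.coord_move a w s hw hs hs']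
    have h2 := Γ.coord_move_of_ne a b _ (Γ.coord a w) hab h1 h hw (Γ.coord_mem a w hw)
    rw [Γ.move_move a w s _ hw hs hs' hw (Γ.coord_mem a w hw), Γ.move_coord a w hw] at h2
    rwa [h2]
  · intro h
    rwa [Γ.coord_move_of_ne a b w s hab hw h hs hs']

/-- The collapse of the normal coordinate. -/
def shrink (t : ℝ) : ℝ := t * outerCutoff (Γ.ε / 3) (Γ.ε / 2) t

lemma shrink_of_le {t : ℝ} (h : |t| ≤ Γ.ε / 3) : Γ.shrink t = 0 := by
  have := Γ.ε_pos
  rw [shrink, outerCutoff_of_le (by linarith) (by linarith) h, mul_zero]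

lemma shrink_of_ge {t : ℝ} (h : Γ.ε / 2 ≤ |t|) : Γ.shrink t = t := by
  have := Γ.ε_pos
  rw [shrink, outerCutoff_of_ge (by linarith) (by linarith) h, mul_one]

lemma outerCutoff_mem (a b t : ℝ) : outerCutoff a b t ∈ Icc (0 : ℝ) 1 :=
  ⟨Real.smoothTransition.nonneg _, Real.smoothTransition.le_one _⟩

lemma abs_shrink_lt {t : ℝ} (h : |t| < Γ.ε) : |Γ.shrink t| < Γ.ε := by
  have h1 := outerCutoff_mem (Γ.ε / 3) (Γ.ε / 2) t
  rw [shrink, abs_mul, abs_of_nonneg h1.1]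
  exact (mul_le_of_le_one_right (abs_nonneg t) h1.2).trans_lt h

lemma shrink_mem {a : ι} {t : ℝ} (h : t ∈ Γ.side a) : Γ.shrink t ∈ Γ.side a :=
  Γ.mul_mem a t h _ (outerCutoff_mem _ _ _)

lemma contDiff_shrink : ContDiff ℝ ∞ Γ.shrink :=
  contDiff_id.mul (contDiff_outerCutoff _ _)

/-- The normal coordinate, cut off outside of the collar. -/
def cutCoord (t : ℝ) : ℝ := t * (1 - outerCutoff (2 * Γ.ε / 3) (5 * Γ.ε / 6) t)

lemma cutCoord_of_le {t : ℝ} (h : |t| ≤ 2 * Γ.ε / 3) : Γ.cutCoord t = t := by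
  have := Γ.ε_pos
  rw [cutCoord, outerCutoff_of_le (by linarith) (by linarith) h, sub_zero, mul_one]

lemma cutCoord_of_ge {t : ℝ} (h : Γ.ε ≤ |t|) : Γ.cutCoord t = 0 := by
  have := Γ.ε_pos
  rw [cutCoord, outerCutoff_of_ge (by linarith) (by linarith) (by linarith), sub_self, mul_zero]

lemma contDiff_cutCoord : ContDiff ℝ ∞ Γ.cutCoord :=
  contDiff_id.mul (contDiff_const.sub (contDiff_outerCutoff _ _))

/-- The collapse of one collar. -/
def collapse (a : ι) (w : W) : W :=
  open Classical in if |Γ.coord a w| < Γ.ε then Γ.move a w (Γ.shrink (Γ.coord a w)) else w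

lemma collapse_of_lt {a : ι} {w : W} (h : |Γ.coord a w| < Γ.ε) :
    Γ.collapse a w = Γ.move a w (Γ.shrink (Γ.coord a w)) := if_pos h

lemma collapse_of_gt {a : ι} {w : W} (h : Γ.ε / 2 ≤ |Γ.coord a w|) : Γ.collapse a w = w := by
  unfold collapse
  split_ifs with h1
  · rw [Γ.shrink_of_ge h, Γ.move_coord a w h1]
  · rfl

lemma collapse_of_le {a : ι} {w : W} (h : |Γ.coord a w| ≤ Γ.ε / 3) :
    Γ.collapse a w = Γ.move a w 0 := by
  have := Γ.ε_pos
  rw [Γ.collapse_of_lt (by linarith), Γ.shrink_of_le h]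

/-- The domain of the motions of a collar. -/
def domain (a : ι) : Set (W × ℝ) :=
  {w | |Γ.coord a w| < Γ.ε} ×ˢ (Ioo (-Γ.ε) Γ.ε ∩ Γ.side a)

lemma mem_domain {a : ι} {w : W} {s : ℝ} (hw : |Γ.coord a w| < Γ.ε) (hs : |s| < Γ.ε)
    (hs' : s ∈ Γ.side a) : (w, s) ∈ Γ.domain a :=
  ⟨hw, abs_lt.1 hs, hs'⟩

/-- The foot of the normal line. -/
lemma contMDiffOn_move_comp (a : ι) {f : ℝ → ℝ} (hf : ContDiff ℝ ∞ f)
    (hf1 : ∀ t, |t| < Γ.ε → |f t| < Γ.ε) (hf2 : ∀ t ∈ Γ.side a, f t ∈ Γ.side a) :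
    ContMDiffOn (𝓡∂ 4) (𝓡∂ 4) ∞ (fun w => Γ.move a w (f (Γ.coord a w)))
      {w | |Γ.coord a w| < Γ.ε} := by
  have h : ContMDiffOn (𝓡∂ 4) ((𝓡∂ 4).prod 𝓘(ℝ, ℝ)) ∞ (fun w => (w, f (Γ.coord a w)))
      {w | |Γ.coord a w| < Γ.ε} :=
    (contMDiff_id.prodMk (hf.contMDiff.comp (Γ.smooth_coord a))).contMDiffOn
  exact (Γ.smooth_move a).comp h fun w hw =>
    Γ.mem_domain hw (hf1 _ hw) (hf2 _ (Γ.coord_mem a w hw))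

lemma contMDiff_collapse (a : ι) : ContMDiff (𝓡∂ 4) (𝓡∂ 4) ∞ (Γ.collapse a) := by
  intro w
  have hε := Γ.ε_pos
  by_cases hw : |Γ.coord a w| < Γ.ε
  · have h1 := Γ.contMDiffOn_move_comp a Γ.contDiff_shrink (fun t => Γ.abs_shrink_lt)
      (fun t => Γ.shrink_mem)
    have hn := (Γ.isOpen_collar a Γ.ε).mem_nhds hw
    refine ((h1 w hw).contMDiffAt hn).congr_of_eventuallyEq ?_
    filter_upwards [hn] with w' hw' using Γ.collapse_of_lt hw'
  · refine contMDiffAt_id.congr_of_eventuallyEq ?_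
    have hn : {w' | Γ.ε / 2 < |Γ.coord a w'|} ∈ 𝓝 w :=
      (isOpen_lt continuous_const (Γ.smooth_coord a).continuous.abs).mem_nhds
        (show Γ.ε / 2 < |Γ.coord a w| by rw [not_lt] at hw; linarith)
    filter_upwards [hn] with w' hw' using Γ.collapse_of_gt (le_of_lt hw')

lemma coord_collapse_of_ne {a b : ι} (hab : a ≠ b) {w : W} (hw : |Γ.coord b w| < Γ.ε) :
    Γ.coord b (Γ.collapse a w) = Γ.coord b w := by
  unfold collapse
  split_ifs with h
  · exact Γ.coord_move_of_ne a b w _ hab h hw (Γ.abs_shrink_lt h) (Γ.shrink_mem (Γ.coord_mem a w h))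
  · rfl

lemma mem_collar_collapse_iff {a b : ι} (hab : a ≠ b) {w : W} :
    |Γ.coord b (Γ.collapse a w)| < Γ.ε ↔ |Γ.coord b w| < Γ.ε := by
  unfold collapse
  split_ifs with h
  · exact Γ.mem_collar_move_iff hab h (Γ.abs_shrink_lt h) (Γ.shrink_mem (Γ.coord_mem a w h))
  · rfl

lemma cutCoord_collapse_of_ne {a b : ι} (hab : a ≠ b) (w : W) :
    Γ.cutCoord (Γ.coord b (Γ.collapse a w)) = Γ.cutCoord (Γ.coord b w) := by
  by_cases h : |Γ.coord b w| < Γ.ε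
  · rw [Γ.coord_collapse_of_ne hab h]
  · have h2 : ¬ |Γ.coord b (Γ.collapse a w)| < Γ.ε := by rwa [Γ.mem_collar_collapse_iff hab]
    rw [Γ.cutCoord_of_ge (not_lt.1 h), Γ.cutCoord_of_ge (not_lt.1 h2)]

lemma cutCoord_move_of_ne {a b : ι} (hab : a ≠ b) {w : W} {s : ℝ} (hw : |Γ.coord a w| < Γ.ε)
    (hs : |s| < Γ.ε) (hs' : s ∈ Γ.side a) :
    Γ.cutCoord (Γ.coord b (Γ.move a w s)) = Γ.cutCoord (Γ.coord b w) := by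
  by_cases h : |Γ.coord b w| < Γ.ε
  · rw [Γ.coord_move_of_ne a b w s hab hw h hs hs']
  · have h2 : ¬ |Γ.coord b (Γ.move a w s)| < Γ.ε := by rwa [Γ.mem_collar_move_iff hab hw hs hs']
    rw [Γ.cutCoord_of_ge (not_lt.1 h), Γ.cutCoord_of_ge (not_lt.1 h2)]

lemma collapse_move_of_ne {a b : ι} (hab : a ≠ b) {w : W} {s : ℝ} (hw : |Γ.coord a w| < Γ.ε)
    (hs : |s| < Γ.ε) (hs' : s ∈ Γ.side a) :
    Γ.collapse b (Γ.move a w s) = Γ.move a (Γ.collapse b w) s := by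
  by_cases h : |Γ.coord b w| < Γ.ε
  · have h2 := (Γ.mem_collar_move_iff hab hw hs hs').2 h
    rw [Γ.collapse_of_lt h, Γ.collapse_of_lt h2, Γ.coord_move_of_ne a b w s hab hw h hs hs']
    exact (Γ.move_comm a b w s _ hab hw h hs hs' (Γ.abs_shrink_lt h)
      (Γ.shrink_mem (Γ.coord_mem b w h))).symm
  · have h2 : ¬ |Γ.coord b (Γ.move a w s)| < Γ.ε := by rwa [Γ.mem_collar_move_iff hab hw hs hs']
    have hε := Γ.ε_pos
    rw [Γ.collapse_of_gt (by linarith), Γ.collapse_of_gt (by linarith)]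

/-- The collapse of several collars. -/
def collapseList (A : List ι) (w : W) : W := A.foldr Γ.collapse w

@[simp] lemma collapseList_cons (a : ι) (A : List ι) (w : W) :
    Γ.collapseList (a :: A) w = Γ.collapse a (Γ.collapseList A w) := rfl

lemma contMDiff_collapseList (A : List ι) : ContMDiff (𝓡∂ 4) (𝓡∂ 4) ∞ (Γ.collapseList A) := by
  induction A with
  | nil => exact contMDiff_id
  | cons a A ih => exact (Γ.contMDiff_collapse a).comp ih

lemma coord_collapseList {A : List ι} {b : ι} (hb : b ∉ A) {w : W} (hw : |Γ.coord b w| < Γ.ε) :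
    Γ.coord b (Γ.collapseList A w) = Γ.coord b w := by
  induction A with
  | nil => rfl
  | cons a A ih =>
    rw [List.mem_cons, not_or] at hb
    have h := ih hb.2
    rw [collapseList_cons, Γ.coord_collapse_of_ne (Ne.symm hb.1) (by rwa [h]), h]

lemma cutCoord_collapseList {A : List ι} {b : ι} (hb : b ∉ A) (w : W) :
    Γ.cutCoord (Γ.coord b (Γ.collapseList A w)) = Γ.cutCoord (Γ.coord b w) := by
  induction A with
  | nil => rfl
  | cons a A ih =>
    rw [List.mem_cons, not_or] at hb
    rw [collapseList_cons, Γ.cutCoord_collapse_of_ne (Ne.symm hb.1), ih hb.2]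

lemma collapseList_move_of_notMem {A : List ι} {a : ι} (ha : a ∉ A) {w : W} {s : ℝ}
    (hw : |Γ.coord a w| < Γ.ε) (hs : |s| < Γ.ε) (hs' : s ∈ Γ.side a) :
    Γ.collapseList A (Γ.move a w s) = Γ.move a (Γ.collapseList A w) s := by
  induction A with
  | nil => rfl
  | cons b A ih =>
    rw [List.mem_cons, not_or] at ha
    rw [collapseList_cons, ih ha.2, collapseList_cons,
      Γ.collapse_move_of_ne ha.1 (by rwa [Γ.coord_collapseList ha.2 hw]) hs hs']

lemma collapse_move_zero {a : ι} {w : W} (hw : |Γ.coord a w| ≤ Γ.ε / 3) :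
    Γ.collapse a (Γ.move a w 0) = Γ.collapse a w := by
  have hε := Γ.ε_pos
  have h0 : |(0 : ℝ)| < Γ.ε := by simpa using hε
  have hw' : |Γ.coord a w| < Γ.ε := by linarith
  have h1 := Γ.coord_move a w 0 hw' h0 (Γ.zero_mem a)
  rw [Γ.collapse_of_le hw, Γ.collapse_of_le (by rw [h1, abs_zero]; positivity),
    Γ.move_move a w 0 0 hw' h0 (Γ.zero_mem a) h0 (Γ.zero_mem a)]

/-- Near a hypersurface the total collapse factors through the normal projection. -/
lemma collapseList_move_zero {A : List ι} (hA : A.Nodup) {a : ι} (ha : a ∈ A) {w : W}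
    (hw : |Γ.coord a w| ≤ Γ.ε / 3) :
    Γ.collapseList A (Γ.move a w 0) = Γ.collapseList A w := by
  have hε := Γ.ε_pos
  have h0 : |(0 : ℝ)| < Γ.ε := by simpa using hε
  have hw' : |Γ.coord a w| < Γ.ε := by linarith
  induction A with
  | nil => simp at ha
  | cons b A ih =>
    rw [List.nodup_cons] at hA
    rw [collapseList_cons, collapseList_cons]
    by_cases hab : a = b
    · subst hab
      rw [Γ.collapseList_move_of_notMem hA.1 hw' h0 (Γ.zero_mem a), Γ.collapse_move_zero]
      rwa [Γ.coord_collapseList hA.1 hw']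
    · rw [ih hA.2 ((List.mem_cons.1 ha).resolve_left hab)]

lemma mdifferentiableAt_coord (a : ι) (w : W) :
    MDifferentiableAt (𝓡∂ 4) 𝓘(ℝ, ℝ) (Γ.coord a) w :=
  (Γ.smooth_coord a w).mdifferentiableAt (by norm_num)

lemma contMDiff_cutCoord_coord (a : ι) :
    ContMDiff (𝓡∂ 4) 𝓘(ℝ, ℝ) ∞ (fun w => Γ.cutCoord (Γ.coord a w)) :=
  Γ.contDiff_cutCoord.contMDiff.comp (Γ.smooth_coord a)

lemma coordDiff_cutCoord_of_lt {a : ι} {w : W} (hw : |Γ.coord a w| < 2 * Γ.ε / 3) :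
    coordDiff (fun w => Γ.cutCoord (Γ.coord a w)) w = coordDiff (Γ.coord a) w := by
  refine Filter.EventuallyEq.mfderiv_eq ?_
  filter_upwards [(Γ.isOpen_collar a _).mem_nhds hw] with w' hw'
  exact Γ.cutCoord_of_le (le_of_lt hw')

/-- A collapse and the corresponding coordinate form an immersion. -/
lemma eq_zero_of_mfderiv_collapse {a : ι} {w : W} {v : TangentSpace (𝓡∂ 4) w}
    (h1 : mfderiv (𝓡∂ 4) (𝓡∂ 4) (Γ.collapse a) w v = 0)
    (h2 : coordDiff (fun w => Γ.cutCoord (Γ.coord a w)) w v = 0) : v = 0 := by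
  have hε := Γ.ε_pos
  by_cases hw : |Γ.coord a w| < 2 * Γ.ε / 3
  · rw [Γ.coordDiff_cutCoord_of_lt hw] at h2
    have hw' : |Γ.coord a w| < Γ.ε := by linarith
    have hd : MDifferentiableWithinAt ((𝓡∂ 4).prod 𝓘(ℝ, ℝ)) (𝓡∂ 4)
        (fun p : W × ℝ => Γ.move a p.1 p.2) (Γ.domain a) (Γ.collapse a w, Γ.coord a w) := by
      refine (Γ.smooth_move a _ ?_).mdifferentiableWithinAt (by norm_num)
      refine Γ.mem_domain ?_ hw' (Γ.coord_mem a w hw')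
      rw [Γ.collapse_of_lt hw', Γ.coord_move a w _ hw' (Γ.abs_shrink_lt hw')
        (Γ.shrink_mem (Γ.coord_mem a w hw'))]
      exact Γ.abs_shrink_lt hw'
    have hF : HasMFDerivWithinAt (𝓡∂ 4) ((𝓡∂ 4).prod 𝓘(ℝ, ℝ))
        (fun w => (Γ.collapse a w, Γ.coord a w)) {w | |Γ.coord a w| < Γ.ε} w
        ((mfderiv (𝓡∂ 4) (𝓡∂ 4) (Γ.collapse a) w).prod (coordDiff (Γ.coord a) w)) :=
      (((Γ.contMDiff_collapse a w).mdifferentiableAt (by norm_num)).hasMFDerivAt.prodMk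
        (Γ.mdifferentiableAt_coord a w).hasMFDerivAt).hasMFDerivWithinAt
    have hmaps : {w | |Γ.coord a w| < Γ.ε} ⊆
        (fun w => (Γ.collapse a w, Γ.coord a w)) ⁻¹' Γ.domain a := by
      intro w' hw'
      refine Γ.mem_domain ?_ hw' (Γ.coord_mem a w' hw')
      rw [Γ.collapse_of_lt hw', Γ.coord_move a w' _ hw' (Γ.abs_shrink_lt hw')
        (Γ.shrink_mem (Γ.coord_mem a w' hw'))]
      exact Γ.abs_shrink_lt hw'
    have hcomp := HasMFDerivWithinAt.comp w hd.hasMFDerivWithinAt hF hmaps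
    have hn := (Γ.isOpen_collar a Γ.ε).mem_nhds hw'
    have hid := (hcomp.hasMFDerivAt hn).mfderiv
    -- Moving the collapsed point back to its original normal coordinate recovers w. So collapse and
    -- coordinate together have a smooth left inverse, and their joint differential is injective.
    have heq : ((fun p : W × ℝ => Γ.move a p.1 p.2) ∘ fun w => (Γ.collapse a w, Γ.coord a w))
        =ᶠ[𝓝 w] id := by
      filter_upwards [hn] with w' hw'
      have hs := Γ.shrink_mem (Γ.coord_mem a w' hw')
      simp only [Function.comp, id]
      rw [Γ.collapse_of_lt hw', Γ.move_move a w' _ _ hw' (Γ.abs_shrink_lt hw') hs hw'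
        (Γ.coord_mem a w' hw'), Γ.move_coord a w' hw']
    have hv := heq.mfderiv_eq (I := 𝓡∂ 4) (I' := 𝓡∂ 4)
    rw [hid, mfderiv_id] at hv
    have hv2 := congrArg (fun T => T v) hv
    have hz : ((mfderiv (𝓡∂ 4) (𝓡∂ 4) (Γ.collapse a) w).prod (coordDiff (Γ.coord a) w)) v = 0 := by
      exact Prod.ext h1 h2
    refine Eq.trans hv2.symm ?_
    have hT : ∀ T : TangentSpace ((𝓡∂ 4).prod 𝓘(ℝ, ℝ)) (Γ.collapse a w, Γ.coord a w) →L[ℝ]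
        TangentSpace (𝓡∂ 4) w, T (((mfderiv (𝓡∂ 4) (𝓡∂ 4) (Γ.collapse a) w).prod
          (coordDiff (Γ.coord a) w)) v) = 0 := fun T =>
      (congrArg T hz).trans (ContinuousLinearMap.map_zero T)
    exact hT _
  · have heq : Γ.collapse a =ᶠ[𝓝 w] id := by
      have hn : {w' | Γ.ε / 2 < |Γ.coord a w'|} ∈ 𝓝 w :=
        (isOpen_lt continuous_const (Γ.smooth_coord a).continuous.abs).mem_nhds
          (show Γ.ε / 2 < |Γ.coord a w| by rw [not_lt] at hw; linarith)
      filter_upwards [hn] with w' hw' using Γ.collapse_of_gt (le_of_lt hw')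
    have hv := heq.mfderiv_eq (I := 𝓡∂ 4) (I' := 𝓡∂ 4)
    rw [mfderiv_id] at hv
    have hv2 := congrArg (fun T => T v) hv
    exact hv2.symm.trans h1

/-- Induction over the collars. Collapsing the others does not change the cut-off coordinate of a,
so the hypothesis on it can be transported to the image point, where the case of one collar applies.
-/
lemma eq_zero_of_mfderiv_collapseList {A : List ι} (hA : A.Nodup) {w : W}
    {v : TangentSpace (𝓡∂ 4) w}
    (h1 : mfderiv (𝓡∂ 4) (𝓡∂ 4) (Γ.collapseList A) w v = 0)
    (h2 : ∀ a ∈ A, coordDiff (fun w => Γ.cutCoord (Γ.coord a w)) w v = 0) : v = 0 := by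
  induction A with
  | nil =>
    have : Γ.collapseList [] = id := rfl
    rw [this, mfderiv_id] at h1
    exact h1
  | cons a A ih =>
    rw [List.nodup_cons] at hA
    have hdA := ((Γ.contMDiff_collapseList A) w).mdifferentiableAt (by norm_num)
    refine ih hA.2 ?_ fun b hb => h2 b (List.mem_cons_of_mem a hb)
    refine Γ.eq_zero_of_mfderiv_collapse (a := a) (w := Γ.collapseList A w) ?_ ?_
    · have : Γ.collapseList (a :: A) = Γ.collapse a ∘ Γ.collapseList A := rfl
      rw [this, mfderiv_comp w ((Γ.contMDiff_collapse a _).mdifferentiableAt (by norm_num)) hdA]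
        at h1
      exact h1
    · have h3 := h2 a List.mem_cons_self
      have : (fun w => Γ.cutCoord (Γ.coord a w)) =
          (fun w => Γ.cutCoord (Γ.coord a w)) ∘ Γ.collapseList A :=
        funext fun w => (Γ.cutCoord_collapseList hA.1 w).symm
      rw [coordDiff, this, mfderiv_comp w
        ((Γ.contMDiff_cutCoord_coord a _).mdifferentiableAt (by norm_num)) hdA] at h3
      exact h3


section Metric

variable [Fintype ι] {n : ℕ} (e : W → EuclideanSpace ℝ (Fin n))

/-- The coordinates of an immersion that is cylindrical along all the collars. -/
def cylCoord (c : Fin n ⊕ ι) (w : W) : ℝ :=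
  Sum.elim (fun k => e (Γ.collapseList Finset.univ.toList w) k)
    (fun a => Γ.cutCoord (Γ.coord a w)) c

variable {e}

lemma contMDiff_cylCoord (he : ContMDiff (𝓡∂ 4) 𝓘(ℝ, EuclideanSpace ℝ (Fin n)) ∞ e)
    (c : Fin n ⊕ ι) : ContMDiff (𝓡∂ 4) 𝓘(ℝ, ℝ) ∞ (Γ.cylCoord e c) := by
  rcases c with k | a
  · have h : ContDiff ℝ ∞ (fun x : EuclideanSpace ℝ (Fin n) => x k) :=
      (EuclideanSpace.proj k : EuclideanSpace ℝ (Fin n) →L[ℝ] ℝ).contDiff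
    exact h.contMDiff.comp (he.comp (Γ.contMDiff_collapseList _))
  · exact Γ.contMDiff_cutCoord_coord a

lemma eq_zero_of_coordDiff_cylCoord (he : ContMDiff (𝓡∂ 4) 𝓘(ℝ, EuclideanSpace ℝ (Fin n)) ∞ e)
    (hinj : ∀ w, Function.Injective (mfderiv (𝓡∂ 4) 𝓘(ℝ, EuclideanSpace ℝ (Fin n)) e w))
    (w : W) (v : TangentSpace (𝓡∂ 4) w) (hv : ∀ c, coordDiff (Γ.cylCoord e c) w v = 0) :
    v = 0 := by
  refine Γ.eq_zero_of_mfderiv_collapseList (Finset.nodup_toList Finset.univ) ?_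
    fun a _ => hv (Sum.inr a)
  set Φ := Γ.collapseList Finset.univ.toList with hΦ
  have hdΦ : MDifferentiableAt (𝓡∂ 4) (𝓡∂ 4) Φ w :=
    ((Γ.contMDiff_collapseList _) w).mdifferentiableAt (by norm_num)
  have hde : MDifferentiableAt (𝓡∂ 4) 𝓘(ℝ, EuclideanSpace ℝ (Fin n)) e (Φ w) :=
    (he _).mdifferentiableAt (by norm_num)
  apply hinj (Φ w)
  rw [map_zero]
  apply PiLp.ext
  intro k
  have h1 := hv (Sum.inl k)
  have hcomp : Γ.cylCoord e (Sum.inl k) =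
      (EuclideanSpace.proj k : EuclideanSpace ℝ (Fin n) →L[ℝ] ℝ) ∘ (e ∘ Φ) := rfl
  rw [coordDiff, hcomp, mfderiv_comp w
    (ContinuousLinearMap.mdifferentiableAt _) (hde.comp w hdΦ), mfderiv_comp w hde hdΦ,
    ContinuousLinearMap.mfderiv_eq] at h1
  exact h1

/-- The normal projection of a collar. -/
def foot (a : ι) (w : W) : W := Γ.move a w 0

omit [Fintype ι] in
lemma contMDiffOn_foot (a : ι) :
    ContMDiffOn (𝓡∂ 4) (𝓡∂ 4) ∞ (Γ.foot a) {w | |Γ.coord a w| < Γ.ε} :=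
  Γ.contMDiffOn_move_comp a (f := fun _ => 0) contDiff_const
    (fun _ _ => by simpa using Γ.ε_pos) fun _ _ => Γ.zero_mem a

lemma cylCoord_foot {a : ι} {w : W} (hw : |Γ.coord a w| ≤ Γ.ε / 3) {c : Fin n ⊕ ι}
    (hc : c ≠ Sum.inr a) : Γ.cylCoord e c (Γ.foot a w) = Γ.cylCoord e c w := by
  have hε := Γ.ε_pos
  rcases c with k | b
  · simp only [cylCoord, Sum.elim_inl, foot]
    rw [Γ.collapseList_move_zero (Finset.nodup_toList Finset.univ)
      (Finset.mem_toList.2 (Finset.mem_univ a)) hw]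
  · exact Γ.cutCoord_move_of_ne (fun h => hc (congrArg Sum.inr h.symm)) (by linarith)
      (by simpa using hε) (Γ.zero_mem a)

lemma cylCoord_foot_self {a : ι} {w : W} (hw : |Γ.coord a w| < Γ.ε) :
    Γ.cylCoord e (Sum.inr a) (Γ.foot a w) = 0 := by
  have hε := Γ.ε_pos
  have h0 : |(0 : ℝ)| < Γ.ε := by simpa using hε
  simp only [cylCoord, Sum.elim_inr, foot]
  rw [Γ.coord_move a w 0 hw h0 (Γ.zero_mem a), Γ.cutCoord_of_le (by simpa using by positivity)]

/-- Close to the hypersurface all components of the immersion but t_a factor through the normal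
projection, while t_a vanishes on its image. This is the source of the cylindrical form dt² + h. -/
lemma coordDiff_cylCoord (he : ContMDiff (𝓡∂ 4) 𝓘(ℝ, EuclideanSpace ℝ (Fin n)) ∞ e) {a : ι}
    {w : W} (hw : |Γ.coord a w| < Γ.ε / 3) (c : Fin n ⊕ ι) (v : TangentSpace (𝓡∂ 4) w) :
    coordDiff (Γ.cylCoord e c) (Γ.foot a w) (mfderiv (𝓡∂ 4) (𝓡∂ 4) (Γ.foot a) w v) =
      open Classical in if c = Sum.inr a then 0 else coordDiff (Γ.cylCoord e c) w v := by
  have hε := Γ.ε_pos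
  have hw' : |Γ.coord a w| < Γ.ε := by linarith
  have hdf : MDifferentiableAt (𝓡∂ 4) (𝓡∂ 4) (Γ.foot a) w :=
    ((Γ.contMDiffOn_foot a w hw').contMDiffAt
      ((Γ.isOpen_collar a _).mem_nhds hw')).mdifferentiableAt (by norm_num)
  have hdc : MDifferentiableAt (𝓡∂ 4) 𝓘(ℝ, ℝ) (Γ.cylCoord e c) (Γ.foot a w) :=
    (Γ.contMDiff_cylCoord he c _).mdifferentiableAt (by norm_num)
  have hcomp := mfderiv_comp w hdc hdf
  have h1 : coordDiff (Γ.cylCoord e c) (Γ.foot a w)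
      (mfderiv (𝓡∂ 4) (𝓡∂ 4) (Γ.foot a) w v) =
      coordDiff (Γ.cylCoord e c ∘ Γ.foot a) w v := by
    rw [coordDiff, coordDiff, hcomp]
    rfl
  rw [h1]
  have hn := (Γ.isOpen_collar a _).mem_nhds hw
  split_ifs with hc
  · subst hc
    have heq : Γ.cylCoord e (Sum.inr a) ∘ Γ.foot a =ᶠ[𝓝 w] fun _ => 0 := by
      filter_upwards [hn] with w' (hw' : |Γ.coord a w'| < Γ.ε / 3)
      exact Γ.cylCoord_foot_self (by linarith)
    rw [coordDiff, heq.mfderiv_eq, mfderiv_const]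
    rfl
  · have heq : Γ.cylCoord e c ∘ Γ.foot a =ᶠ[𝓝 w] Γ.cylCoord e c := by
      filter_upwards [hn] with w' (hw' : |Γ.coord a w'| < Γ.ε / 3)
      exact Γ.cylCoord_foot hw'.le hc
    rw [coordDiff, heq.mfderiv_eq]
    rfl

/-- The coordinates of a collar, with the original hypersurface as target. -/
def collarChart (a : ι) : PartialEquiv W (W × ℝ) where
  toFun w := (Γ.foot a w, Γ.coord a w)
  invFun p := Γ.move a p.1 p.2
  source := {w | |Γ.coord a w| < Γ.ε / 3}
  target := {w | Γ.coord a w = 0} ×ˢ (Ioo (-(Γ.ε / 3)) (Γ.ε / 3) ∩ Γ.side a)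
  map_source' w hw := by
    have hε := Γ.ε_pos
    have hw' : |Γ.coord a w| < Γ.ε := by
      have h : |Γ.coord a w| < Γ.ε / 3 := hw
      linarith
    exact ⟨Γ.coord_move a w 0 hw' (by simpa using hε) (Γ.zero_mem a), abs_lt.1 hw,
      Γ.coord_mem a w hw'⟩
  map_target' p hp := by
    have hε := Γ.ε_pos
    have h1 : Γ.coord a p.1 = 0 := hp.1
    have h2 : |p.2| < Γ.ε / 3 := abs_lt.2 hp.2.1
    change |Γ.coord a (Γ.move a p.1 p.2)| < Γ.ε / 3
    rwa [Γ.coord_move a p.1 p.2 (by rw [h1]; simpa using hε) (by linarith) hp.2.2]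
  left_inv' w hw := by
    have hε := Γ.ε_pos
    have hw' : |Γ.coord a w| < Γ.ε := by
      have h : |Γ.coord a w| < Γ.ε / 3 := hw
      linarith
    change Γ.move a (Γ.move a w 0) (Γ.coord a w) = w
    rw [Γ.move_move a w 0 _ hw' (by simpa using hε) (Γ.zero_mem a) hw' (Γ.coord_mem a w hw'),
      Γ.move_coord a w hw']
  right_inv' p hp := by
    have hε := Γ.ε_pos
    have h1 : Γ.coord a p.1 = 0 := hp.1
    have h2 : |p.2| < Γ.ε / 3 := abs_lt.2 hp.2.1
    have h3 : |Γ.coord a p.1| < Γ.ε := by rw [h1]; simpa using hε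
    have h4 := Γ.move_coord a p.1 h3
    rw [h1] at h4
    refine Prod.ext ?_ ?_
    · change Γ.move a (Γ.move a p.1 p.2) 0 = p.1
      rw [Γ.move_move a p.1 p.2 0 h3 (by linarith) hp.2.2 (by simpa using hε) (Γ.zero_mem a), h4]
    · exact Γ.coord_move a p.1 p.2 h3 (by linarith) hp.2.2

/-- There is a metric that is cylindrical along all the collars of a collar system. -/
theorem exists_metric [IsManifold (𝓡∂ 4) ∞ W] [T2Space W] [CompactSpace W] :
    ∃ g : SmoothMetric W, ∀ a,
      Nonempty (CylindricalCollar g {w | Γ.coord a w = 0} (Γ.side a)) := by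
  classical
  obtain ⟨n, e, he, -, hinj⟩ := exists_embedding_euclidean_of_compact (I := 𝓡∂ 4) (M := W)
  have hε := Γ.ε_pos
  -- The collar gets half-width ε/3 because the collapse is complete exactly where it has been set
  -- up to be, on |t| ≤ ε/3.
  refine ⟨immersionMetric (Γ.cylCoord e) (Γ.contMDiff_cylCoord he)
    (Γ.eq_zero_of_coordDiff_cylCoord he hinj), fun a => ⟨⟨Γ.ε / 3, by positivity,
    Γ.collarChart a, Γ.isOpen_collar a _, rfl, ?_, ?_, ?_, ?_⟩⟩⟩
  · intro w hw
    have h1 : Γ.coord a w = 0 := hw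
    refine ⟨?_, Prod.ext ?_ h1⟩
    · change |Γ.coord a w| < Γ.ε / 3
      rw [h1]; simpa using hε
    · have h2 := Γ.move_coord a w (by rw [h1]; simpa using hε)
      rwa [h1] at h2
  · refine ((Γ.contMDiffOn_foot a).mono fun w hw => ?_).prodMk (Γ.smooth_coord a).contMDiffOn
    have h : |Γ.coord a w| < Γ.ε / 3 := hw
    change |Γ.coord a w| < Γ.ε
    linarith
  · refine (Γ.smooth_move a).mono ?_
    rintro ⟨w, s⟩ ⟨h1, h2⟩
    have h3 : Γ.coord a w = 0 := h1
    have h4 : |s| < Γ.ε / 3 := abs_lt.2 h2.1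
    exact Γ.mem_domain (by rw [h3]; simpa using hε) (by linarith) h2.2
  · intro w hw v v'
    change (∑ c, (coordDiff (Γ.cylCoord e c) w).smulRight (coordDiff (Γ.cylCoord e c) w)) v v' =
      coordDiff (Γ.coord a) w v * coordDiff (Γ.coord a) w v' +
      (∑ c, (coordDiff (Γ.cylCoord e c) (Γ.foot a w)).smulRight
        (coordDiff (Γ.cylCoord e c) (Γ.foot a w)))
        (mfderiv (𝓡∂ 4) (𝓡∂ 4) (Γ.foot a) w v) (mfderiv (𝓡∂ 4) (𝓡∂ 4) (Γ.foot a) w v')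
    have hw' : |Γ.coord a w| < Γ.ε / 3 := hw
    have hself : coordDiff (Γ.cylCoord e (Sum.inr a)) w = coordDiff (Γ.coord a) w :=
      Γ.coordDiff_cutCoord_of_lt (by linarith)
    simp only [sum_apply, ContinuousLinearMap.smulRight_apply, smul_apply, smul_eq_mul,
      Γ.coordDiff_cylCoord he hw']
    -- The component t_a contributes dt² at w and nothing at the foot; every other component
    -- contributes equally on both sides.
    rw [← Finset.add_sum_erase _ _ (Finset.mem_univ (Sum.inr a)), hself]
    congr 1
    rw [← Finset.add_sum_erase Finset.univ _ (Finset.mem_univ (Sum.inr a)), if_pos rfl, zero_mul,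
      zero_add]
    refine Finset.sum_congr rfl fun c hc => ?_
    rw [if_neg (Finset.ne_of_mem_erase hc), if_neg (Finset.ne_of_mem_erase hc)]

end Metric

end CollarSystem

/-! ### Inverting the radial cut-off -/

section CutoffRadius

/-- An explicit inverse of `Real.smoothTransition` on `(0, 1)`. -/
def transitionInv (c : ℝ) : ℝ :=
  2 / (Real.log ((1 - c) / c) + 2 + √(Real.log ((1 - c) / c) ^ 2 + 4))

/-- The radius at which the cut-off function takes the value `c`. -/
def cutoffRadius (c : ℝ) : ℝ := (2 - transitionInv c) / 3

lemma add_sqrt_pos (a : ℝ) : 0 < a + √(a ^ 2 + 4) := by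
  have h1 : |a| < √(a ^ 2 + 4) := by
    rw [← Real.sqrt_sq_eq_abs]
    exact Real.sqrt_lt_sqrt (sq_nonneg a) (by linarith)
  linarith [neg_abs_le a]

lemma transitionInv_mem (c : ℝ) : transitionInv c ∈ Ioo (0 : ℝ) 1 := by
  have h := add_sqrt_pos (Real.log ((1 - c) / c))
  unfold transitionInv
  refine ⟨by apply div_pos <;> linarith, ?_⟩
  rw [div_lt_one] <;> linarith

/-- The transition function is 1/(1 + exp(1/x − 1/(1−x))). Solving the resulting quadratic equation
for x gives `transitionInv`, whose explicit form makes the radius a smooth function of the cut-off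
value. -/
lemma smoothTransition_eq_of_mem {x c : ℝ} (hx : x ∈ Ioo (0 : ℝ) 1) (hc : c ∈ Ioo (0 : ℝ) 1) :
    Real.smoothTransition x = c ↔ x⁻¹ - (1 - x)⁻¹ = Real.log ((1 - c) / c) := by
  have hx1 : 0 < 1 - x := by linarith [hx.2]
  have hc1 : 0 < 1 - c := by linarith [hc.2]
  have hc0 := hc.1
  unfold Real.smoothTransition expNegInvGlue
  rw [if_neg (not_le.2 hx.1), if_neg (not_le.2 hx1)]
  have e1 := Real.exp_pos (-x⁻¹)
  have e2 := Real.exp_pos (-(1 - x)⁻¹)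
  rw [div_eq_iff (by positivity)]
  have e3 : Real.exp (x⁻¹ - (1 - x)⁻¹) = Real.exp (-(1 - x)⁻¹) / Real.exp (-x⁻¹) := by
    rw [← Real.exp_sub]; congr 1; ring
  rw [← Real.exp_injective.eq_iff (a := x⁻¹ - (1 - x)⁻¹), Real.exp_log (by positivity), e3,
    div_eq_div_iff e1.ne' hc0.ne']
  constructor <;> intro h <;> linarith

lemma smoothTransition_transitionInv {c : ℝ} (hc : c ∈ Ioo (0 : ℝ) 1) :
    Real.smoothTransition (transitionInv c) = c := by
  rw [smoothTransition_eq_of_mem (transitionInv_mem c) hc]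
  unfold transitionInv
  generalize Real.log ((1 - c) / c) = a
  have h := add_sqrt_pos a
  have h2 : √(a ^ 2 + 4) ^ 2 = a ^ 2 + 4 := Real.sq_sqrt (by positivity)
  generalize √(a ^ 2 + 4) = R at h h2
  have h3 : a + 2 + R ≠ 0 := by linarith
  have h4 : 1 - 2 / (a + 2 + R) = (a + R) / (a + 2 + R) := by
    field_simp
    ring
  rw [h4, inv_div, inv_div]
  field_simp
  nlinarith

lemma transitionInv_smoothTransition {x : ℝ} (hx : x ∈ Ioo (0 : ℝ) 1) :
    transitionInv (Real.smoothTransition x) = x := by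
  have hc : Real.smoothTransition x ∈ Ioo (0 : ℝ) 1 :=
    ⟨Real.smoothTransition.pos_of_pos hx.1, Real.smoothTransition.lt_one_of_lt_one hx.2⟩
  have h1 := (smoothTransition_eq_of_mem hx hc).1 rfl
  have hx0 := hx.1
  have hx1 : 0 < 1 - x := by linarith [hx.2]
  unfold transitionInv
  rw [← h1]
  have h2 : (x⁻¹ - (1 - x)⁻¹) ^ 2 + 4 = ((1 - 2 * (x * (1 - x))) / (x * (1 - x))) ^ 2 := by
    field_simp
    ring
  have h3 : 0 ≤ (1 - 2 * (x * (1 - x))) / (x * (1 - x)) := by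
    apply div_nonneg
    · nlinarith [sq_nonneg (1 - 2 * x)]
    · positivity
  rw [h2, Real.sqrt_sq h3]
  have h4 : x⁻¹ - (1 - x)⁻¹ + 2 + (1 - 2 * (x * (1 - x))) / (x * (1 - x)) = 2 / x := by
    field_simp
    ring
  rw [h4]
  field_simp

lemma cutoffRadius_mem (c : ℝ) : cutoffRadius c ∈ Ioo (1 / 3 : ℝ) (2 / 3) := by
  have h := transitionInv_mem c
  unfold cutoffRadius
  constructor <;> linarith [h.1, h.2]

lemma radialCutoff_cutoffRadius {c : ℝ} (hc : c ∈ Ioo (0 : ℝ) 1) :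
    radialCutoff (cutoffRadius c) = c := by
  unfold radialCutoff cutoffRadius
  rw [show 2 - 3 * ((2 - transitionInv c) / 3) = transitionInv c by ring,
    smoothTransition_transitionInv hc]

lemma cutoffRadius_radialCutoff {r : ℝ} (hr : radialCutoff r ∈ Ioo (0 : ℝ) 1) :
    cutoffRadius (radialCutoff r) = r := by
  have h1 := radialCutoff_pos.1 hr.1
  have h2 := radialCutoff_lt_one.1 hr.2
  unfold radialCutoff cutoffRadius
  rw [transitionInv_smoothTransition ⟨by linarith, by linarith⟩]
  ring

lemma contDiffAt_cutoffRadius {c : ℝ} (hc : c ∈ Ioo (0 : ℝ) 1) :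
    ContDiffAt ℝ ∞ cutoffRadius c := by
  have h1 : 0 < 1 - c := by linarith [hc.2]
  have hlog : ContDiffAt ℝ ∞ (fun c : ℝ => Real.log ((1 - c) / c)) c := by
    refine ContDiffAt.log ?_ (div_pos h1 hc.1).ne'
    exact (contDiffAt_const.sub contDiffAt_id).div contDiffAt_id hc.1.ne'
  unfold cutoffRadius transitionInv
  refine (contDiffAt_const.sub (contDiffAt_const.div ?_ ?_)).div_const 3
  · exact (hlog.add contDiffAt_const).add
      (((hlog.pow 2).add contDiffAt_const).sqrt (by positivity))
  · have := add_sqrt_pos (Real.log ((1 - c) / c))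
    linarith

end CutoffRadius

/-! ### A cut-off translation of the interval (0, 1) -/

/-- A commuting family of motions `c ↦ flow c t s` from time `t` to time `s` on the line, which are
translations well inside `(0, 1)` and the identity near `0` and `1`. -/
structure ShiftFlow (κ : ℝ) where
  ε : ℝ
  ε_pos : 0 < ε
  ε_le : ε ≤ κ / 16
  flow : ℝ → ℝ → ℝ → ℝ
  smooth : ∀ c t s, |t| < ε → ContDiffAt ℝ ∞ (fun q : ℝ × ℝ × ℝ => flow q.1 q.2.1 q.2.2) (c, t, s)
  flow_self : ∀ c t, |t| < ε → flow c t t = c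
  flow_flow : ∀ c t s s', |t| < ε → |s| < ε → flow (flow c t s) s s' = flow c t s'
  flow_of_notMem : ∀ c t s, |t| < ε → |s| < ε → c ∉ Ioo (κ / 4) (1 - κ / 4) → flow c t s = c
  flow_middle : ∀ c t s, |t| < ε → |s| < ε → c ∈ Icc (3 * κ / 4) (1 - 3 * κ / 4) →
    flow c t s = c + (s - t)

namespace ShiftFlow

/-- The speed of the motion. -/
def speed (κ c : ℝ) : ℝ :=
  Real.smoothTransition ((c - κ / 4) / (κ / 4)) * Real.smoothTransition ((1 - κ / 4 - c) / (κ / 4))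

lemma contDiff_speed (κ : ℝ) : ContDiff ℝ ∞ (speed κ) :=
  ((Real.smoothTransition.contDiff (n := ⊤)).comp
    (by fun_prop : ContDiff ℝ ∞ fun c : ℝ => (c - κ / 4) / (κ / 4))).mul
  ((Real.smoothTransition.contDiff (n := ⊤)).comp
    (by fun_prop : ContDiff ℝ ∞ fun c : ℝ => (1 - κ / 4 - c) / (κ / 4)))

lemma speed_mem (κ c : ℝ) : speed κ c ∈ Icc (0 : ℝ) 1 :=
  ⟨mul_nonneg (Real.smoothTransition.nonneg _) (Real.smoothTransition.nonneg _),
    mul_le_one₀ (Real.smoothTransition.le_one _) (Real.smoothTransition.nonneg _)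
      (Real.smoothTransition.le_one _)⟩

variable {κ : ℝ} (hκ : 0 < κ)
include hκ

lemma speed_of_notMem {c : ℝ} (hc : c ∉ Ioo (κ / 4) (1 - κ / 4)) : speed κ c = 0 := by
  by_cases h : κ / 4 < c
  · have h2 : 1 - κ / 4 ≤ c := by
      by_contra h2
      exact hc ⟨h, not_le.1 h2⟩
    unfold speed
    rw [Real.smoothTransition.zero_of_nonpos (x := (1 - κ / 4 - c) / (κ / 4)), mul_zero]
    exact div_nonpos_of_nonpos_of_nonneg (by linarith) (by linarith)
  · unfold speed
    rw [Real.smoothTransition.zero_of_nonpos (x := (c - κ / 4) / (κ / 4)), zero_mul]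
    exact div_nonpos_of_nonpos_of_nonneg (by linarith) (by linarith)

lemma speed_of_mem {c : ℝ} (hc : c ∈ Icc (κ / 2) (1 - κ / 2)) : speed κ c = 1 := by
  unfold speed
  rw [Real.smoothTransition.one_of_one_le, Real.smoothTransition.one_of_one_le, mul_one]
  · rw [one_le_div (by positivity)]; linarith [hc.2]
  · rw [one_le_div (by positivity)]; linarith [hc.1]

lemma exists_bound_deriv_speed : ∃ K > 0, ∀ c, |deriv (speed κ) c| ≤ K := by
  have hcs : HasCompactSupport (speed κ) :=
    HasCompactSupport.intro (isCompact_Icc (a := κ / 4) (b := 1 - κ / 4)) fun c hc =>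
      speed_of_notMem hκ fun h => hc ⟨h.1.le, h.2.le⟩
  have hcont : Continuous (deriv (speed κ)) :=
    (contDiff_speed κ).continuous_deriv (by norm_num)
  obtain ⟨K, hK⟩ := hcont.bounded_above_of_compact_support hcs.deriv
  exact ⟨max K 1, by positivity, fun c => (hK c).trans (le_max_left _ _)⟩

omit hκ in
lemma hasDerivAt_motion (t c : ℝ) :
    HasDerivAt (fun c => c + speed κ c * t) (1 + deriv (speed κ) c * t) c :=
  (hasDerivAt_id c).add
    ((((contDiff_speed κ).differentiable (by norm_num) c).hasDerivAt).mul_const t)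

omit hκ in
-- Each starting point c moves with its own constant speed, along c + speed(c)·t. While |t| times
-- the slope of the speed is at most 1/2, the paths do not cross. So the motion from time t to s can
-- go back to the start and out again, and the composition law is automatic.
lemma strictMono_motion {ε : ℝ} (hε : ∀ c, |deriv (speed κ) c| * ε ≤ 1 / 2) {t : ℝ}
    (ht : |t| < ε) : StrictMono fun c => c + speed κ c * t := by
  refine strictMono_of_deriv_pos fun c => ?_
  rw [(hasDerivAt_motion t c).deriv]
  have h1 : |deriv (speed κ) c * t| ≤ 1 / 2 := by
    rw [abs_mul]
    exact (mul_le_mul_of_nonneg_left ht.le (abs_nonneg _)).trans (hε c)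
  linarith [neg_abs_le (deriv (speed κ) c * t)]

omit hκ in
lemma exists_motion_eq (c t : ℝ) : ∃ c₀, c₀ + speed κ c₀ * t = c := by
  have hcont : Continuous fun c => c + speed κ c * t :=
    continuous_id.add ((contDiff_speed κ).continuous.mul continuous_const)
  have hb : ∀ c₀, |speed κ c₀ * t| ≤ |t| := fun c₀ => by
    rw [abs_mul, abs_of_nonneg (speed_mem κ c₀).1]
    exact mul_le_of_le_one_left (abs_nonneg t) (speed_mem κ c₀).2
  have h := intermediate_value_Icc (a := c - |t|) (b := c + |t|)
    (by linarith [abs_nonneg t]) hcont.continuousOn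
  obtain ⟨c₀, -, h₀⟩ := h (show c ∈ _ from
    ⟨by linarith [le_abs_self (speed κ (c - |t|) * t), hb (c - |t|)],
      by linarith [neg_abs_le (speed κ (c + |t|) * t), hb (c + |t|)]⟩)
  exact ⟨c₀, h₀⟩

/-- The starting point of the motion that reaches `c` at time `t`. -/
def start (κ c t : ℝ) : ℝ := (exists_motion_eq (κ := κ) c t).choose

omit hκ in
lemma start_spec (c t : ℝ) : start κ c t + speed κ (start κ c t) * t = c :=
  (exists_motion_eq (κ := κ) c t).choose_spec

omit hκ in
lemma start_eq {ε : ℝ} (hε : ∀ c, |deriv (speed κ) c| * ε ≤ 1 / 2) {c₀ c t : ℝ}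
    (ht : |t| < ε) (h : c₀ + speed κ c₀ * t = c) : start κ c t = c₀ :=
  (strictMono_motion hε ht).injective ((start_spec c t).trans h.symm)

omit hκ in
-- Inverse function theorem for (c, t) ↦ (c + speed(c) t, t), whose differential is triangular with
-- positive diagonal. By injectivity the local inverse agrees with the globally chosen start.
lemma contDiffAt_start {ε : ℝ} (hε : ∀ c, |deriv (speed κ) c| * ε ≤ 1 / 2) {c t : ℝ}
    (ht : |t| < ε) : ContDiffAt ℝ ∞ (fun q : ℝ × ℝ => start κ q.1 q.2) (c, t) := by
  set c₀ := start κ c t with hc₀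
  set G : ℝ × ℝ → ℝ × ℝ := fun q => (q.1 + speed κ q.1 * q.2, q.2) with hG
  have hGs : ContDiff ℝ ∞ G := by
    have := contDiff_speed κ
    exact (contDiff_fst.add ((this.comp contDiff_fst).mul contDiff_snd)).prodMk contDiff_snd
  set α := 1 + deriv (speed κ) c₀ * t with hα
  set β := speed κ c₀ with hβ
  have hαpos : 0 < α := by
    have h1 : |deriv (speed κ) c₀ * t| ≤ 1 / 2 := by
      rw [abs_mul]
      exact (mul_le_mul_of_nonneg_left ht.le (abs_nonneg _)).trans (hε c₀)
    linarith [neg_abs_le (deriv (speed κ) c₀ * t)]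
  set fs := ContinuousLinearMap.fst ℝ ℝ ℝ
  set sn := ContinuousLinearMap.snd ℝ ℝ ℝ
  set G' : (ℝ × ℝ) ≃L[ℝ] (ℝ × ℝ) := ContinuousLinearEquiv.equivOfInverse
    ((α • fs + β • sn).prod sn) ((α⁻¹ • (fs - β • sn)).prod sn)
    (by
      rintro ⟨a, b⟩
      simp [fs, sn]
      field_simp)
    (by
      rintro ⟨a, b⟩
      simp [fs, sn]
      field_simp
      ring) with hG'
  have hGd : HasFDerivAt G (G' : ℝ × ℝ →L[ℝ] ℝ × ℝ) (c₀, t) := by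
    have h1 : HasFDerivAt (fun q : ℝ × ℝ => speed κ q.1) (deriv (speed κ) c₀ • fs) (c₀, t) :=
      HasDerivAt.comp_hasFDerivAt (f := Prod.fst) ((c₀, t) : ℝ × ℝ)
        (((contDiff_speed κ).differentiable (by norm_num) c₀).hasDerivAt) hasFDerivAt_fst
    have h2 := (hasFDerivAt_fst (𝕜 := ℝ) (p := (c₀, t))).add (h1.mul hasFDerivAt_snd)
    refine (h2.prodMk hasFDerivAt_snd).congr_fderiv ?_
    ext <;> simp [hG', fs, sn, hα, hβ]
    ring
  have hGc : G (c₀, t) = (c, t) := by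
    simp only [hG, Prod.mk.injEq, and_true]
    exact start_spec c t
  have hn : (∞ : WithTop ℕ∞) ≠ 0 := by norm_num
  have hinv := hGs.contDiffAt.to_localInverse hGd hn
  have hright := (hGs.contDiffAt.hasStrictFDerivAt' hGd hn).eventually_right_inverse
  rw [hGc] at hinv hright
  refine (contDiff_fst.contDiffAt.comp (c, t) hinv).congr_of_eventuallyEq ?_
  have hopen : IsOpen {q : ℝ × ℝ | |q.2| < ε} := isOpen_lt continuous_snd.abs continuous_const
  filter_upwards [hright, hopen.mem_nhds (show (c, t) ∈ {q : ℝ × ℝ | |q.2| < ε} from ht)]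
    with q hq hqt
  set r := (hGs.contDiffAt.hasStrictFDerivAt' hGd hn).localInverse G G' (c₀, t) q with hr
  have hq' : G r = q := hq
  have h1 : (G r).1 = q.1 := congrArg Prod.fst hq'
  have h2 : (G r).2 = q.2 := congrArg Prod.snd hq'
  change r.1 + speed κ r.1 * r.2 = q.1 at h1
  change r.2 = q.2 at h2
  rw [h2] at h1
  exact start_eq hε hqt h1

lemma nonempty : Nonempty (ShiftFlow κ) := by
  obtain ⟨K, hK, hKb⟩ := exists_bound_deriv_speed hκ
  -- The bound 1/(2K) keeps the paths from crossing; κ/16 keeps the motions small compared with the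
  -- distance of the levels.
  set ε := min (κ / 16) (1 / (2 * K)) with hεd
  have hε0 : 0 < ε := by positivity
  have hεκ : ε ≤ κ / 16 := min_le_left _ _
  have hε : ∀ c, |deriv (speed κ) c| * ε ≤ 1 / 2 := fun c => by
    calc |deriv (speed κ) c| * ε ≤ K * (1 / (2 * K)) :=
          mul_le_mul (hKb c) (min_le_right _ _) hε0.le hK.le
      _ = 1 / 2 := by field_simp
  refine ⟨⟨ε, hε0, hεκ, fun c t s => start κ c t + speed κ (start κ c t) * s, ?_, ?_, ?_, ?_,
    ?_⟩⟩
  · intro c t s ht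
    have h1 : ContDiffAt ℝ ∞ (fun q : ℝ × ℝ × ℝ => start κ q.1 q.2.1) (c, t, s) :=
      (contDiffAt_start hε ht).comp (c, t, s)
        (f := fun q : ℝ × ℝ × ℝ => (q.1, q.2.1)) (by fun_prop)
    exact h1.add (((contDiff_speed κ).contDiffAt.comp _ h1).mul (by fun_prop))
  · intro c t _
    exact start_spec c t
  · intro c t s s' _ hs
    have : start κ (start κ c t + speed κ (start κ c t) * s) s = start κ c t :=
      start_eq hε hs rfl
    simp only [this]
  · intro c t s ht _ hc
    have h0 := speed_of_notMem hκ hc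
    have : start κ c t = c := start_eq hε ht (by rw [h0]; ring)
    simp only [this, h0]
    ring
  · intro c t s ht _ hc
    have ht' := abs_lt.1 (ht.trans_le hεκ)
    -- The start c − t is within κ/16 of the middle range, hence still in the region of speed 1.
    have h0 : speed κ (c - t) = 1 :=
      speed_of_mem hκ ⟨by linarith [hc.1, ht'.2], by linarith [hc.2, ht'.1]⟩
    have : start κ c t = c - t := start_eq hε ht (by rw [h0]; ring)
    simp only [this, h0]
    ring

end ShiftFlow

/-- Points outside (κ/4, 1 − κ/4) are fixed and the motion is invertible, so no point can leave that
interval. -/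
lemma ShiftFlow.flow_mem {κ : ℝ} (hκ : 0 < κ) (Λ : ShiftFlow κ) {c t s : ℝ} (ht : |t| < Λ.ε)
    (hs : |s| < Λ.ε) (hc : c ∈ Ioo (0 : ℝ) 1) : Λ.flow c t s ∈ Ioo (0 : ℝ) 1 := by
  by_cases h : c ∈ Ioo (κ / 4) (1 - κ / 4)
  · have h2 : Λ.flow c t s ∈ Ioo (κ / 4) (1 - κ / 4) := by
      by_contra h2
      have h3 := Λ.flow_of_notMem _ s t hs ht h2
      rw [Λ.flow_flow c t s t ht hs, Λ.flow_self c t ht] at h3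
      exact h2 (h3 ▸ h)
    exact ⟨by linarith [h2.1], by linarith [h2.2]⟩
  · rwa [Λ.flow_of_notMem c t s ht hs h]

/-! ### Radial slides in the tubes of the link -/

/-- The direction in which the motion along the wall of `I` changes the `i`-th cut-off function. -/
def wallSign {l : ℕ} (I : Finset (Fin l)) (i : Fin l) : ℝ := if i ∈ I then -1 else 1

lemma abs_wallSign_mul {l : ℕ} (I : Finset (Fin l)) (i : Fin l) (t : ℝ) :
    |wallSign I i * t| = |t| := by
  unfold wallSign
  split_ifs <;> simp

namespace FramedLink

variable {l : ℕ} {Y : Type*} [TopologicalSpace Y] [ChartedSpace (EuclideanSpace ℝ (Fin 3)) Y]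
  (L : FramedLink l Y)

lemma mem_tube_of_bump_pos {i : Fin l} {z : Y} (h : 0 < L.bump i z) : z ∈ (L.tube i).target := by
  by_contra hz
  rw [L.bump_of_notMem hz] at h
  exact h.false

/-- The point on the same ray of the `i`-th tube at which the cut-off function is `c`. -/
def annulusMove (i : Fin l) (z : Y) (c : ℝ) : Y :=
  L.tube i (((L.tube i).symm z).1,
    (cutoffRadius c / ‖((L.tube i).symm z).2‖) • ((L.tube i).symm z).2)

lemma annulusMove_tube {i : Fin l} {u : Circle} {ζ : ℂ} (h : ‖ζ‖ < 1) (c : ℝ) :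
    L.annulusMove i (L.tube i (u, ζ)) c = L.tube i (u, (cutoffRadius c / ‖ζ‖) • ζ) := by
  rw [annulusMove, (L.tube i).left_inv (L.mem_tube_source.2 h)]

lemma norm_cutoffRadius_smul {ζ : ℂ} (h : ζ ≠ 0) (c : ℝ) :
    ‖(cutoffRadius c / ‖ζ‖) • ζ‖ = cutoffRadius c := by
  have h1 := (cutoffRadius_mem c).1
  have h2 := norm_pos_iff.2 h
  rw [norm_smul, Real.norm_of_nonneg (div_nonneg (by linarith) h2.le), div_mul_cancel₀ _ h2.ne']

lemma exists_of_bump_mem {i : Fin l} {z : Y} (h : L.bump i z ∈ Ioo (0 : ℝ) 1) :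
    ∃ u ζ, ζ ≠ 0 ∧ ‖ζ‖ < 1 ∧ z = L.tube i (u, ζ) ∧ L.bump i z = radialCutoff ‖ζ‖ := by
  obtain ⟨u, ζ, hζ, rfl⟩ := L.exists_of_mem_tube (L.mem_tube_of_bump_pos h.1)
  refine ⟨u, ζ, ?_, hζ, rfl, L.bump_tube hζ⟩
  rintro rfl
  rw [L.bump_tube hζ, norm_zero, radialCutoff_of_le (by norm_num)] at h
  exact h.2.false

lemma bump_annulusMove {i : Fin l} {z : Y} (h : L.bump i z ∈ Ioo (0 : ℝ) 1) {c : ℝ}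
    (hc : c ∈ Ioo (0 : ℝ) 1) : L.bump i (L.annulusMove i z c) = c := by
  obtain ⟨u, ζ, h0, hζ, rfl, hb⟩ := L.exists_of_bump_mem h
  have h1 := norm_cutoffRadius_smul h0 c
  rw [L.annulusMove_tube hζ, L.bump_tube (by rw [h1]; linarith [(cutoffRadius_mem c).2]), h1,
    radialCutoff_cutoffRadius hc]

lemma annulusMove_annulusMove {i : Fin l} {z : Y} (h : L.bump i z ∈ Ioo (0 : ℝ) 1) (c c' : ℝ) :
    L.annulusMove i (L.annulusMove i z c) c' = L.annulusMove i z c' := by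
  obtain ⟨u, ζ, h0, hζ, rfl, hb⟩ := L.exists_of_bump_mem h
  have h1 := norm_cutoffRadius_smul h0 c
  rw [L.annulusMove_tube hζ, L.annulusMove_tube hζ,
    L.annulusMove_tube (by rw [h1]; linarith [(cutoffRadius_mem c).2]), h1, smul_smul]
  congr 3
  have := (cutoffRadius_mem c).1
  have h2 : cutoffRadius c ≠ 0 := by linarith
  field_simp

lemma annulusMove_self {i : Fin l} {z : Y} (h : L.bump i z ∈ Ioo (0 : ℝ) 1) :
    L.annulusMove i z (L.bump i z) = z := by
  obtain ⟨u, ζ, h0, hζ, rfl, hb⟩ := L.exists_of_bump_mem h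
  rw [hb] at h
  rw [hb, L.annulusMove_tube hζ, cutoffRadius_radialCutoff h, div_self (norm_ne_zero_iff.2 h0),
    one_smul]

lemma annulusMove_mem_tube {i : Fin l} {z : Y} (h : L.bump i z ∈ Ioo (0 : ℝ) 1) (c : ℝ) :
    L.annulusMove i z c ∈ (L.tube i).target := by
  obtain ⟨u, ζ, h0, hζ, rfl, hb⟩ := L.exists_of_bump_mem h
  rw [L.annulusMove_tube hζ]
  exact L.tube_mem (by rw [norm_cutoffRadius_smul h0]; linarith [(cutoffRadius_mem c).2])

variable {κ : ℝ} (Λ : ShiftFlow κ) (I : Finset (Fin l))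

/-- The motion in `Y` that goes with the motion along the wall of `I`. -/
def slide (z : Y) (t s : ℝ) : Y :=
  open Classical in
  if h : ∃ i, L.bump i z ∈ Ioo (0 : ℝ) 1 then
    L.annulusMove h.choose z (Λ.flow (L.bump h.choose z) (wallSign I h.choose * t)
      (wallSign I h.choose * s))
  else z

lemma slide_of_mem {i : Fin l} {z : Y} (h : L.bump i z ∈ Ioo (0 : ℝ) 1) (t s : ℝ) :
    L.slide Λ I z t s = L.annulusMove i z (Λ.flow (L.bump i z) (wallSign I i * t)
      (wallSign I i * s)) := by
  have hex : ∃ i, L.bump i z ∈ Ioo (0 : ℝ) 1 := ⟨i, h⟩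
  have hi : hex.choose = i := L.eq_of_mem_tube (L.mem_tube_of_bump_pos hex.choose_spec.1)
    (L.mem_tube_of_bump_pos h.1)
  rw [slide, dif_pos hex, hi]

lemma slide_of_forall_notMem {z : Y} (h : ∀ i, L.bump i z ∉ Ioo (0 : ℝ) 1) (t s : ℝ) :
    L.slide Λ I z t s = z :=
  dif_neg (not_exists.2 h)

variable {Λ I} {t s : ℝ} (hκ : 0 < κ) (ht : |t| < Λ.ε) (hs : |s| < Λ.ε)

lemma wallSign_mul_lt {i : Fin l} (ht : |t| < Λ.ε) : |wallSign I i * t| < Λ.ε := by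
  rwa [abs_wallSign_mul]

include hκ ht hs

lemma bump_slide {i : Fin l} {z : Y} (h : z ∈ (L.tube i).target) :
    L.bump i (L.slide Λ I z t s) =
      Λ.flow (L.bump i z) (wallSign I i * t) (wallSign I i * s) := by
  by_cases hb : L.bump i z ∈ Ioo (0 : ℝ) 1
  · rw [L.slide_of_mem Λ I hb, L.bump_annulusMove hb
      (Λ.flow_mem hκ (wallSign_mul_lt ht) (wallSign_mul_lt hs) hb)]
  · rw [L.slide_of_forall_notMem, Λ.flow_of_notMem _ _ _ (wallSign_mul_lt ht) (wallSign_mul_lt hs)]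
    · intro h'
      exact hb ⟨by linarith [h'.1], by linarith [h'.2]⟩
    · intro j hj
      have := L.eq_of_mem_tube h (L.mem_tube_of_bump_pos hj.1)
      subst this
      exact hb hj

omit hκ ht hs in
lemma slide_mem_tube {i : Fin l} {z : Y} (h : z ∈ (L.tube i).target) :
    L.slide Λ I z t s ∈ (L.tube i).target := by
  by_cases hb : L.bump i z ∈ Ioo (0 : ℝ) 1
  · rw [L.slide_of_mem Λ I hb]
    exact L.annulusMove_mem_tube hb _
  · rw [L.slide_of_forall_notMem]
    · exact h
    · intro j hj
      have := L.eq_of_mem_tube h (L.mem_tube_of_bump_pos hj.1)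
      subst this
      exact hb hj

omit hκ hs in
lemma slide_self (z : Y) : L.slide Λ I z t t = z := by
  by_cases h : ∃ i, L.bump i z ∈ Ioo (0 : ℝ) 1
  · obtain ⟨i, hi⟩ := h
    rw [L.slide_of_mem Λ I hi, Λ.flow_self _ _ (wallSign_mul_lt ht), L.annulusMove_self hi]
  · exact L.slide_of_forall_notMem Λ I (not_exists.1 h) t t

lemma slide_slide (z : Y) (s' : ℝ) :
    L.slide Λ I (L.slide Λ I z t s) s s' = L.slide Λ I z t s' := by
  by_cases h : ∃ i, L.bump i z ∈ Ioo (0 : ℝ) 1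
  · obtain ⟨i, hi⟩ := h
    have hm := Λ.flow_mem hκ (wallSign_mul_lt (I := I) (i := i) ht)
      (wallSign_mul_lt (I := I) (i := i) hs) hi
    have hb := L.bump_annulusMove hi hm
    rw [L.slide_of_mem Λ I hi, L.slide_of_mem Λ I hi, L.slide_of_mem Λ I (hb.symm ▸ hm), hb,
      Λ.flow_flow _ _ _ _ (wallSign_mul_lt ht) (wallSign_mul_lt hs),
      L.annulusMove_annulusMove hi]
  · rw [L.slide_of_forall_notMem Λ I (not_exists.1 h), L.slide_of_forall_notMem Λ I
      (not_exists.1 h), L.slide_of_forall_notMem Λ I (not_exists.1 h)]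

/-- A point that is slid ends at a radius greater than 1/3, so only unmoved points can lie on the
link. -/
lemma slide_of_mem_carrier {z : Y} (h : L.slide Λ I z t s ∈ L.carrier) :
    L.slide Λ I z t s = z := by
  by_cases hz : ∃ i, L.bump i z ∈ Ioo (0 : ℝ) 1
  · obtain ⟨i, hi⟩ := hz
    have hm := Λ.flow_mem hκ (wallSign_mul_lt (I := I) (i := i) ht)
      (wallSign_mul_lt (I := I) (i := i) hs) hi
    rw [L.slide_of_mem Λ I hi] at h
    obtain ⟨u, ζ, h0, hζ, hz, -⟩ := L.exists_of_bump_mem hi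
    have h1 := norm_cutoffRadius_smul h0
      (Λ.flow (L.bump i z) (wallSign I i * t) (wallSign I i * s))
    have h2 := cutoffRadius_mem (Λ.flow (L.bump i z) (wallSign I i * t) (wallSign I i * s))
    generalize Λ.flow (L.bump i z) (wallSign I i * t) (wallSign I i * s) = c at h h1 h2
    rw [hz, L.annulusMove_tube hζ, L.mem_carrier_tube (by rw [h1]; linarith [h2.2])] at h
    rw [h, norm_zero] at h1
    linarith [h2.1]
  · exact L.slide_of_forall_notMem Λ I (not_exists.1 hz) t s

/-- In an open annulus the slide is a composition of smooth maps. At a point where no cut-off lies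
strictly between 0 and 1 it is the identity nearby, because the flow fixes values close to 0 and 1.
-/
lemma contMDiffAt_slide [T2Space Y] (z : Y) :
    ContMDiffAt ((𝓡 3).prod 𝓘(ℝ, ℝ × ℝ)) (𝓡 3) ∞
      (fun q : Y × (ℝ × ℝ) => L.slide Λ I q.1 q.2.1 q.2.2) (z, t, s) := by
  by_cases h : ∃ i, L.bump i z ∈ Ioo (0 : ℝ) 1
  · obtain ⟨i, hi⟩ := h
    have hzt := L.mem_tube_of_bump_pos hi.1
    have hm := Λ.flow_mem hκ (wallSign_mul_lt (I := I) (i := i) ht)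
      (wallSign_mul_lt (I := I) (i := i) hs) hi
    have hfst : ContMDiffAt ((𝓡 3).prod 𝓘(ℝ, ℝ × ℝ)) (𝓡 3) ∞
      (fun q : Y × (ℝ × ℝ) => q.1) (z, t, s) := contMDiffAt_fst
    have hsnd : ContMDiffAt ((𝓡 3).prod 𝓘(ℝ, ℝ × ℝ)) 𝓘(ℝ, ℝ × ℝ) ∞
      (fun q : Y × (ℝ × ℝ) => q.2) (z, t, s) := contMDiffAt_snd
    have hb : ContMDiffAt ((𝓡 3).prod 𝓘(ℝ, ℝ × ℝ)) 𝓘(ℝ, ℝ) ∞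
        (fun q : Y × (ℝ × ℝ) => L.bump i q.1) (z, t, s) :=
      (L.contMDiff_bump i).contMDiffAt.comp (z, t, s) hfst
    have hflow : ContMDiffAt ((𝓡 3).prod 𝓘(ℝ, ℝ × ℝ)) 𝓘(ℝ, ℝ) ∞
        (fun q : Y × (ℝ × ℝ) => Λ.flow (L.bump i q.1) (wallSign I i * q.2.1)
          (wallSign I i * q.2.2)) (z, t, s) := by
      have h1 : ContDiff ℝ ∞ (fun r : ℝ × ℝ => (wallSign I i * r.1, wallSign I i * r.2)) := by
        fun_prop
      have h2 := hb.prodMk_space (h1.contMDiff.contMDiffAt.comp (z, t, s) hsnd)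
      exact (Λ.smooth (L.bump i z) _ (wallSign I i * s)
        (wallSign_mul_lt ht)).contMDiffAt.comp (z, t, s) h2
    have hR : ContMDiffAt ((𝓡 3).prod 𝓘(ℝ, ℝ × ℝ)) 𝓘(ℝ, ℝ) ∞
        (fun q : Y × (ℝ × ℝ) => cutoffRadius (Λ.flow (L.bump i q.1) (wallSign I i * q.2.1)
          (wallSign I i * q.2.2))) (z, t, s) :=
      (contDiffAt_cutoffRadius hm).contMDiffAt.comp (z, t, s) hflow
    have hsymm : ContMDiffAt ((𝓡 3).prod 𝓘(ℝ, ℝ × ℝ)) ((𝓡 1).prod 𝓘(ℝ, ℂ)) ∞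
        (fun q : Y × (ℝ × ℝ) => (L.tube i).symm q.1) (z, t, s) :=
      ((L.smooth_tube_symm i z hzt).contMDiffAt ((L.tube i).open_target.mem_nhds hzt)).comp
        (z, t, s) hfst
    obtain ⟨u, ζ, h0, hζ, hz, -⟩ := L.exists_of_bump_mem hi
    have hzs : (L.tube i).symm z = (u, ζ) := by
      rw [hz, (L.tube i).left_inv (L.mem_tube_source.2 hζ)]
    have hζs : ContMDiffAt ((𝓡 3).prod 𝓘(ℝ, ℝ × ℝ)) 𝓘(ℝ, ℂ) ∞
        (fun q : Y × (ℝ × ℝ) => ((L.tube i).symm q.1).2) (z, t, s) :=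
      contMDiffAt_snd.comp (z, t, s) hsymm
    have hus : ContMDiffAt ((𝓡 3).prod 𝓘(ℝ, ℝ × ℝ)) (𝓡 1) ∞
        (fun q : Y × (ℝ × ℝ) => ((L.tube i).symm q.1).1) (z, t, s) :=
      contMDiffAt_fst.comp (z, t, s) hsymm
    have hscale : ContDiffAt ℝ ∞ (fun r : ℝ × ℂ => (r.1 / ‖r.2‖) • r.2)
        (cutoffRadius (Λ.flow (L.bump i z) (wallSign I i * t) (wallSign I i * s)), ζ) := by
      have hn : ContDiffAt ℝ ∞ (fun r : ℝ × ℂ => ‖r.2‖)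
          (cutoffRadius (Λ.flow (L.bump i z) (wallSign I i * t) (wallSign I i * s)), ζ) :=
        ContDiffAt.comp _ (contDiffAt_norm ℝ h0) contDiffAt_snd
      have h0' : ‖ζ‖ ≠ 0 := norm_ne_zero_iff.2 h0
      exact ContDiffAt.smul (contDiffAt_fst.div hn h0') contDiffAt_snd
    have hζ' : ContMDiffAt ((𝓡 3).prod 𝓘(ℝ, ℝ × ℝ)) 𝓘(ℝ, ℂ) ∞
        (fun q : Y × (ℝ × ℝ) => (cutoffRadius (Λ.flow (L.bump i q.1) (wallSign I i * q.2.1)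
          (wallSign I i * q.2.2)) / ‖((L.tube i).symm q.1).2‖) • ((L.tube i).symm q.1).2)
        (z, t, s) :=
      ContMDiffAt.comp_of_eq (x := (z, t, s)) hscale.contMDiffAt (hR.prodMk_space hζs)
        (by simp only [hzs])
    have hpair := hus.prodMk hζ'
    have hsrc : (u, (cutoffRadius (Λ.flow (L.bump i z) (wallSign I i * t) (wallSign I i * s)) /
        ‖ζ‖) • ζ) ∈ (L.tube i).source :=
      L.mem_tube_source.2 (by
        rw [norm_cutoffRadius_smul h0]
        linarith [(cutoffRadius_mem (Λ.flow (L.bump i z) (wallSign I i * t)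
          (wallSign I i * s))).2])
    have htube := (L.smooth_tube i _ hsrc).contMDiffAt ((L.tube i).open_source.mem_nhds hsrc)
    have hfin := ContMDiffAt.comp_of_eq (x := (z, t, s)) htube hpair (by simp only [hzs])
    refine hfin.congr_of_eventuallyEq ?_
    have hev : ∀ᶠ q : Y × (ℝ × ℝ) in 𝓝 (z, t, s), L.bump i q.1 ∈ Ioo (0 : ℝ) 1 :=
      hb.continuousAt.preimage_mem_nhds (Ioo_mem_nhds hi.1 hi.2)
    filter_upwards [hev] with q hq
    exact L.slide_of_mem Λ I hq _ _
  · push Not at h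
    have hfst : ContMDiffAt ((𝓡 3).prod 𝓘(ℝ, ℝ × ℝ)) (𝓡 3) ∞
      (fun q : Y × (ℝ × ℝ) => q.1) (z, t, s) := contMDiffAt_fst
    refine hfst.congr_of_eventuallyEq ?_
    -- The closed annuli carrying all actual motion. Being compact they are closed in Y, and they
    -- miss z.
    have hK : ∀ i, IsCompact (L.tube i '' (univ ×ˢ
        {ζ : ℂ | radialCutoff ‖ζ‖ ∈ Icc (κ / 4) (1 - κ / 4)})) := by
      intro i
      have hsub : ∀ ζ ∈ {ζ : ℂ | radialCutoff ‖ζ‖ ∈ Icc (κ / 4) (1 - κ / 4)}, ‖ζ‖ < 2 / 3 :=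
        fun ζ hζ => radialCutoff_pos.1 (lt_of_lt_of_le (by positivity) hζ.1)
      refine L.isCompact_image_tube i ?_ fun ζ hζ => by linarith [hsub ζ hζ]
      refine (isCompact_closedBall (0 : ℂ) (2 / 3)).of_isClosed_subset ?_ fun ζ hζ => ?_
      · exact isClosed_Icc.preimage contDiff_radialCutoff_norm.continuous
      · exact mem_closedBall_zero_iff.2 (hsub ζ hζ).le
    have hzK : z ∈ (⋃ i, L.tube i '' (univ ×ˢ
        {ζ : ℂ | radialCutoff ‖ζ‖ ∈ Icc (κ / 4) (1 - κ / 4)}))ᶜ := by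
      intro hz
      obtain ⟨i, ⟨u, ζ⟩, hζ, rfl⟩ := mem_iUnion.1 hz
      have hζ2 : radialCutoff ‖ζ‖ ∈ Icc (κ / 4) (1 - κ / 4) := hζ.2
      have h1 : ‖ζ‖ < 2 / 3 := radialCutoff_pos.1 (lt_of_lt_of_le (by positivity) hζ2.1)
      apply h i
      rw [L.bump_tube (by linarith)]
      exact ⟨by linarith [hζ2.1], by linarith [hζ2.2]⟩
    have hopen : IsOpen (⋃ i, L.tube i '' (univ ×ˢ
        {ζ : ℂ | radialCutoff ‖ζ‖ ∈ Icc (κ / 4) (1 - κ / 4)}))ᶜ :=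
      (isCompact_iUnion hK).isClosed.isOpen_compl
    have ht' : ∀ᶠ q : Y × (ℝ × ℝ) in 𝓝 (z, t, s), |q.2.1| < Λ.ε :=
      (isOpen_lt (by fun_prop) continuous_const).mem_nhds (show |t| < Λ.ε from ht)
    have hs' : ∀ᶠ q : Y × (ℝ × ℝ) in 𝓝 (z, t, s), |q.2.2| < Λ.ε :=
      (isOpen_lt (by fun_prop) continuous_const).mem_nhds (show |s| < Λ.ε from hs)
    filter_upwards [hfst.continuousAt.preimage_mem_nhds (hopen.mem_nhds hzK), ht', hs']
      with q hq hqt hqs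
    by_cases hqb : ∃ i, L.bump i q.1 ∈ Ioo (0 : ℝ) 1
    · obtain ⟨i, hi⟩ := hqb
      obtain ⟨u, ζ, h0, hζ, hz, hbz⟩ := L.exists_of_bump_mem hi
      rw [L.slide_of_mem Λ I hi, Λ.flow_of_notMem _ _ _ (wallSign_mul_lt hqt)
        (wallSign_mul_lt hqs), L.annulusMove_self hi]
      intro hmem
      rw [hbz] at hmem
      exact hq (mem_iUnion.2 ⟨i, (u, ζ), ⟨mem_univ _, ⟨hmem.1.le, hmem.2.le⟩⟩, hz.symm⟩)
    · exact L.slide_of_forall_notMem Λ I (not_exists.1 hqb) _ _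

end FramedLink

/-! ### The hyperbolic flow on a handle -/

section HandleMove

/-- The factor by which the cocore direction of a handle has to be stretched to reach the
height `h` along the hyperbolic flow. -/
def handleScale (p : ℂ × ℂ) (h : ℝ) : ℝ :=
  (h + √(h ^ 2 + 4 * ‖p.1‖ ^ 2 * ‖p.2‖ ^ 2)) / (2 * ‖p.2‖ ^ 2)

/-- The point of height `h` on a line of the hyperbolic flow of a handle. -/
def handleMove (p : ℂ × ℂ) (h : ℝ) : ℂ × ℂ :=
  ((√(handleScale p h))⁻¹ • p.1, √(handleScale p h) • p.2)

variable {p : ℂ × ℂ} {h : ℝ}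

lemma handleScale_pos (hp : p.2 ≠ 0) (hh : 0 < h) : 0 < handleScale p h := by
  have h1 := norm_pos_iff.2 hp
  unfold handleScale
  positivity

/-- The scale E is the positive root of ‖y‖²E² − hE − ‖x‖² = 0. Hence (x/√E, √E y) has height h and
the same product xy, that is, the same base point in the tube. -/
lemma handleScale_spec (hp : p.2 ≠ 0) (hh : 0 < h) :
    handleScale p h * ‖p.2‖ ^ 2 - ‖p.1‖ ^ 2 / handleScale p h = h := by
  have h1 := norm_pos_iff.2 hp
  have h2 : √(h ^ 2 + 4 * ‖p.1‖ ^ 2 * ‖p.2‖ ^ 2) ^ 2 = h ^ 2 + 4 * ‖p.1‖ ^ 2 * ‖p.2‖ ^ 2 :=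
    Real.sq_sqrt (by positivity)
  have h0 : 0 ≤ √(h ^ 2 + 4 * ‖p.1‖ ^ 2 * ‖p.2‖ ^ 2) := Real.sqrt_nonneg _
  unfold handleScale
  generalize √(h ^ 2 + 4 * ‖p.1‖ ^ 2 * ‖p.2‖ ^ 2) = R at h0 h2
  have h3 : 0 < h + R := by linarith
  field_simp
  nlinarith

lemma handleMove_mul (hp : p.2 ≠ 0) (hh : 0 < h) :
    (handleMove p h).1 * (handleMove p h).2 = p.1 * p.2 := by
  have h1 := Real.sqrt_pos.2 (handleScale_pos hp hh)
  simp only [handleMove, smul_mul_smul_comm, inv_mul_cancel₀ h1.ne', one_smul]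

lemma norm_handleMove_mul (hp : p.2 ≠ 0) (hh : 0 < h) :
    ‖(handleMove p h).1‖ * ‖(handleMove p h).2‖ = ‖p.1‖ * ‖p.2‖ := by
  rw [← norm_mul, handleMove_mul hp hh, norm_mul]

lemma handleMove_height (hp : p.2 ≠ 0) (hh : 0 < h) :
    ‖(handleMove p h).2‖ ^ 2 - ‖(handleMove p h).1‖ ^ 2 = h := by
  have h1 := handleScale_pos hp hh
  have h2 := handleScale_spec hp hh
  simp only [handleMove, norm_smul, mul_pow, norm_inv, Real.norm_of_nonneg (Real.sqrt_nonneg _),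
    inv_pow, Real.sq_sqrt h1.le]
  refine Eq.trans ?_ h2
  ring

lemma handleMove_mem (hp : p ∈ handleRegion) (hp2 : p.2 ≠ 0) (hh : 0 < h) (h1 : h ≤ 1) :
    handleMove p h ∈ handleRegion := by
  refine ⟨?_, ?_⟩
  · rw [norm_handleMove_mul hp2 hh]
    exact hp.1
  · rw [handleMove_height hp2 hh, abs_of_pos hh]
    exact h1

lemma handleMove_snd_ne (hp : p.2 ≠ 0) (hh : 0 < h) : (handleMove p h).2 ≠ 0 :=
  smul_ne_zero (Real.sqrt_pos.2 (handleScale_pos hp hh)).ne' hp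

/-- Since ‖x‖‖y‖ is constant along a flow line, the scales compose multiplicatively. -/
lemma handleMove_handleMove (hp : p.2 ≠ 0) (hh : 0 < h) (h' : ℝ) :
    handleMove (handleMove p h) h' = handleMove p h' := by
  have h1 := handleScale_pos hp hh
  have h2 := norm_handleMove_mul hp hh
  have h3 : handleScale (handleMove p h) h' = handleScale p h' / handleScale p h := by
    have h4 : ‖(handleMove p h).2‖ ^ 2 = handleScale p h * ‖p.2‖ ^ 2 := by
      simp only [handleMove, norm_smul, mul_pow, Real.norm_of_nonneg (Real.sqrt_nonneg _),
        Real.sq_sqrt h1.le]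
    have h5 : 4 * ‖(handleMove p h).1‖ ^ 2 * ‖(handleMove p h).2‖ ^ 2 =
        4 * ‖p.1‖ ^ 2 * ‖p.2‖ ^ 2 := by
      rw [mul_assoc, ← mul_pow, h2]; ring
    unfold handleScale at h4 ⊢
    rw [h5, h4]
    have h6 := norm_pos_iff.2 hp
    field_simp
  have h7 := Real.sqrt_pos.2 h1
  have h8 : √(handleScale (handleMove p h) h') = √(handleScale p h') / √(handleScale p h) := by
    rw [h3, Real.sqrt_div' _ h1.le]
  unfold handleMove at h8 ⊢
  rw [h8]
  simp only [smul_smul]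
  congr 2 <;> field_simp

lemma handleMove_self (hp : p.2 ≠ 0) : handleMove p (‖p.2‖ ^ 2 - ‖p.1‖ ^ 2) = p := by
  have h1 := norm_pos_iff.2 hp
  have h2 : handleScale p (‖p.2‖ ^ 2 - ‖p.1‖ ^ 2) = 1 := by
    unfold handleScale
    rw [show (‖p.2‖ ^ 2 - ‖p.1‖ ^ 2) ^ 2 + 4 * ‖p.1‖ ^ 2 * ‖p.2‖ ^ 2 =
      (‖p.2‖ ^ 2 + ‖p.1‖ ^ 2) ^ 2 by ring, Real.sqrt_sq (by positivity)]
    field_simp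
    ring
  simp [handleMove, h2]

lemma contDiffAt_handleMove (hp : p.2 ≠ 0) (hh : 0 < h) :
    ContDiffAt ℝ ∞ (fun q : (ℂ × ℂ) × ℝ => handleMove q.1 q.2) (p, h) := by
  have h1 := norm_pos_iff.2 hp
  have hx : ContDiff ℝ ∞ (fun q : (ℂ × ℂ) × ℝ => ‖q.1.1‖ ^ 2) :=
    (contDiff_fst.comp contDiff_fst).norm_sq ℝ
  have hy : ContDiff ℝ ∞ (fun q : (ℂ × ℂ) × ℝ => ‖q.1.2‖ ^ 2) :=
    (contDiff_snd.comp contDiff_fst).norm_sq ℝ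
  have hs : ContDiffAt ℝ ∞ (fun q : (ℂ × ℂ) × ℝ => handleScale q.1 q.2) (p, h) := by
    unfold handleScale
    refine ContDiffAt.div (contDiffAt_snd.add (ContDiffAt.sqrt ?_ ?_)) ?_ ?_
    · exact ((contDiff_snd.pow 2).add ((contDiff_const.mul hx).mul hy)).contDiffAt
    · positivity
    · exact (contDiff_const.mul hy).contDiffAt
    · positivity
  have hp0 := handleScale_pos hp hh
  have hsq := hs.sqrt hp0.ne'
  unfold handleMove
  refine ContDiffAt.prodMk ?_ ?_
  · exact (hsq.inv (Real.sqrt_pos.2 hp0).ne').smul (contDiff_fst.comp contDiff_fst).contDiffAt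
  · exact hsq.smul (contDiff_snd.comp contDiff_fst).contDiffAt

end HandleMove

/-! ### Motions along a single wall -/

/-- The combinatorial data of a hypersurface in the surgery cobordism: the graph with background
level `level` that passes above the handles in `handles`, with its collar parameters. -/
structure Wall (l : ℕ) (κ : ℝ) where
  handles : Finset (Fin l)
  level : ℝ
  side : Set ℝ
  zero_mem : (0 : ℝ) ∈ side
  mul_mem : ∀ s ∈ side, ∀ r ∈ Icc (0 : ℝ) 1, s * r ∈ side
  abs_level_add_le : ∀ s ∈ side, |s| ≤ κ → |level + s| ≤ 1
  level_cases : level ≤ -κ ∨ (handles = ∅ ∧ κ ≤ level)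
  of_ne : handles ≠ ∅ → κ ≤ level + 1 ∧ level ≤ -κ
  sub_mem : ∀ h b : ℝ, |h| ≤ 1 → (handles = ∅ → b = 0) → h - (level + b) ∈ side

namespace Wall

variable {l : ℕ} {κ : ℝ} (a : Wall l κ)

/-- The level of a wall over the cocore of a handle. -/
def cocoreLevel (i : Fin l) : ℝ := a.level + if i ∈ a.handles then 1 else 0

lemma abs_add_le {b s : ℝ} (hb : b ∈ Icc (0 : ℝ) 1) (hb0 : a.handles = ∅ → b = 0)
    (hs : |s| ≤ κ) (hs' : s ∈ a.side) : |a.level + b + s| ≤ 1 := by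
  by_cases h : a.handles = ∅
  · rw [hb0 h, add_zero]
    exact a.abs_level_add_le s hs' hs
  · have h1 := a.of_ne h
    have h2 := abs_le.1 hs
    rw [abs_le]
    constructor <;> linarith [hb.1, hb.2]

/-- The level of a wall over a cocore avoids (−κ, κ). So a collar of small width that reaches a
cocore does so at positive height, away from the centre of the handle. -/
lemma cocoreLevel_pos {i : Fin l} (h : -κ < a.cocoreLevel i) :
    κ ≤ a.cocoreLevel i := by
  unfold cocoreLevel at h ⊢
  split_ifs at h ⊢ with hi
  · exact (a.of_ne (Finset.ne_empty_of_mem hi)).1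
  · rcases a.level_cases with h1 | h1
    · linarith
    · linarith [h1.2]

lemma abs_cocoreLevel_add_le {i : Fin l} {s : ℝ} (hs : |s| ≤ κ) (hs' : s ∈ a.side) :
    |a.cocoreLevel i + s| ≤ 1 := by
  unfold cocoreLevel
  refine a.abs_add_le ?_ ?_ hs hs'
  · split_ifs <;> simp
  · intro h
    simp [h]

end Wall

namespace SurgeryCobordism

variable {l : ℕ} {Y : Type*} [TopologicalSpace Y] [ChartedSpace (EuclideanSpace ℝ (Fin 3)) Y]
  {L : FramedLink l Y} {W : Type*} [TopologicalSpace W] [ChartedSpace (EuclideanHalfSpace 4) W]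
  (C : SurgeryCobordism L W) {κ : ℝ} (Λ : ShiftFlow κ) (a : Wall l κ)

lemma _root_.FramedLink.bumpSum_eq_zero {I : Finset (Fin l)} (h : I = ∅) (z : Y) :
    L.bumpSum I z = 0 := by
  subst h
  simp [FramedLink.bumpSum]

lemma wallCoord_mem_side (w : W) : C.wallCoord a.handles a.level w ∈ a.side := by
  by_cases hw : w ∈ C.base.target
  · obtain ⟨p, hp, rfl⟩ := C.exists_of_mem_base hw
    rw [C.wallCoord_base _ _ hp]
    exact a.sub_mem _ _ hp.1 fun h => FramedLink.bumpSum_eq_zero h _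
  · obtain ⟨i, y, h, rfl⟩ := C.exists_of_notMem_base hw
    rw [C.wallCoord_handle _ _ h]
    refine a.sub_mem _ _ h.2 fun h0 => ?_
    simp [h0]

/-- The image of a point of the base under the motion along a wall. -/
def baseMove (p : Y × ℝ) (t s : ℝ) : Y × ℝ :=
  (L.slide Λ a.handles p.1 t s, a.level + L.bumpSum a.handles (L.slide Λ a.handles p.1 t s) + s)

/-- The motion along a wall. -/
def wallMove (w : W) (s : ℝ) : W :=
  open Classical in
  if w ∈ C.base.target then
    C.base (baseMove (L := L) Λ a (C.base.symm w) (C.wallCoord a.handles a.level w) s)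
  else if h : ∃ i, w ∈ (C.handle i).target then
    C.handle h.choose (handleMove ((C.handle h.choose).symm w) (C.cut a.handles a.level w + s))
  else w

variable {Λ a} {s : ℝ} (hκ : 0 < κ)

lemma bumpSum_carrier {I : Finset (Fin l)} {i : Fin l} (u : Circle) :
    L.bumpSum I (L.tube i (u, 0)) = if i ∈ I then 1 else 0 := by
  rw [L.bumpSum_tube (by simp), norm_zero, radialCutoff_of_le (by norm_num)]

include hκ

/-- What could go wrong is landing on the removed part K_i × [0,1]. A point arriving over K_i has
not slid, so it started at negative height; then the wall is at level at most −κ there, and the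
motion, being shorter than κ, remains below 0. -/
lemma baseMove_mem {p : Y × ℝ} (hp : p ∈ L.baseRegion) {t : ℝ}
    (hpt : p.2 - (a.level + L.bumpSum a.handles p.1) = t) (ht : |t| < Λ.ε) (hs : |s| < Λ.ε)
    (hs' : s ∈ a.side) : baseMove (L := L) Λ a p t s ∈ L.baseRegion := by
  have hε := Λ.ε_le
  refine ⟨a.abs_add_le ⟨L.bumpSum_nonneg _ _, L.bumpSum_le_one _ _⟩
    (fun h => FramedLink.bumpSum_eq_zero h _) (by linarith) hs', fun hc => ?_⟩
  have hc' : L.slide Λ a.handles p.1 t s ∈ L.carrier := hc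
  have h1 := L.slide_of_mem_carrier hκ ht hs hc'
  change a.level + L.bumpSum a.handles (L.slide Λ a.handles p.1 t s) + s < 0
  rw [h1] at hc' ⊢
  have h2 := hp.2 hc'
  obtain ⟨i, u, hz⟩ := hc'
  rw [hz, bumpSum_carrier] at hpt ⊢
  have h3 : ¬ -κ < a.cocoreLevel i := fun h => by
    have h4 := a.cocoreLevel_pos h
    unfold Wall.cocoreLevel at h4
    have := (abs_lt.1 ht).1
    linarith
  unfold Wall.cocoreLevel at h3
  have := (abs_lt.1 hs).2
  linarith

omit hκ in
lemma wallMove_base {p : Y × ℝ} (hp : p ∈ L.baseRegion) :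
    C.wallMove Λ a (C.base p) s =
      C.base (baseMove (L := L) Λ a p (C.wallCoord a.handles a.level (C.base p)) s) := by
  rw [wallMove, if_pos (C.base_mem hp), C.symm_base hp]

lemma handle_level_pos {i : Fin l} {x y : ℂ} (h : (x, y) ∈ handleRegion) (hxy : ‖x‖ < ‖y‖)
    (hn : ‖x * y‖ ≤ 1 / 3) (ht : |C.wallCoord a.handles a.level (C.handle i (x, y))| < Λ.ε)
    (hs : |s| < Λ.ε) (hs' : s ∈ a.side) :
    0 < a.cocoreLevel i + s ∧ a.cocoreLevel i + s ≤ 1 := by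
  have hε := Λ.ε_le
  rw [C.wallCoord_handle _ _ h, radialCutoff_of_le hn] at ht
  have h1 := (abs_lt.1 ht).2
  have h2 : ‖x‖ ^ 2 < ‖y‖ ^ 2 := by
    have := norm_nonneg x
    nlinarith
  have h3 : -κ < a.cocoreLevel i := by
    unfold Wall.cocoreLevel
    linarith
  have h4 := a.cocoreLevel_pos h3
  have h5 := abs_lt.1 hs
  exact ⟨by linarith, (abs_le.1 (a.abs_cocoreLevel_add_le (by linarith) hs')).2⟩

omit hκ in
lemma snd_ne_zero_of_lt {x y : ℂ} (hxy : ‖x‖ < ‖y‖) : y ≠ 0 :=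
  norm_pos_iff.1 ((norm_nonneg x).trans_lt hxy)

/-- Near a cocore the cut-off is 1, the slide is trivial and the motion in the base changes only the
height. The hyperbolic flow does the same, since it fixes xy; the two definitions therefore agree,
which gives smoothness across the cocore. -/
lemma wallMove_handle {i : Fin l} {x y : ℂ} (h : (x, y) ∈ handleRegion) (hxy : ‖x‖ < ‖y‖)
    (hn : ‖x * y‖ ≤ 1 / 3) (ht : |C.wallCoord a.handles a.level (C.handle i (x, y))| < Λ.ε)
    (hs : |s| < Λ.ε) (hs' : s ∈ a.side) :
    C.wallMove Λ a (C.handle i (x, y)) s = C.handle i (handleMove (x, y) (a.cocoreLevel i + s)) := by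
  obtain ⟨h0, h1⟩ := C.handle_level_pos hκ h hxy hn ht hs hs'
  have hy := snd_ne_zero_of_lt hxy
  by_cases hx : x = 0
  · subst hx
    have hex : ∃ j, C.handle i (0, y) ∈ (C.handle j).target := ⟨i, C.handle_mem h⟩
    have hi : hex.choose = i := (C.cocore_mem_handle_iff h).1 hex.choose_spec
    rw [wallMove, if_neg (C.cocore_notMem_base i y h), dif_pos hex, hi, C.symm_handle h,
      C.cut_handle _ _ h, radialCutoff_of_le hn]
    rfl
  · obtain ⟨r, u, hr, rfl, hxn⟩ := exists_polar hx
    obtain ⟨h2, h3⟩ := glue_mem (L := L) (i := i) hr h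
    have hglue := C.glue i u r y hr h
    set t := C.wallCoord a.handles a.level (C.handle i ((r : ℂ) * u, y)) with htd
    have hn' : ‖(r : ℂ) * y‖ ≤ 1 / 3 := by
      simpa [Circle.norm_coe] using hn
    have hb : L.bumpSum a.handles (L.tube i (u, (r : ℂ) * y)) = if i ∈ a.handles then 1 else 0 := by
      rw [L.bumpSum_tube h2, radialCutoff_of_le hn']
    have hsl : L.slide Λ a.handles (L.tube i (u, (r : ℂ) * y)) t s =
        L.tube i (u, (r : ℂ) * y) := by
      refine L.slide_of_forall_notMem Λ _ (fun j hj => ?_) _ _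
      have hji := L.eq_of_mem_tube (L.mem_tube_of_bump_pos hj.1) (L.tube_mem h2)
      subst hji
      rw [L.bump_tube h2, radialCutoff_of_le hn'] at hj
      exact hj.2.false
    have hmv : C.wallMove Λ a (C.handle i ((r : ℂ) * u, y)) s =
        C.base (L.tube i (u, (r : ℂ) * y), a.cocoreLevel i + s) := by
      rw [hglue, C.wallMove_base h3, ← hglue, ← htd, baseMove, hsl, hb]
      rfl
    rw [hmv]
    set E := handleScale ((r : ℂ) * u, y) (a.cocoreLevel i + s) with hE
    have hEp : 0 < √E := Real.sqrt_pos.2 (handleScale_pos hy h0)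
    have hmem := handleMove_mem h hy h0 h1
    have hht := handleMove_height (p := ((r : ℂ) * u, y)) hy h0
    have hform : handleMove ((r : ℂ) * u, y) (a.cocoreLevel i + s) =
        (((√E)⁻¹ * r : ℝ) * (u : ℂ), (√E : ℂ) * y) := by
      simp only [handleMove, ← hE, Complex.real_smul]
      push_cast
      rw [mul_assoc]
    rw [hform] at hmem hht ⊢
    have hr' : 0 < (√E)⁻¹ * r := by positivity
    rw [C.glue i u _ _ hr' hmem]
    have e1 : (((√E)⁻¹ * r : ℝ) : ℂ) * ((√E : ℂ) * y) = r * y := by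
      have : (√E : ℂ) ≠ 0 := by exact_mod_cast hEp.ne'
      push_cast
      field_simp
    rw [e1]
    simp only [norm_ofReal_mul_circle hr'] at hht
    rw [hht]

omit hκ in
/-- A point is either in the base, or on a cocore. -/
lemma wallMove_cases (w : W) (ht : |C.wallCoord a.handles a.level w| < Λ.ε) :
    (∃ p ∈ L.baseRegion, w = C.base p ∧
      p.2 - (a.level + L.bumpSum a.handles p.1) = C.wallCoord a.handles a.level w) ∨
    ∃ i y, y ≠ 0 ∧ ((0 : ℂ), y) ∈ handleRegion ∧ w = C.handle i (0, y) ∧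
      ‖y‖ ^ 2 - a.cocoreLevel i = C.wallCoord a.handles a.level w := by
  have hε := Λ.ε_le
  have hε0 := Λ.ε_pos
  by_cases hw : w ∈ C.base.target
  · obtain ⟨p, hp, rfl⟩ := C.exists_of_mem_base hw
    exact Or.inl ⟨p, hp, rfl, (C.wallCoord_base _ _ hp).symm⟩
  · obtain ⟨i, y, h, rfl⟩ := C.exists_of_notMem_base hw
    have h1 := C.wallCoord_handle a.handles a.level (i := i) h
    rw [zero_mul, norm_zero, radialCutoff_of_le (by norm_num)] at h1
    refine Or.inr ⟨i, y, ?_, h, rfl, ?_⟩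
    · rintro rfl
      have h2 : C.wallCoord a.handles a.level (C.handle i (0, 0)) = -a.cocoreLevel i := by
        rw [h1, norm_zero, Wall.cocoreLevel]; ring
      rw [h2, abs_neg] at ht
      have h3 := abs_lt.1 ht
      have := a.cocoreLevel_pos (i := i) (by linarith)
      linarith
    · rw [h1, Wall.cocoreLevel]
      ring

lemma wallCoord_wallMove {w : W} (ht : |C.wallCoord a.handles a.level w| < Λ.ε) (hs : |s| < Λ.ε)
    (hs' : s ∈ a.side) : C.wallCoord a.handles a.level (C.wallMove Λ a w s) = s := by
  rcases C.wallMove_cases w ht with ⟨p, hp, rfl, hpt⟩ | ⟨i, y, hy, h, rfl, hyt⟩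
  · rw [C.wallMove_base hp, C.wallCoord_base _ _ (baseMove_mem hκ hp hpt ht hs hs'), baseMove]
    ring
  · have hxy : ‖(0 : ℂ)‖ < ‖y‖ := by rw [norm_zero]; exact norm_pos_iff.2 hy
    have hn : ‖(0 : ℂ) * y‖ ≤ 1 / 3 := by simp
    obtain ⟨h0, h1⟩ := C.handle_level_pos hκ h hxy hn ht hs hs'
    rw [C.wallMove_handle hκ h hxy hn ht hs hs']
    have hm := handleMove_mem h hy h0 h1
    have hh := handleMove_height (p := ((0 : ℂ), y)) hy h0
    have hmul := handleMove_mul (p := ((0 : ℂ), y)) hy h0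
    rw [← Prod.mk.eta (p := handleMove (0, y) _)] at hm ⊢
    rw [C.wallCoord_handle _ _ hm, hh, hmul, radialCutoff_of_le hn, Wall.cocoreLevel]
    ring

lemma wallMove_wallCoord {w : W} (ht : |C.wallCoord a.handles a.level w| < Λ.ε) :
    C.wallMove Λ a w (C.wallCoord a.handles a.level w) = w := by
  have hside := C.wallCoord_mem_side a w
  rcases C.wallMove_cases w ht with ⟨p, hp, rfl, hpt⟩ | ⟨i, y, hy, h, rfl, hyt⟩
  · rw [C.wallMove_base hp, baseMove, L.slide_self ht, ← hpt]
    congr 1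
    exact Prod.ext rfl (by simp only; ring)
  · have hxy : ‖(0 : ℂ)‖ < ‖y‖ := by rw [norm_zero]; exact norm_pos_iff.2 hy
    have hn : ‖(0 : ℂ) * y‖ ≤ 1 / 3 := by simp
    rw [C.wallMove_handle hκ h hxy hn ht ht hside, ← hyt]
    have := handleMove_self (p := ((0 : ℂ), y)) hy
    simp only [norm_zero] at this
    rw [show a.cocoreLevel i + (‖y‖ ^ 2 - a.cocoreLevel i) = ‖y‖ ^ 2 - 0 ^ 2 by ring, this]

lemma wallMove_wallMove {w : W} (ht : |C.wallCoord a.handles a.level w| < Λ.ε) (hs : |s| < Λ.ε)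
    (hs' : s ∈ a.side) {s₁ : ℝ} (hs₁ : |s₁| < Λ.ε) (hs₁' : s₁ ∈ a.side) :
    C.wallMove Λ a (C.wallMove Λ a w s) s₁ = C.wallMove Λ a w s₁ := by
  have hmc := C.wallCoord_wallMove hκ ht hs hs'
  rcases C.wallMove_cases w ht with ⟨p, hp, rfl, hpt⟩ | ⟨i, y, hy, h, rfl, hyt⟩
  · have hm := baseMove_mem hκ hp hpt ht hs hs'
    rw [C.wallMove_base hp] at hmc ⊢
    rw [C.wallMove_base hp, C.wallMove_base hm, hmc]
    congr 1
    simp only [baseMove]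
    rw [L.slide_slide hκ ht hs]
  · have hxy : ‖(0 : ℂ)‖ < ‖y‖ := by rw [norm_zero]; exact norm_pos_iff.2 hy
    have hn : ‖(0 : ℂ) * y‖ ≤ 1 / 3 := by simp
    obtain ⟨h0, h1⟩ := C.handle_level_pos hκ h hxy hn ht hs hs'
    rw [C.wallMove_handle hκ h hxy hn ht hs hs'] at hmc ⊢
    rw [C.wallMove_handle hκ h hxy hn ht hs₁ hs₁']
    have hm := handleMove_mem h hy h0 h1
    have hmul := handleMove_mul (p := ((0 : ℂ), y)) hy h0
    have hne := handleMove_snd_ne (p := ((0 : ℂ), y)) hy h0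
    have hcomp := handleMove_handleMove (p := ((0 : ℂ), y)) hy h0 (a.cocoreLevel i + s₁)
    have h01 : (handleMove ((0 : ℂ), y) (a.cocoreLevel i + s)).1 = 0 := by simp [handleMove]
    rw [← hcomp]
    generalize handleMove ((0 : ℂ), y) (a.cocoreLevel i + s) = q at hm hmul hne h01 hmc
    obtain ⟨x', y'⟩ := q
    simp only at h01 hne
    subst h01
    exact C.wallMove_handle hκ hm (by rw [norm_zero]; exact norm_pos_iff.2 hne) (by simp)
      (by rw [hmc]; exact hs) hs₁ hs₁'

end SurgeryCobordism

namespace SurgeryCobordism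

variable {l : ℕ} {Y : Type*} [TopologicalSpace Y] [ChartedSpace (EuclideanSpace ℝ (Fin 3)) Y]
  {L : FramedLink l Y} {W : Type*} [TopologicalSpace W] [ChartedSpace (EuclideanHalfSpace 4) W]
  (C : SurgeryCobordism L W) {κ : ℝ} {Λ : ShiftFlow κ} {a b : Wall l κ} (hκ : 0 < κ)

include hκ

lemma contMDiffOn_wallMove [T2Space Y] :
    ContMDiffOn ((𝓡∂ 4).prod 𝓘(ℝ, ℝ)) (𝓡∂ 4) ∞ (fun q : W × ℝ => C.wallMove Λ a q.1 q.2)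
      ({w | |C.wallCoord a.handles a.level w| < Λ.ε} ×ˢ (Ioo (-Λ.ε) Λ.ε ∩ a.side)) := by
  rintro ⟨w, s⟩ ⟨ht, hs, hs'⟩
  simp only [mem_ofPred_eq] at ht hs hs'
  set N : Set (W × ℝ) :=
    {w | |C.wallCoord a.handles a.level w| < Λ.ε} ×ˢ (Ioo (-Λ.ε) Λ.ε ∩ a.side) with hN
  have hsε : |s| < Λ.ε := abs_lt.2 hs
  have hfst : ContMDiffAt ((𝓡∂ 4).prod 𝓘(ℝ, ℝ)) (𝓡∂ 4) ∞ (fun q : W × ℝ => q.1) (w, s) :=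
    contMDiffAt_fst
  have hsnd : ContMDiffAt ((𝓡∂ 4).prod 𝓘(ℝ, ℝ)) 𝓘(ℝ, ℝ) ∞ (fun q : W × ℝ => q.2) (w, s) :=
    contMDiffAt_snd
  have hcoord : ContMDiffAt ((𝓡∂ 4).prod 𝓘(ℝ, ℝ)) 𝓘(ℝ, ℝ) ∞
      (fun q : W × ℝ => C.wallCoord a.handles a.level q.1) (w, s) :=
    (C.contMDiff_wallCoord a.handles a.level).contMDiffAt.comp (w, s) hfst
  by_cases hw : w ∈ C.base.target
  · have hwn : Prod.fst ⁻¹' C.base.target ∈ 𝓝 (w, s) :=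
      continuousAt_fst.preimage_mem_nhds (C.isOpen_base.mem_nhds hw)
    have hsymm : ContMDiffAt ((𝓡∂ 4).prod 𝓘(ℝ, ℝ)) ((𝓡 3).prod 𝓘(ℝ, ℝ)) ∞
        (fun q : W × ℝ => C.base.symm q.1) (w, s) :=
      ((C.smooth_base_symm w hw).contMDiffAt (C.isOpen_base.mem_nhds hw)).comp (w, s) hfst
    have hz : ContMDiffAt ((𝓡∂ 4).prod 𝓘(ℝ, ℝ)) (𝓡 3) ∞
        (fun q : W × ℝ => (C.base.symm q.1).1) (w, s) := contMDiffAt_fst.comp (w, s) hsymm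
    have hslide : ContMDiffAt ((𝓡∂ 4).prod 𝓘(ℝ, ℝ)) (𝓡 3) ∞
        (fun q : W × ℝ => L.slide Λ a.handles (C.base.symm q.1).1
          (C.wallCoord a.handles a.level q.1) q.2) (w, s) :=
      ContMDiffAt.comp_of_eq (x := (w, s))
        (L.contMDiffAt_slide (I := a.handles) hκ ht hsε (C.base.symm w).1)
        (hz.prodMk (hcoord.prodMk_space hsnd)) rfl
    have hmove : ContMDiffAt ((𝓡∂ 4).prod 𝓘(ℝ, ℝ)) ((𝓡 3).prod 𝓘(ℝ, ℝ)) ∞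
        (fun q : W × ℝ => baseMove (L := L) Λ a (C.base.symm q.1)
          (C.wallCoord a.handles a.level q.1) q.2) (w, s) := by
      refine hslide.prodMk ((contMDiffAt_const.add ?_).add hsnd)
      exact (L.contMDiff_bumpSum a.handles).contMDiffAt.comp (w, s) hslide
    have hmaps : MapsTo (fun q : W × ℝ => baseMove (L := L) Λ a (C.base.symm q.1)
        (C.wallCoord a.handles a.level q.1) q.2) (Prod.fst ⁻¹' C.base.target ∩ N)
        C.base.source := by
      rintro ⟨w', s'⟩ ⟨hw', ht', hs1, hs2⟩
      obtain ⟨p, hp, rfl⟩ := C.exists_of_mem_base (show w' ∈ C.base.target from hw')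
      simp only
      rw [C.symm_base hp, C.base_source]
      exact baseMove_mem hκ hp (C.wallCoord_base _ _ hp).symm ht' (abs_lt.2 hs1) hs2
    have h1 := ContMDiffWithinAt.comp (w, s)
      (C.smooth_base _ (hmaps (show (w, s) ∈ _ from ⟨hw, ht, hs, hs'⟩))) hmove.contMDiffWithinAt hmaps
    have h2 := h1.congr_of_eventuallyEq_of_mem (f₁ := fun q : W × ℝ => C.wallMove Λ a q.1 q.2)
      (Filter.eventually_of_mem self_mem_nhdsWithin (by
        rintro ⟨w', s'⟩ ⟨hw', -⟩
        exact if_pos hw')) ⟨hw, ht, hs, hs'⟩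
    exact (contMDiffWithinAt_inter' (mem_nhdsWithin_of_mem_nhds hwn)).1 (inter_comm _ N ▸ h2)
  · obtain ⟨i, y, h, rfl⟩ := C.exists_of_notMem_base hw
    -- The neighbourhood of the cocore point on which the formula in the handle is valid on and off
    -- the cocore.
    set R : Set W := (C.handle i).target ∩
      (C.handle i).symm ⁻¹' {p | ‖p.1‖ < ‖p.2‖ ∧ ‖p.1 * p.2‖ < 1 / 3} with hR
    have ho1 : IsOpen {p : ℂ × ℂ | ‖p.1‖ < ‖p.2‖} := isOpen_lt (by fun_prop) (by fun_prop)
    have ho2 : IsOpen {p : ℂ × ℂ | ‖p.1 * p.2‖ < 1 / 3} := isOpen_lt (by fun_prop) (by fun_prop)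
    have hRo : IsOpen R :=
      (C.smooth_handle_symm i).continuousOn.isOpen_inter_preimage (C.isOpen_handle i)
        (ho1.inter ho2)
    have hy : y ≠ 0 := by
      rcases C.wallMove_cases _ ht with ⟨p, hp, he, -⟩ | ⟨j, y', hy', h', he, -⟩
      · exact absurd (he ▸ C.base_mem hp) hw
      · have hij : i = j := by
          rw [← C.cocore_mem_handle_iff h', ← he]
          exact C.handle_mem h
        subst hij
        have := congrArg (C.handle i).symm he
        rw [C.symm_handle h, C.symm_handle h'] at this
        have hyy : y = y' := congrArg Prod.snd this
        rw [hyy]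
        exact hy'
    have hwR : C.handle i (0, y) ∈ R := by
      refine ⟨C.handle_mem h, ?_⟩
      rw [mem_preimage, C.symm_handle h]
      simp [hy]
    have hform : ∀ q : W × ℝ, q ∈ Prod.fst ⁻¹' R ∩ N →
        ((C.handle i).symm q.1).2 ≠ 0 ∧ 0 < a.cocoreLevel i + q.2 ∧
        handleMove ((C.handle i).symm q.1) (a.cocoreLevel i + q.2) ∈ (C.handle i).source ∧
        C.wallMove Λ a q.1 q.2 =
          C.handle i (handleMove ((C.handle i).symm q.1) (a.cocoreLevel i + q.2)) := by
      rintro ⟨w', s'⟩ ⟨⟨hw1, hw2⟩, ht', hs1, hs2⟩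
      obtain ⟨⟨x', y'⟩, hp, rfl⟩ := C.exists_of_mem_handle (show w' ∈ (C.handle i).target from hw1)
      rw [mem_preimage, C.symm_handle hp] at hw2
      simp only [mem_ofPred_eq] at hw2 ht' hs1 hs2
      have hlev := C.handle_level_pos hκ hp hw2.1 hw2.2.le ht' (abs_lt.2 hs1) hs2
      have hy' := snd_ne_zero_of_lt hw2.1
      simp only
      rw [C.symm_handle hp]
      refine ⟨hy', hlev.1, ?_, C.wallMove_handle hκ hp hw2.1 hw2.2.le ht' (abs_lt.2 hs1) hs2⟩
      rw [C.handle_source]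
      exact handleMove_mem hp hy' hlev.1 hlev.2
    have hmem : (C.handle i (0, y), s) ∈ Prod.fst ⁻¹' R ∩ N := ⟨hwR, ht, hs, hs'⟩
    obtain ⟨hy', hlev, hsrc, -⟩ := hform _ hmem
    have hsymm : ContMDiffAt ((𝓡∂ 4).prod 𝓘(ℝ, ℝ)) 𝓘(ℝ, ℂ × ℂ) ∞
        (fun q : W × ℝ => (C.handle i).symm q.1) (C.handle i (0, y), s) :=
      ((C.smooth_handle_symm i _ hwR.1).contMDiffAt ((C.isOpen_handle i).mem_nhds hwR.1)).comp
        (C.handle i (0, y), s) hfst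
    have hmove : ContMDiffAt ((𝓡∂ 4).prod 𝓘(ℝ, ℝ)) 𝓘(ℝ, ℂ × ℂ) ∞
        (fun q : W × ℝ => handleMove ((C.handle i).symm q.1) (a.cocoreLevel i + q.2))
        (C.handle i (0, y), s) :=
      ContMDiffAt.comp_of_eq (x := (C.handle i (0, y), s))
        (contDiffAt_handleMove hy' hlev).contMDiffAt
        (hsymm.prodMk_space (contMDiffAt_const.add hsnd)) rfl
    have h1 := ContMDiffWithinAt.comp (C.handle i (0, y), s)
      (C.smooth_handle i _ hsrc) hmove.contMDiffWithinAt (fun q hq => (hform q hq).2.2.1)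
    have h2 := h1.congr_of_eventuallyEq_of_mem (f₁ := fun q : W × ℝ => C.wallMove Λ a q.1 q.2)
      (Filter.eventually_of_mem self_mem_nhdsWithin fun q hq => (hform q hq).2.2.2) hmem
    have hwn : Prod.fst ⁻¹' R ∈ 𝓝 (C.handle i (0, y), s) :=
      continuousAt_fst.preimage_mem_nhds (hRo.mem_nhds hwR)
    exact (contMDiffWithinAt_inter' (mem_nhdsWithin_of_mem_nhds hwn)).1 (inter_comm _ N ▸ h2)

end SurgeryCobordism

/-! ### Commuting motions along different walls -/

/-- Two walls whose collars are disjoint or meet only half-way up the cut-off functions. -/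
def Wall.Separated {l : ℕ} {κ : ℝ} (a b : Wall l κ) : Prop :=
  κ ≤ |a.level - b.level| ∧ (|a.level - b.level| ≤ 1 - κ ∨ 1 + κ ≤ |a.level - b.level|)

lemma Wall.Separated.symm {l : ℕ} {κ : ℝ} {a b : Wall l κ} (h : a.Separated b) :
    b.Separated a := by
  unfold Wall.Separated at h ⊢
  rwa [abs_sub_comm]

namespace SurgeryCobordism

variable {l : ℕ} {Y : Type*} [TopologicalSpace Y] [ChartedSpace (EuclideanSpace ℝ (Fin 3)) Y]
  {L : FramedLink l Y} {W : Type*} [TopologicalSpace W] [ChartedSpace (EuclideanHalfSpace 4) W]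
  (C : SurgeryCobordism L W) {κ : ℝ} {Λ : ShiftFlow κ} {a b : Wall l κ}

/-- The collars of separated walls meet only in tubes. -/
lemma exists_tube_of_separated (hab : a.Separated b) {w : W}
    (ha : |C.wallCoord a.handles a.level w| < Λ.ε)
    (hb : |C.wallCoord b.handles b.level w| < Λ.ε) :
    ∃ i, ∃ p ∈ L.baseRegion, w = C.base p ∧ p.1 ∈ (L.tube i).target := by
  have hε := Λ.ε_le
  have hε0 := Λ.ε_pos
  have ha' := abs_lt.1 ha
  have hb' := abs_lt.1 hb
  obtain ⟨hs1, hs2⟩ := hab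
  rcases C.wallMove_cases w ha with ⟨p, hp, rfl, hpt⟩ | ⟨i, y, hy, h, rfl, hyt⟩
  · by_cases ht : ∃ i, p.1 ∈ (L.tube i).target
    · obtain ⟨i, hi⟩ := ht
      exact ⟨i, p, hp, rfl, hi⟩
    · push Not at ht
      rw [C.wallCoord_base _ _ hp, L.bumpSum_of_forall_notMem ht] at ha' hb'
      have : |a.level - b.level| < κ := abs_lt.2 ⟨by linarith, by linarith⟩
      linarith
  -- On a cocore the two coordinates differ by the difference of levels, possibly shifted by ±1.
  -- Separation keeps this away from 0 by more than the widths of the collars.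
  · exfalso
    rw [C.wallCoord_handle _ _ h, zero_mul, norm_zero, radialCutoff_of_le (by norm_num)] at ha' hb'
    rcases abs_cases (a.level - b.level) with h3 | h3 <;> split_ifs at ha' hb' <;>
      rcases hs2 with hs2 | hs2 <;> linarith [h3.1]

/-- Where the collars of separated walls meet. -/
lemma bump_mem_of_separated (hab : a.Separated b) {p : Y × ℝ} (hp : p ∈ L.baseRegion) {i : Fin l}
    (hi : p.1 ∈ (L.tube i).target) (ha : |C.wallCoord a.handles a.level (C.base p)| < Λ.ε)
    (hb : |C.wallCoord b.handles b.level (C.base p)| < Λ.ε) :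
    (i ∈ a.handles ↔ i ∉ b.handles) ∧ L.bump i p.1 ∈ Icc (3 * κ / 4) (1 - 3 * κ / 4) := by
  have hε := Λ.ε_le
  have hε0 := Λ.ε_pos
  have ha' := abs_lt.1 ha
  have hb' := abs_lt.1 hb
  obtain ⟨hs1, hs2⟩ := hab
  rw [C.wallCoord_base _ _ hp, L.bumpSum_of_mem hi] at ha' hb'
  have h0 := L.bump_nonneg i p.1
  have h1 := L.bump_le_one i p.1
  -- If i is on the same side of both walls, the coordinates differ by at least κ and the collars
  -- cannot meet. Otherwise χ_i is within 2ε ≤ κ/8 of ± the difference of levels, and only absolute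
  -- differences in [κ, 1−κ] are possible.
  by_cases hia : i ∈ a.handles <;> by_cases hib : i ∈ b.handles <;>
    simp only [hia, hib, if_true, if_false, not_true_eq_false, not_false_eq_true, iff_true,
      iff_false, true_and, false_and, iff_self, mem_Icc] at ha' hb' ⊢ <;>
    rcases abs_cases (a.level - b.level) with h3 | h3 <;> rcases hs2 with hs2 | hs2 <;>
    first
    | (exfalso; linarith [h3.1])
    | (constructor <;> linarith [h3.1])

lemma middle_subset (hκ : 0 < κ) {c : ℝ} (hc : c ∈ Icc (3 * κ / 4) (1 - 3 * κ / 4)) :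
    c ∈ Ioo (0 : ℝ) 1 :=
  ⟨by linarith [hc.1], by linarith [hc.2]⟩

/-- The motion along a wall in the middle of an annulus. -/
lemma wallMove_annulus (hκ : 0 < κ) {p : Y × ℝ} (hp : p ∈ L.baseRegion) {i : Fin l}
    (hi : L.bump i p.1 ∈ Icc (3 * κ / 4) (1 - 3 * κ / 4))
    (ha : |C.wallCoord a.handles a.level (C.base p)| < Λ.ε) {s : ℝ} (hs : |s| < Λ.ε)
    (hs' : s ∈ a.side) {t : ℝ} (ht : C.wallCoord a.handles a.level (C.base p) = t) :
    ∃ q ∈ L.baseRegion, C.wallMove Λ a (C.base p) s = C.base q ∧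
      q.1 ∈ (L.tube i).target ∧
      L.bump i q.1 = L.bump i p.1 + wallSign a.handles i * (s - t) ∧
      q = (L.annulusMove i p.1 (L.bump i p.1 + wallSign a.handles i * (s - t)),
        p.2 + if i ∈ a.handles then 0 else s - t) := by
  have hi' := middle_subset hκ hi
  have hpt := (C.wallCoord_base a.handles a.level hp).symm
  rw [ht] at hpt ha
  have hflow := Λ.flow_middle (L.bump i p.1) _ _ (FramedLink.wallSign_mul_lt (I := a.handles)
    (i := i) ha) (FramedLink.wallSign_mul_lt (I := a.handles) (i := i) hs) hi
  rw [← mul_sub] at hflow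
  have hsl : L.slide Λ a.handles p.1 t s =
      L.annulusMove i p.1 (L.bump i p.1 + wallSign a.handles i * (s - t)) := by
    rw [L.slide_of_mem Λ _ hi', hflow]
  have hzt := L.mem_tube_of_bump_pos hi'.1
  have hbs := L.bump_slide (I := a.handles) hκ ha hs hzt
  rw [hflow] at hbs
  have hst := L.slide_mem_tube (Λ := Λ) (I := a.handles) (t := t) (s := s) hzt
  refine ⟨baseMove (L := L) Λ a p t s, baseMove_mem hκ hp hpt ha hs hs', ?_, hst, hbs, ?_⟩
  · rw [C.wallMove_base hp, ht]
  · refine Prod.ext hsl ?_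
    simp only [baseMove]
    rw [L.bumpSum_of_mem hst, hbs]
    rw [L.bumpSum_of_mem hzt] at hpt
    unfold wallSign
    split_ifs at hpt ⊢ <;> linarith

/-- The reason for `wallSign`. For i in a the motion keeps the height h and changes χ_i by −(s−t),
which leaves the coordinate of b, h minus a constant, unchanged. For i not in a it changes h and χ_i
equally, which leaves h − χ_i unchanged. -/
lemma wallCoord_wallMove_of_separated (hκ : 0 < κ) (hab : a.Separated b) {w : W}
    (ha : |C.wallCoord a.handles a.level w| < Λ.ε)
    (hb : |C.wallCoord b.handles b.level w| < Λ.ε) {s : ℝ} (hs : |s| < Λ.ε) (hs' : s ∈ a.side) :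
    C.wallCoord b.handles b.level (C.wallMove Λ a w s) = C.wallCoord b.handles b.level w := by
  obtain ⟨i, p, hp, rfl, hi⟩ := C.exists_tube_of_separated hab ha hb
  obtain ⟨hx, hc⟩ := C.bump_mem_of_separated hab hp hi ha hb
  obtain ⟨q, hq, hmove, hqt, hqb, hqe⟩ := C.wallMove_annulus hκ hp hc ha hs hs' rfl
  rw [hmove, C.wallCoord_base _ _ hq, C.wallCoord_base _ _ hp, L.bumpSum_of_mem hqt,
    L.bumpSum_of_mem hi, hqb, hqe]
  unfold wallSign
  by_cases hia : i ∈ a.handles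
  · simp [hia, hx.1 hia]
  · have hib : i ∈ b.handles := by
      by_contra hib
      exact hia (hx.2 hib)
    simp only [hia, hib, if_true, if_false]
    ring

/-- Where both collars are present, both motions are translations of (χ_i, h) along the same ray of
the same tube. -/
lemma wallMove_comm (hκ : 0 < κ) (hab : a.Separated b) {w : W}
    (ha : |C.wallCoord a.handles a.level w| < Λ.ε)
    (hb : |C.wallCoord b.handles b.level w| < Λ.ε) {s s' : ℝ} (hs : |s| < Λ.ε) (hsa : s ∈ a.side)
    (hs' : |s'| < Λ.ε) (hsb : s' ∈ b.side) :
    C.wallMove Λ a (C.wallMove Λ b w s') s = C.wallMove Λ b (C.wallMove Λ a w s) s' := by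
  have ea := C.wallCoord_wallMove_of_separated hκ hab ha hb hs hsa
  have eb := C.wallCoord_wallMove_of_separated hκ hab.symm hb ha hs' hsb
  have fa := C.wallCoord_wallMove hκ ha hs hsa
  have fb := C.wallCoord_wallMove hκ hb hs' hsb
  obtain ⟨i, p, hp, rfl, hi⟩ := C.exists_tube_of_separated hab ha hb
  obtain ⟨-, hc⟩ := C.bump_mem_of_separated hab hp hi ha hb
  have hc' := middle_subset hκ hc
  obtain ⟨q, hq, hqm, hqt, hqb, hqe⟩ := C.wallMove_annulus hκ hp hc ha hs hsa rfl
  obtain ⟨r, hr, hrm, hrt, hrb, hre⟩ := C.wallMove_annulus hκ hp hc hb hs' hsb rfl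
  rw [hqm] at ea fa ⊢
  rw [hrm] at eb fb ⊢
  obtain ⟨-, hqc⟩ := C.bump_mem_of_separated (Λ := Λ) hab hq hqt (fa ▸ hs) (ea ▸ hb)
  obtain ⟨-, hrc⟩ := C.bump_mem_of_separated (Λ := Λ) hab hr hrt (eb ▸ ha) (fb ▸ hs')
  obtain ⟨q', -, hqm', -, -, hqe'⟩ := C.wallMove_annulus (Λ := Λ) (a := b) hκ hq hqc (ea ▸ hb)
    hs' hsb ea
  obtain ⟨r', -, hrm', -, -, hre'⟩ := C.wallMove_annulus (Λ := Λ) (a := a) hκ hr hrc (eb ▸ ha)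
    hs hsa eb
  rw [hqm', hrm', hqe', hre', hqb, hrb, hqe, hre, L.annulusMove_annulusMove hc',
    L.annulusMove_annulusMove hc']
  congr 2
  · congr 1
    ring
  · ring

/-- The collars of a family of pairwise separated walls. -/
def wallSystem [T2Space Y] {ι : Type*} (hκ : 0 < κ) (Λ : ShiftFlow κ) (A : ι → Wall l κ)
    (hA : ∀ a b, a ≠ b → (A a).Separated (A b)) : CollarSystem ι W where
  ε := Λ.ε
  ε_pos := Λ.ε_pos
  coord a := C.wallCoord (A a).handles (A a).level
  side a := (A a).side
  zero_mem a := (A a).zero_mem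
  mul_mem a := (A a).mul_mem
  smooth_coord _ := C.contMDiff_wallCoord _ _
  coord_mem _ w _ := C.wallCoord_mem_side _ w
  move a := C.wallMove Λ (A a)
  smooth_move _ := C.contMDiffOn_wallMove hκ
  coord_move _ _ _ hw hs hs' := C.wallCoord_wallMove hκ hw hs hs'
  move_coord _ _ hw := C.wallMove_wallCoord hκ hw
  move_move _ _ _ _ hw hs hs' hs₁ hs₁' := C.wallMove_wallMove hκ hw hs hs' hs₁ hs₁'
  coord_move_of_ne _ _ _ _ hab ha hb hs hs' :=
    C.wallCoord_wallMove_of_separated hκ (hA _ _ hab) ha hb hs hs'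
  move_comm _ _ _ _ _ hab ha hb hs hsa hs' hsb :=
    C.wallMove_comm hκ (hA _ _ hab) ha hb hs hsa hs' hsb

end SurgeryCobordism

/-! ### The walls of the cobordism and an adapted metric -/

/-- The wall of an internal vertex. -/
def internalWall {l : ℕ} (I : InternalVertex l) : Wall l (1 / 2 ^ l) where
  handles := I.1
  level := vertexLevel I.1
  side := univ
  zero_mem := mem_univ _
  mul_mem _ _ _ _ := mem_univ _
  abs_level_add_le s _ hs := by
    have h1 := le_vertexLevel I.2.1
    have h2 := vertexLevel_le I.1
    have h3 := abs_le.1 hs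
    exact abs_le.2 ⟨by linarith, by linarith⟩
  level_cases := Or.inl (vertexLevel_le I.1)
  of_ne _ := ⟨by linarith [le_vertexLevel I.2.1], vertexLevel_le I.1⟩
  sub_mem _ _ _ _ := mem_univ _

lemma one_div_two_pow_le (l : ℕ) : (1 : ℝ) / 2 ^ l ≤ 1 := by
  rw [div_le_one (by positivity)]
  exact one_le_pow₀ (by norm_num)

/-- The incoming boundary. -/
def incomingWall (l : ℕ) : Wall l (1 / 2 ^ l) where
  handles := ∅
  level := -1
  side := Ici 0
  zero_mem := mem_Ici.2 le_rfl
  mul_mem _ hs _ hr := mul_nonneg hs hr.1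
  abs_level_add_le s hs hs' := by
    have h1 := abs_le.1 hs'
    have h2 := one_div_two_pow_le l
    have h3 : 0 ≤ s := hs
    exact abs_le.2 ⟨by linarith, by linarith⟩
  level_cases := Or.inl (by linarith [one_div_two_pow_le l])
  of_ne h := absurd rfl h
  sub_mem h b hh hb := by
    rw [hb rfl, mem_Ici]
    linarith [(abs_le.1 hh).1]

/-- The outgoing boundary. -/
def outgoingWall (l : ℕ) : Wall l (1 / 2 ^ l) where
  handles := ∅
  level := 1
  side := Iic 0
  zero_mem := mem_Iic.2 le_rfl
  mul_mem _ hs _ hr := mul_nonpos_of_nonpos_of_nonneg hs hr.1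
  abs_level_add_le s hs hs' := by
    have h1 := abs_le.1 hs'
    have h2 := one_div_two_pow_le l
    have h3 : s ≤ 0 := hs
    exact abs_le.2 ⟨by linarith, by linarith⟩
  level_cases := Or.inr ⟨rfl, one_div_two_pow_le l⟩
  of_ne h := absurd rfl h
  sub_mem h b hh hb := by
    rw [hb rfl, mem_Iic]
    linarith [(abs_le.1 hh).2]

/-- The internal walls and the two ends. -/
def cobordismWall (l : ℕ) : InternalVertex l ⊕ Bool → Wall l (1 / 2 ^ l)
  | Sum.inl I => internalWall I
  | Sum.inr false => incomingWall l
  | Sum.inr true => outgoingWall l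

/-- Internal levels lie in [−1+κ, −κ]. They differ from one another and from −1 by between κ and
1−κ, and from 1 by at least 1+κ, which is out of reach of a bump of height 1. -/
lemma separated_cobordismWall {l : ℕ} (a b : InternalVertex l ⊕ Bool) (hab : a ≠ b) :
    (cobordismWall l a).Separated (cobordismWall l b) := by
  have hκ := one_div_two_pow_le l
  have hin : ∀ I : InternalVertex l, (internalWall I).Separated (incomingWall l) := by
    intro I
    have h1 := le_vertexLevel I.2.1
    have h2 := vertexLevel_le I.1
    have h3 : (0 : ℝ) < 1 / 2 ^ l := by positivity
    simp only [Wall.Separated, internalWall, incomingWall]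
    rw [abs_of_nonneg (by linarith)]
    exact ⟨by linarith, Or.inl (by linarith)⟩
  have hout : ∀ I : InternalVertex l, (internalWall I).Separated (outgoingWall l) := by
    intro I
    have h2 := vertexLevel_le I.1
    have h3 : (0 : ℝ) < 1 / 2 ^ l := by positivity
    simp only [Wall.Separated, internalWall, outgoingWall]
    rw [abs_of_nonpos (by linarith)]
    exact ⟨by linarith, Or.inr (by linarith)⟩
  have hio : (incomingWall l).Separated (outgoingWall l) := by
    simp only [Wall.Separated, incomingWall, outgoingWall]
    norm_num
    constructor
    · have := one_div_two_pow_le l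
      rw [one_div] at this
      linarith
    · right
      have := one_div_two_pow_le l
      rw [one_div] at this
      linarith
  rcases a with I | a <;> rcases b with J | b
  · have hne : I ≠ J := fun h => hab (h ▸ rfl)
    have h1 := le_vertexLevel I.2.1
    have h2 := vertexLevel_le I.1
    have h3 := le_vertexLevel J.2.1
    have h4 := vertexLevel_le J.1
    have h5 : (0 : ℝ) < 1 / 2 ^ l := by positivity
    exact ⟨vertexLevel_separated fun h => hne (Subtype.ext h),
      Or.inl (abs_le.2 ⟨by simp only [cobordismWall, internalWall]; linarith,
        by simp only [cobordismWall, internalWall]; linarith⟩)⟩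
  · cases b
    exacts [hin I, hout I]
  · cases a
    exacts [(hin J).symm, (hout J).symm]
  · cases a <;> cases b
    exacts [absurd rfl hab, hio, hio.symm, absurd rfl hab]

namespace SurgeryCobordism

variable {l : ℕ} {Y : Type*} [TopologicalSpace Y] [ChartedSpace (EuclideanSpace ℝ (Fin 3)) Y]
  {L : FramedLink l Y} {W : Type*} [TopologicalSpace W] [ChartedSpace (EuclideanHalfSpace 4) W]
  [IsManifold (𝓡∂ 4) ∞ W]

/-- All internal hypersurfaces and both ends enter one collar system, so a single metric is
cylindrical along all of them. -/
theorem nonempty_adaptedMetric [T2Space Y] [T2Space W] [CompactSpace W]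
    (C : SurgeryCobordism L W) : Nonempty (AdaptedMetric C) := by
  have hκ : (0 : ℝ) < 1 / 2 ^ l := by positivity
  obtain ⟨Λ⟩ := ShiftFlow.nonempty hκ
  obtain ⟨g, hg⟩ := (C.wallSystem hκ Λ (cobordismWall l) separated_cobordismWall).exists_metric
  have hI : ∀ I : InternalVertex l, Nonempty (CylindricalCollar g (C.hypersurface I) univ) := by
    intro I
    rw [C.hypersurface_eq I]
    exact hg (Sum.inl I)
  have hin : Nonempty (CylindricalCollar g C.incoming (Ici 0)) := by
    have : C.incoming = {w | C.wallCoord ∅ (-1) w = 0} := by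
      ext w
      simp only [incoming, wallCoord, cut_empty, mem_ofPred_eq, sub_eq_zero]
    rw [this]
    exact hg (Sum.inr false)
  have hout : Nonempty (CylindricalCollar g C.outgoing (Iic 0)) := by
    have : C.outgoing = {w | C.wallCoord ∅ 1 w = 0} := by
      ext w
      simp only [outgoing, wallCoord, cut_empty, mem_ofPred_eq, sub_eq_zero]
    rw [this]
    exact hg (Sum.inr true)
  exact ⟨⟨g, fun I => (hI I).some, hin.some, hout.some⟩⟩

end SurgeryCobordism

/-! ### Shrinking the given collars -/

namespace CylindricalCollar

variable {W : Type*} [TopologicalSpace W] [ChartedSpace (EuclideanHalfSpace 4) W]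
  [IsManifold (𝓡∂ 4) ∞ W] {g : SmoothMetric W} {S : Set W} (K : CylindricalCollar g S univ)

/-- The closed collar of half-width `δ`. -/
def closedSub (δ : ℝ) : Set W := {w | w ∈ K.chart.source ∧ |(K.chart w).2| ≤ δ}

lemma sub_subset_closedSub (δ : ℝ) : K.sub δ ⊆ K.closedSub δ := fun _ hw => ⟨hw.1, hw.2.le⟩

lemma isCompact_closedSub (hS : IsCompact S) {δ : ℝ} (hδ : δ < K.ε) :
    IsCompact (K.closedSub δ) := by
  have hsub : S ×ˢ Icc (-δ) δ ⊆ K.chart.target := by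
    rw [K.target_eq]
    exact prod_mono_right fun t ht => ⟨⟨by linarith [ht.1], by linarith [ht.2]⟩, mem_univ _⟩
  have h : K.closedSub δ = K.chart.symm '' (S ×ˢ Icc (-δ) δ) := by
    ext w
    constructor
    · rintro ⟨hw, ht⟩
      have h1 := K.chart.map_source hw
      rw [K.target_eq] at h1
      exact ⟨K.chart w, ⟨h1.1, abs_le.1 ht⟩, K.chart.left_inv hw⟩
    · rintro ⟨q, hq, rfl⟩
      refine ⟨K.chart.map_target (hsub hq), ?_⟩
      rw [K.chart.right_inv (hsub hq)]
      exact abs_le.2 hq.2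
  rw [h]
  exact (hS.prod isCompact_Icc).image_of_continuousOn (K.smooth_chart_symm.continuousOn.mono hsub)

lemma coord_eq_zero_iff {w : W} (hw : w ∈ K.chart.source) : (K.chart w).2 = 0 ↔ w ∈ S := by
  constructor
  · intro h
    have h1 := K.chart.map_source hw
    rw [K.target_eq] at h1
    obtain ⟨h2, h3⟩ := K.chart_self _ h1.1
    have h4 : K.chart (K.chart w).1 = K.chart w := by
      rw [h3]
      exact Prod.ext rfl h.symm
    exact K.chart.injOn h2 hw h4 ▸ h1.1
  · intro h
    rw [(K.chart_self w h).2]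

/-- The part of a compact collar outside O misses S, so |t| has a positive minimum on it; any
smaller width works. -/
lemma eventually_closedSub_subset [T2Space W] (hS : IsCompact S) {O : Set W} (hO : IsOpen O)
    (hSO : S ⊆ O) : ∀ᶠ δ in 𝓝[>] (0 : ℝ), K.closedSub δ ⊆ O := by
  have hε := K.ε_pos
  set Z := K.closedSub (K.ε / 2) ∩ Oᶜ with hZ
  have hZc : IsCompact Z := (K.isCompact_closedSub hS (by linarith)).inter_right hO.isClosed_compl
  obtain ⟨δ₀, hδ₀, hmin⟩ : ∃ δ₀ > 0, ∀ w ∈ Z, δ₀ ≤ |(K.chart w).2| := by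
    rcases Z.eq_empty_or_nonempty with h | h
    · exact ⟨1, one_pos, fun w hw => absurd (h ▸ hw) (notMem_empty w)⟩
    · have hcont : ContinuousOn (fun w => |(K.chart w).2|) Z :=
        fun w hw => ((K.contMDiffAt_coord hw.1.1).continuousAt.abs).continuousWithinAt
      obtain ⟨w, hw, hmin⟩ := hZc.exists_isMinOn h hcont
      refine ⟨_, abs_pos.2 fun h0 => ?_, fun w' hw' => hmin hw'⟩
      exact hw.2 (hSO ((K.coord_eq_zero_iff hw.1.1).1 h0))
  have h1 : Iio (min δ₀ (K.ε / 2)) ∈ 𝓝[>] (0 : ℝ) :=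
    nhdsWithin_le_nhds (Iio_mem_nhds (by positivity))
  filter_upwards [h1] with δ hδ w hw
  by_contra hwO
  have h2 : δ < δ₀ := lt_of_lt_of_le hδ (min_le_left _ _)
  have h3 : δ < K.ε / 2 := lt_of_lt_of_le hδ (min_le_right _ _)
  have h4 := hmin w ⟨⟨hw.1, hw.2.trans h3.le⟩, hwO⟩
  linarith [hw.2]

end CylindricalCollar

namespace AdaptedMetric

variable {l : ℕ} {Y : Type*} [TopologicalSpace Y] [ChartedSpace (EuclideanSpace ℝ (Fin 3)) Y]
  {L : FramedLink l Y} {W : Type*} [TopologicalSpace W] [ChartedSpace (EuclideanHalfSpace 4) W]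
  [IsManifold (𝓡∂ 4) ∞ W] {C : SurgeryCobordism L W} (A : AdaptedMetric C)

/-- The collars can be shrunk so that they are disjoint for disjoint hypersurfaces and from the
boundary. -/
lemma exists_collar_width [T2Space Y] [T2Space W] [CompactSpace W] :
    ∃ δ > 0, (∀ I, δ < (A.collar I).ε) ∧
      (∀ I J, I < J → Disjoint ((A.collar I).closedSub δ) ((A.collar J).closedSub δ)) ∧
      ∀ I, Disjoint ((A.collar I).closedSub δ) (C.incoming ∪ C.outgoing) := by
  have hS : ∀ I, IsCompact (C.hypersurface I) := fun I => by
    rw [C.hypersurface_eq I]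
    exact C.isCompact_wall _ _
  have h1 : ∀ᶠ δ in 𝓝[>] (0 : ℝ), ∀ I, δ < (A.collar I).ε :=
    Filter.eventually_all.2 fun I =>
      nhdsWithin_le_nhds (Iio_mem_nhds (A.collar I).ε_pos)
  have h2 : ∀ᶠ δ in 𝓝[>] (0 : ℝ), ∀ I J, I < J →
      Disjoint ((A.collar I).closedSub δ) ((A.collar J).closedSub δ) := by
    refine Filter.eventually_all.2 fun I => Filter.eventually_all.2 fun J => ?_
    by_cases hIJ : I < J
    · have hd : Disjoint (C.hypersurface I) (C.hypersurface J) :=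
        (C.disjoint_hypersurface_iff hIJ.ne).2 (Or.inl hIJ.le)
      obtain ⟨U, V, hU, hV, hSU, hSV, hUV⟩ :=
        SeparatedNhds.of_isCompact_isCompact (hS I) (hS J) hd
      filter_upwards [(A.collar I).eventually_closedSub_subset (hS I) hU hSU,
        (A.collar J).eventually_closedSub_subset (hS J) hV hSV] with δ hI hJ _
      exact hUV.mono hI hJ
    · exact Filter.Eventually.of_forall fun δ h => absurd h hIJ
  have hheight : Continuous C.height := by
    have h := (C.contMDiff_wallCoord ∅ 0).continuous
    have : C.wallCoord ∅ 0 = C.height := by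
      ext w
      rw [SurgeryCobordism.wallCoord, C.cut_empty, sub_zero]
    rwa [this] at h
  have hends : IsClosed (C.incoming ∪ C.outgoing) :=
    (isClosed_eq hheight continuous_const).union (isClosed_eq hheight continuous_const)
  have h3 : ∀ᶠ δ in 𝓝[>] (0 : ℝ), ∀ I,
      (A.collar I).closedSub δ ⊆ (C.incoming ∪ C.outgoing)ᶜ := by
    refine Filter.eventually_all.2 fun I =>
      (A.collar I).eventually_closedSub_subset (hS I) hends.isOpen_compl ?_
    rintro w (hw : C.height w = C.cutHeight I.1 w) (h | h)
    · have : C.height w < C.cutHeight I.1 w := C.incoming_subset_below I h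
      exact this.ne hw
    · have : C.cutHeight I.1 w < C.height w := C.outgoing_subset_above I h
      exact this.ne' hw
  obtain ⟨δ, ⟨⟨hδ1, hδ2⟩, hδ3⟩, hδ0⟩ :=
    (((h1.and h2).and h3).and self_mem_nhdsWithin).exists
  exact ⟨δ, hδ0, hδ1, hδ2, fun I => disjoint_left.2 fun w hw hE => hδ3 I hw hE⟩

variable {A} {δ : ℝ} (hδ : 0 < δ)

include hδ

lemma stretch_eq_of_notMem {E : InternalVertex l → ℝ} {w : W}
    (hw : ∀ I, w ∉ (A.collar I).closedSub δ) :
    A.stretch (fun I => neckProfile δ (E I)) w = A.metric.inner w := by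
  ext v v'
  rw [stretch_apply, add_eq_left]
  refine Finset.sum_eq_zero fun I _ => ?_
  split_ifs with h
  · have ht : δ ≤ |((A.collar I).chart w).2| := by
      by_contra hlt
      exact hw I ⟨h, (not_le.1 hlt).le⟩
    rw [neckProfile_of_le hδ _ ht]
    ring
  · rfl

/-- Away from a collar, the profile is locally constant. -/
lemma eventually_profile_eq_one [T2Space W] {X : Type*} [TopologicalSpace X] {q : X → W}
    {s : Set X} {x₀ : X} (hq : ContinuousWithinAt q s x₀) {I : InternalVertex l}
    (hS : IsCompact (C.hypersurface I)) (hδ' : δ < (A.collar I).ε)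
    (h : q x₀ ∉ (A.collar I).chart.source) (E : X → ℝ) :
    ∀ᶠ x in 𝓝[s] x₀, q x ∈ (A.collar I).chart.source →
      neckProfile δ (E x) ((A.collar I).chart (q x)).2 = 1 := by
  have hK := ((A.collar I).isCompact_closedSub hS hδ').isClosed.isOpen_compl
  filter_upwards [hq (hK.mem_nhds fun hmem => h hmem.1)] with x hx hsrc
  refine neckProfile_of_le hδ _ ?_
  by_contra hlt
  exact hx ⟨hsrc, (not_le.1 hlt).le⟩

end AdaptedMetric

/-! ### The family of metrics over the permutohedron -/

lemma permutohedron_subset {l : ℕ} {p : Fin l → ℝ} (hp : p ∈ permutohedron l) :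
    p ∈ permPolytope l := by
  rwa [← permutohedron_eq_permPolytope]

lemma slack_eq_zero_iff {l : ℕ} {I : Finset (Fin l)} {x : Fin l → ℝ} :
    slack I x = 0 ↔ ∑ i ∈ I, x i = (I.card : ℝ) * (I.card + 1) / 2 := sub_eq_zero

lemma mem_intrinsicInterior_face_iff {l : ℕ} {p : Fin l → ℝ} (hp : p ∈ permutohedron l)
    (F : PermFace l) : p ∈ intrinsicInterior ℝ F.1 ↔
      {I | neckLengths p I = ⊤} = ((faceChain F).1 : Set (InternalVertex l)) := by
  have hp' := permutohedron_subset hp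
  rw [mem_intrinsicInterior_face, Set.ext_iff]
  simp only [hp', true_and, mem_ofPred_eq, neckLengths_eq_top_iff hp', Finset.mem_coe]

lemma contDiffOn_toReal_neckLengths {l : ℕ} (I : InternalVertex l) :
    ContDiffOn ℝ ∞ (fun p => (neckLengths p I).toReal)
      (intrinsicInterior ℝ (permutohedron l)) := by
  intro p hp
  rw [mem_intrinsicInterior_permutohedron] at hp
  have h1 := contDiffAt_neckCoord (hp.2 I)
  have h2 := neckCoord_lt_one I.2.1 I.2.2 (hp.2 I)
  have h3 : ContDiffAt ℝ ∞ (fun p => neckCoord I.1 p / (1 - neckCoord I.1 p)) p :=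
    h1.div (contDiffAt_const.sub h1) (by linarith)
  refine h3.contDiffWithinAt.congr_of_mem (fun x hx => ?_)
    (mem_intrinsicInterior_permutohedron.2 hp)
  have hx' := neckCoord_mem_Icc (mem_intrinsicInterior_permutohedron.1 hx).1 I.1
  rw [neckLengths, toReal_neckLength hx'.1 hx'.2]

lemma continuousOn_iteratedDeriv_profile {l : ℕ} {δ : ℝ} (hδ : 0 < δ) (I : InternalVertex l)
    (k : ℕ) :
    ContinuousOn (fun q : (Fin l → ℝ) × ℝ => iteratedDeriv k (neckProfile δ (neckCoord I.1 q.1)) q.2)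
      {q | q.1 ∈ permutohedron l ∧ (neckLengths q.1 I = ⊤ → q.2 ≠ 0)} := by
  rintro ⟨p, t⟩ ⟨hp, ht⟩
  have hp' := permutohedron_subset hp
  have hE := neckCoord_mem_Icc hp' I.1
  have h1 := continuousAt_iteratedDeriv_neckProfile hδ k hE.1 hE.2 (t := t) (fun h => ht (by
    rwa [neckLengths_eq_top_iff hp', ← neckCoord_eq_one_iff I.2.1 I.2.2 hp']))
  have h2 : ContinuousAt (fun q : (Fin l → ℝ) × ℝ => (neckCoord I.1 q.1, q.2)) (p, t) :=
    ((continuousAt_neckCoord hp').comp continuousAt_fst).prodMk continuousAt_snd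
  exact (ContinuousAt.comp (x := (p, t)) (f := fun q : (Fin l → ℝ) × ℝ => (neckCoord I.1 q.1, q.2))
    (g := fun q : ℝ × ℝ => iteratedDeriv k (neckProfile δ q.1) q.2) h1 h2).continuousWithinAt

namespace AdaptedMetric

variable {l : ℕ} {Y : Type*} [TopologicalSpace Y] [ChartedSpace (EuclideanSpace ℝ (Fin 3)) Y]
  {L : FramedLink l Y} {W : Type*} [TopologicalSpace W] [ChartedSpace (EuclideanHalfSpace 4) W]
  [IsManifold (𝓡∂ 4) ∞ W] {C : SurgeryCobordism L W} (A : AdaptedMetric C)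

local notation "E4" => EuclideanSpace ℝ (Fin 4)

variable {δ : ℝ} (hδ : 0 < δ) (hδ' : ∀ I, δ < (A.collar I).ε)
  (hS : ∀ I, IsCompact (C.hypersurface I))
include hδ hδ' hS

omit hδ hδ' hS in
lemma neck_ne_zero {p : Fin l → ℝ} (hp : p ∈ permutohedron l) {w : W}
    (hw : ∀ I, neckLengths p I = ⊤ → w ∉ C.hypersurface I) {I : InternalVertex l}
    (hI : w ∈ (A.collar I).chart.source) (h : neckCoord I.1 p = 1) :
    ((A.collar I).chart w).2 ≠ 0 := by
  have hp' := permutohedron_subset hp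
  intro h0
  refine hw I ?_ (((A.collar I).coord_eq_zero_iff hI).1 h0)
  rwa [neckLengths_eq_top_iff hp', ← neckCoord_eq_one_iff I.2.1 I.2.2 hp']

lemma isRiemannianOn_stretch [T2Space W] {p : Fin l → ℝ} (hp : p ∈ permutohedron l) :
    IsRiemannianOn (A.stretch fun I => neckProfile δ (neckCoord I.1 p))
      (⋃ I ∈ {I | neckLengths p I = ⊤}, C.hypersurface I)ᶜ := by
  refine ⟨fun w _ => stretch_symm A _ w, fun w _ => stretch_pos A _ (fun I t =>
    one_le_neckProfile hδ (neckCoord_nonneg _ _) t) w, fun w hw => ?_⟩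
  have hw' : ∀ I, neckLengths p I = ⊤ → w ∉ C.hypersurface I := fun I hI hwI =>
    hw (mem_iUnion₂.2 ⟨I, hI, hwI⟩)
  refine contMDiffWithinAt_stretch A (q := fun w => w) hw
    (fun _ I => neckProfile δ (neckCoord I.1 p)) contMDiffWithinAt_id fun I => ?_
  by_cases hI : w ∈ (A.collar I).chart.source
  · refine Or.inl ⟨hI, ContMDiffAt.contMDiffWithinAt ?_⟩
    have hE := neckCoord_mem_Icc (permutohedron_subset hp) I.1
    have h1 := contDiffAt_neckProfile hδ hE.1 hE.2 (A.neck_ne_zero hp hw' hI)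
    have h2 : ContMDiffAt (𝓡∂ 4) 𝓘(ℝ, ℝ × ℝ) ∞
        (fun w => (neckCoord I.1 p, ((A.collar I).chart w).2)) w :=
      contMDiffAt_const.prodMk_space ((A.collar I).contMDiffAt_coord hI)
    exact ContMDiffAt.comp_of_eq h1.contMDiffAt h2 rfl
  · exact Or.inr (eventually_profile_eq_one hδ continuousWithinAt_id (hS I) (hδ' I) hI _)

lemma contMDiffOn_stretch [T2Space W] :
    ContMDiffOn (𝓘(ℝ, Fin l → ℝ).prod (𝓡∂ 4)) ((𝓡∂ 4).prod 𝓘(ℝ, E4 →L[ℝ] E4 →L[ℝ] ℝ)) ∞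
      (fun q : (Fin l → ℝ) × W =>
        (A.stretch fun I => neckProfile δ (neckCoord I.1 q.1)).toSection q.2)
      (intrinsicInterior ℝ (permutohedron l) ×ˢ univ) := by
  rintro ⟨p, w⟩ hq
  have hp := mem_intrinsicInterior_permutohedron.1 hq.1
  refine contMDiffWithinAt_stretch A (q := fun q : (Fin l → ℝ) × W => q.2) hq
    (fun q I => neckProfile δ (neckCoord I.1 q.1)) contMDiffWithinAt_snd fun I => ?_
  by_cases hI : w ∈ (A.collar I).chart.source
  · refine Or.inl ⟨hI, ContMDiffAt.contMDiffWithinAt ?_⟩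
    have hE := neckCoord_mem_Icc hp.1 I.1
    have hlt := neckCoord_lt_one I.2.1 I.2.2 (hp.2 I)
    have h1 := contDiffAt_neckProfile hδ (t := ((A.collar I).chart w).2) hE.1 hE.2
      (fun h => absurd h hlt.ne)
    have hfst : ContMDiffAt (𝓘(ℝ, Fin l → ℝ).prod (𝓡∂ 4)) 𝓘(ℝ, Fin l → ℝ) ∞
      (fun q : (Fin l → ℝ) × W => q.1) (p, w) := contMDiffAt_fst
    have hsnd : ContMDiffAt (𝓘(ℝ, Fin l → ℝ).prod (𝓡∂ 4)) (𝓡∂ 4) ∞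
      (fun q : (Fin l → ℝ) × W => q.2) (p, w) := contMDiffAt_snd
    have hc : ContMDiffAt (𝓘(ℝ, Fin l → ℝ).prod (𝓡∂ 4)) 𝓘(ℝ, ℝ) ∞
        (fun q : (Fin l → ℝ) × W => ((A.collar I).chart q.2).2) (p, w) :=
      ContMDiffAt.comp (p, w) (g := fun z => ((A.collar I).chart z).2)
        ((A.collar I).contMDiffAt_coord hI) hsnd
    have h2 : ContMDiffAt (𝓘(ℝ, Fin l → ℝ).prod (𝓡∂ 4)) 𝓘(ℝ, ℝ × ℝ) ∞
        (fun q : (Fin l → ℝ) × W => (neckCoord I.1 q.1, ((A.collar I).chart q.2).2)) (p, w) :=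
      ((contDiffAt_neckCoord (hp.2 I)).contMDiffAt.comp (p, w) hfst).prodMk_space
        hc
    exact ContMDiffAt.comp_of_eq (x := (p, w)) h1.contMDiffAt h2 rfl
  · exact Or.inr (eventually_profile_eq_one hδ continuousWithinAt_snd (hS I) (hδ' I) hI
      (fun q : (Fin l → ℝ) × W => neckCoord I.1 q.1))

lemma continuousOn_stretch [T2Space W] :
    ContinuousOn (fun q : (Fin l → ℝ) × W =>
        (A.stretch fun I => neckProfile δ (neckCoord I.1 q.1)).toSection q.2)
      {q | q.1 ∈ permutohedron l ∧ ∀ I, neckLengths q.1 I = ⊤ → q.2 ∉ C.hypersurface I} := by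
  rintro ⟨p, w⟩ hq
  obtain ⟨hp, hw⟩ := id hq
  refine continuousWithinAt_stretch A (q := fun q : (Fin l → ℝ) × W => q.2) hq
    (fun q I => neckProfile δ (neckCoord I.1 q.1)) continuousWithinAt_snd fun I => ?_
  by_cases hI : w ∈ (A.collar I).chart.source
  · refine Or.inl ⟨hI, ContinuousAt.continuousWithinAt ?_⟩
    have hp' := permutohedron_subset hp
    have hE := neckCoord_mem_Icc hp' I.1
    have h1 := (contDiffAt_neckProfile hδ hE.1 hE.2
      (A.neck_ne_zero hp hw hI)).continuousAt
    have hc : ContinuousAt (fun q : (Fin l → ℝ) × W => ((A.collar I).chart q.2).2) (p, w) :=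
      ContinuousAt.comp (x := (p, w)) (f := Prod.snd) (g := fun z => ((A.collar I).chart z).2)
        ((A.collar I).contMDiffAt_coord hI).continuousAt continuousAt_snd
    have h2 : ContinuousAt (fun q : (Fin l → ℝ) × W =>
        (neckCoord I.1 q.1, ((A.collar I).chart q.2).2)) (p, w) :=
      ((continuousAt_neckCoord hp').comp continuousAt_fst).prodMk
        hc
    exact ContinuousAt.comp (x := (p, w)) (f := fun q : (Fin l → ℝ) × W =>
      (neckCoord I.1 q.1, ((A.collar I).chart q.2).2))
      (g := fun q : ℝ × ℝ => neckProfile δ q.1 q.2) h1 h2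
  · exact Or.inr (eventually_profile_eq_one hδ continuousWithinAt_snd (hS I) (hδ' I) hI
      (fun q : (Fin l → ℝ) × W => neckCoord I.1 q.1))

lemma exists_smoothMetric [T2Space W] {p : Fin l → ℝ}
    (hp : p ∈ intrinsicInterior ℝ (permutohedron l)) :
    ∃ g : SmoothMetric W, ∀ w,
      g.inner w = A.stretch (fun I => neckProfile δ (neckCoord I.1 p)) w := by
  refine ⟨stretchMetric A (fun I => neckProfile δ (neckCoord I.1 p)) (fun I t =>
    one_le_neckProfile hδ (neckCoord_nonneg _ _) t) fun w => ?_, fun w => rfl⟩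
  have h := (A.isRiemannianOn_stretch hδ hδ' hS (intrinsicInterior_subset hp)).smooth
  have hempty : (⋃ I ∈ {I | neckLengths p I = ⊤}, C.hypersurface I)ᶜ = univ := by
    refine compl_univ_iff.2 (eq_empty_iff_forall_notMem.2 fun w hw => ?_)
    obtain ⟨I, hI, -⟩ := mem_iUnion₂.1 hw
    have hp' := mem_intrinsicInterior_permutohedron.1 hp
    exact absurd ((neckLengths_eq_top_iff hp'.1).1 hI) (hp'.2 I).ne'
  rw [hempty] at h
  exact (h w (mem_univ w)).contMDiffAt Filter.univ_mem

end AdaptedMetric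

theorem proposition2p2 {l : ℕ}
    {Y : Type*} [TopologicalSpace Y] [T2Space Y] [CompactSpace Y]
    [ChartedSpace (EuclideanSpace ℝ (Fin 3)) Y] [IsManifold (𝓡 3) ∞ Y]
    (L : FramedLink l Y)
    {W : Type*} [TopologicalSpace W] [T2Space W] [CompactSpace W]
    [ChartedSpace (EuclideanHalfSpace 4) W] [IsManifold (𝓡∂ 4) ∞ W]
    (C : SurgeryCobordism L W) :
    -- the internal hypersurfaces: each one breaks `W` into a lower and an upper cobordism, the
    -- handles being distributed as prescribed by `I`
    (∀ I : InternalVertex l,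
      IsCompact (C.hypersurface I) ∧ IsOpen (C.below I) ∧ IsOpen (C.above I) ∧
      C.incoming ⊆ C.below I ∧ C.outgoing ⊆ C.above I ∧
      (∀ i ∈ I.1, ∀ x : ℂ, (x, (0 : ℂ)) ∈ handleRegion → C.handle i (x, 0) ∈ C.below I) ∧
      (∀ i ∉ I.1, ∀ y : ℂ, ((0 : ℂ), y) ∈ handleRegion → C.handle i (0, y) ∈ C.above I)) ∧
    -- they are disjoint exactly when they are ordered
    (∀ I J : InternalVertex l, I ≠ J →
      (Disjoint (C.hypersurface I) (C.hypersurface J) ↔ I ≤ J ∨ J ≤ I)) ∧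
    (∀ I J : InternalVertex l, I < J →
      C.hypersurface I ⊆ C.below J ∧ C.hypersurface J ⊆ C.above I) ∧
    -- the face poset of the permutohedron is dual to the poset of chains
    ∃ e : PermFace l ≃o (VertexChain l)ᵒᵈ,
      (∀ (F : PermFace l) (I : InternalVertex l), I ∈ (OrderDual.ofDual (e F)).1 ↔
        ∀ x ∈ F.1, ∑ i ∈ I.1, x i = (I.1.card : ℝ) * (I.1.card + 1) / 2) ∧
      (∀ F : PermFace l,
        Module.finrank ℝ (vectorSpan ℝ F.1) + (OrderDual.ofDual (e F)).1.card = l - 1) ∧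
      -- metrics that are cylindrical near all the hypersurfaces exist, and each of them is the
      -- starting point of a family parametrized by the permutohedron
      Nonempty (AdaptedMetric C) ∧
      ∀ A : AdaptedMetric C,
        ∃ (δ : ℝ) (T : (Fin l → ℝ) → InternalVertex l → ℝ≥0∞)
          (prof : (Fin l → ℝ) → InternalVertex l → ℝ → ℝ),
          -- the necks: thin collars, disjoint for disjoint hypersurfaces
          0 < δ ∧ (∀ I, δ < (A.collar I).ε) ∧
          (∀ I J, I < J → Disjoint ((A.collar I).sub δ) ((A.collar J).sub δ)) ∧
          -- the neck lengths identify the permutohedron with the cubes glued along twin facets,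
          -- the cube of a maximal chain being the one at the corresponding vertex
          (∃ h : permutohedron l ≃ₜ NeckComplex l, ∀ p, (h p).1 = T p.1) ∧
          (∀ p ∈ permutohedron l, ∀ I : InternalVertex l,
            0 < T p I ↔ ∀ i ∈ I.1, ∀ j ∉ I.1, p i < p j) ∧
          -- the necks that are broken over the interior of a face form precisely its chain
          (∀ p ∈ permutohedron l, ∀ F : PermFace l, p ∈ intrinsicInterior ℝ F.1 ↔
            {I | T p I = ⊤} = ((OrderDual.ofDual (e F)).1 : Set (InternalVertex l))) ∧
          -- the metric over `p` is the initial one with necks of half-length `T p I` inserted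
          (∀ p ∈ permutohedron l, ∀ I, IsNeckProfile δ (T p I) (prof p I)) ∧
          (∀ p ∈ permutohedron l, IsRiemannianOn (A.stretch (prof p))
            (⋃ I ∈ {I | T p I = ⊤}, C.hypersurface I)ᶜ) ∧
          (∃ U : Set W, IsOpen U ∧ C.incoming ∪ C.outgoing ⊆ U ∧
            ∀ p ∈ permutohedron l, ∀ w ∈ U, A.stretch (prof p) w = A.metric.inner w) ∧
          -- over the interior: a smooth family of non-degenerate metrics on `W`
          (∀ p ∈ intrinsicInterior ℝ (permutohedron l),
            ∃ g : SmoothMetric W, ∀ w, g.inner w = A.stretch (prof p) w) ∧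
          (∀ I, ContDiffOn ℝ ∞ (fun p => (T p I).toReal)
            (intrinsicInterior ℝ (permutohedron l))) ∧
          ContMDiffOn (𝓘(ℝ, Fin l → ℝ).prod (𝓡∂ 4)) ((𝓡∂ 4).prod
              𝓘(ℝ, EuclideanSpace ℝ (Fin 4) →L[ℝ] EuclideanSpace ℝ (Fin 4) →L[ℝ] ℝ)) ∞
            (fun q : (Fin l → ℝ) × W => (A.stretch (prof q.1)).toSection q.2)
            (intrinsicInterior ℝ (permutohedron l) ×ˢ univ) ∧
          -- up to the boundary: the metric depends continuously on `p`, with all derivatives of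
          -- the profiles, away from the broken necks
          ContinuousOn (fun q : (Fin l → ℝ) × W => (A.stretch (prof q.1)).toSection q.2)
            {q | q.1 ∈ permutohedron l ∧
              ∀ I, T q.1 I = ⊤ → q.2 ∉ C.hypersurface I} ∧
          (∀ (I : InternalVertex l) (k : ℕ),
            ContinuousOn (fun q : (Fin l → ℝ) × ℝ => iteratedDeriv k (prof q.1 I) q.2)
              {q | q.1 ∈ permutohedron l ∧ (T q.1 I = ⊤ → q.2 ≠ 0)}) := by
  have hS : ∀ I, IsCompact (C.hypersurface I) := fun I => by
    rw [C.hypersurface_eq I]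
    exact C.isCompact_wall _ _
  refine ⟨fun I => ⟨hS I, C.isOpen_below I, C.isOpen_above I, C.incoming_subset_below I,
    C.outgoing_subset_above I, fun i hi x hx => C.core_mem_below I hi hx,
    fun i hi y hy => C.cocore_mem_above I hi hy⟩, fun I J => C.disjoint_hypersurface_iff,
    fun I J hIJ => ⟨C.hypersurface_subset_below hIJ, C.hypersurface_subset_above hIJ⟩,
    faceOrderIso l, ?_, finrank_vectorSpan_face, C.nonempty_adaptedMetric, fun A => ?_⟩
  · intro F I
    change I ∈ (faceChain F).1 ↔ _
    simp only [mem_faceChain, slack_eq_zero_iff]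
  obtain ⟨δ, hδ, hδε, hdisj, hends⟩ := A.exists_collar_width
  refine ⟨δ, neckLengths, fun p I => neckProfile δ (neckCoord I.1 p), hδ, hδε,
    fun I J hIJ => (hdisj I J hIJ).mono ((A.collar I).sub_subset_closedSub δ)
      ((A.collar J).sub_subset_closedSub δ), exists_homeomorph_neckComplex,
    fun p _ I => neckLengths_pos_iff, fun p hp F => mem_intrinsicInterior_face_iff hp F,
    fun p hp I => ?_, fun p hp => A.isRiemannianOn_stretch hδ hδε hS hp,
    -- The neighbourhood of the boundary is the complement of the closed collars: it is open and
    -- untouched by the stretching for every p.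
    ⟨(⋃ I, (A.collar I).closedSub δ)ᶜ, ?_, ?_, ?_⟩,
    fun p hp => A.exists_smoothMetric hδ hδε hS hp, contDiffOn_toReal_neckLengths,
    A.contMDiffOn_stretch hδ hδε hS, A.continuousOn_stretch hδ hδε hS,
    continuousOn_iteratedDeriv_profile hδ⟩
  · have hE := neckCoord_mem_Icc (permutohedron_subset hp) I.1
    exact isNeckProfile_neckProfile hδ hE.1 hE.2
  · exact (isCompact_iUnion fun I =>
      (A.collar I).isCompact_closedSub (hS I) (hδε I)).isClosed.isOpen_compl
  · intro w hw hmem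
    obtain ⟨I, hI⟩ := mem_iUnion.1 hmem
    exact disjoint_left.1 (hends I) hI hw
  · intro p _ w hw
    exact AdaptedMetric.stretch_eq_of_notMem hδ fun I hI => hw (mem_iUnion.2 ⟨I, hI⟩)

end
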